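/- **Setting.** There are $N$ agents, $\mathcal V=\{1,\dots,N\}$, with states in $\mathbb R^{n_x}$ and controls in $\mathbb R^{n_u}$ ($n_x,n_u\ge 1$). For each agent $i$ let $\mathcal I_S^i,\mathcal I_C^i,\mathcal I_O^i\subseteq\mathcal V$ be the sets of agents that enter its dynamics, its cost and its observation. The global dynamics are $x(t+1)=Ax(t)+Bu(t)+w(t)$, where the blocks satisfy $A_{ij}=0$, $B_{ij}=0$ for $j\notin\mathcal I_S^i$. The cost of agent $i$ is $c_i=x_{\mathcal I_C^i}^\top S_i x_{\mathcal I_C^i}+u_{\mathcal I_C^i}^\top R_i u_{\mathcal I_C^i}$ with $S_i\succeq 0$, $R_i\succ 0$. Gains $K$ (to be evaluated) and $K^{\rm play}$ (used to generate data) are structured: their $(i,j)$ blocks vanish for $j\notin\mathcal I_O^i$. Let $\mathcal I_Q^i$ be the set of agents $j$ from which some $k\in\mathcal I_C^i$ can be reached in zero or more steps along the edges $a\to b$, $a\in\mathcal I_S^b\cup\mathcal I_O^b$. Let $\mathcal I_{\rm GD}^i=\{j: i\in\mathcal I_Q^j\}$ and $\mathcal I_{\widehat Q}^i=\bigcup_{j\in\mathcal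 I_{\rm GD}^i}\mathcal I_Q^j$. A subscript $\mathcal I$ on a vector or matrix denotes restriction to the blocks in $\mathcal I$. Put $A_j=A_{\mathcal I_Q^j}$, $B_j=B_{\mathcal I_Q^j}$, $K_j=K_{\mathcal I_Q^j}$, $K^{\rm play}_j=K^{\rm play}_{\mathcal I_Q^j}$, $n_x^j=n_x|\mathcal I_Q^j|$, $n_u^j=n_u|\mathcal I_Q^j|$. $\|\cdot\|$ is the spectral norm of a matrix and the Euclidean norm of a vector, $\|\cdot\|_F$ is the Frobenius norm, and $\|M\|_+=1+\|M\|$. $\mathcal L(X,Y)=\sum_{k\ge0}X^kY(X^\top)^k$ is the solution of $P=XPX^\top+Y$. The vector $\mathrm{svec}(M)$ of a symmetric matrix $M$ lists the upper triangle of $M$ with off-diagonal entries multiplied by $\sqrt2$, and $\mathrm{smat}=\mathrm{svec}^{-1}$. A matrix $L$ is $(\tau,\rho)$-stable if $\tau\ge1$, $\rho\in(0,1)$ and $\|L^k\|\le\tau\rho^k$ for all $k\ge0$. *True parameters.* For a set $\mathcal I$ of agents and cost matrices $S,R$ on it let $$\mathcal Q(\mathcal I,S,R)=\begin{bmatrix}S&0\\0&R\end{bmatrix}+\begin{bmatrix}A_{\mathcal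 I}&B_{\mathcal I}\end{bmatrix}^\top\mathcal L\big((A_{\mathcal I}+B_{\mathcal I}K_{\mathcal I})^\top,\,S+K_{\mathcal I}^\top RK_{\mathcal I}\big)\begin{bmatrix}A_{\mathcal I}&B_{\mathcal I}\end{bmatrix}.$$ $Q_j^{\rm true}$ is $\mathcal Q$ on $\mathcal I_Q^j$ with $S_j,R_j$ (extended by zero), and $\hat q_i^{\rm true}=\mathrm{svec}(\widehat Q_i^{\rm true})$, where $\widehat Q_i^{\rm true}$ is $\mathcal Q$ on $\mathcal I_{\widehat Q}^i$ with $\sum_{j\in\mathcal I_{\rm GD}^i}S_j$, $\sum_{j\in\mathcal I_{\rm GD}^i}R_j$ (extended by zero). *Data.* $x(0)\sim\mathcal N(x_0,\Sigma_0)$, $u(t)=K^{\rm play}x(t)+\eta(t)$, $w(t)\sim\mathcal N(0,\sigma_w^2\mathbb I)$, $\eta(t)\sim\mathcal N(0,\sigma_\eta^2\mathbb I)$ with $0<\sigma_\eta\le\sigma_w$, where $x(0)$ and all $w(t),\eta(t)$ are independent. *Estimates.* For $j\in\mathcal V$ let $\phi_t=\mathrm{svec}(zz^\top)$ with $z=(x_{\mathcal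 I_Q^j}(t),u_{\mathcal I_Q^j}(t))$, $\psi_t=\mathrm{svec}(zz^\top)$ with $z=(x_{\mathcal I_Q^j}(t),K_jx_{\mathcal I_Q^j}(t))$, and $f=\mathrm{svec}\big(\sigma_w^2[\mathbb I;K_j][\mathbb I;K_j]^\top\big)$. Let $\mathbf\Phi,\mathbf\Psi_+,\mathbf F$ have the rows $\phi_1,\dots,\phi_T$; $\psi_2,\dots,\psi_{T+1}$; $f,\dots,f$; and let $\mathbf c_j=(c_j(1),\dots,c_j(T))^\top$. The LSTDQ estimate of agent $j$ is $q_j=(\mathbf\Phi^\top(\mathbf\Phi-\mathbf\Psi_++\mathbf F))^{-1}\mathbf\Phi^\top\mathbf c_j$. The indirect estimate is $\hat q_i^{\rm indirect}=\sum_{j\in\mathcal I_{\rm GD}^i}\mathrm{svec}\big((\mathcal P_Q^j)^\top\mathrm{smat}(q_j)\mathcal P_Q^j\big)$, where $\mathcal P_Q^j$ is the coordinate projection from the states and controls of $\mathcal I_{\widehat Q}^i$ to those of $\mathcal I_Q^j$. **Corollary.** There are universal constants $C>0$ and $p\in\mathbb N$ such that the following holds in every such setting. Let $\delta\in(0,1)$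 and $i\in\mathcal V$, and suppose that for every $j\in\mathcal I_{\rm GD}^i$ both $A_j+B_jK_j$ and $A_j+B_jK_j^{\rm play}$ are $(\tau_j,\rho_j)$-stable. Let $\mathfrak P_\infty^j=\mathcal L(A_j+B_jK_j^{\rm play},\sigma_w^2\mathbb I+\sigma_\eta^2B_jB_j^\top)$, let $M_0=\Sigma_0+x_0x_0^\top$ be the second moment matrix of $x(0)$ (so $M_0=\Sigma_0$ if $x_0=0$), and let $$\bar\sigma_j=\sqrt{\tau_j^2\rho_j^4\|(M_0)_{\mathcal I_Q^j}\|+\|\mathfrak P_\infty^j\|+\sigma_w^2+\sigma_\eta^2\|B_j\|^2},\qquad G_j=\frac{\|K_j^{\rm play}\|_+^2}{\sigma_\eta^2}\,\sigma_w\bar\sigma_j\,\frac{\tau_j^2\|K_j\|_+^4(1+\|A_j\|^2+\|B_j\|^2)}{\rho_j^2(1-\rho_j^2)},$$ $$\ell_j(T)=C\log^p\!\Big(e+\tfrac{|\mathcal I_{\rm GD}^i|\,T}{\delta}+\tfrac1{\sigma_\eta^4}+\tau_j+n_x^j+\|M_0\|+\|K_j^{\rm play}\|+\|\mathfrak P_\infty^j\|\Big).$$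 Suppose that the integers $T_j$ satisfy $$T_j\ \ge\ \ell_j(T_j)\,\max\{(n_x^j+n_u^j)^2,\ (n_x^j)^2(n_x^j+n_u^j)^2G_j^2\},\qquad j\in\mathcal I_{\rm GD}^i .$$ Then, whenever $T\ge\max_{j\in\mathcal I_{\rm GD}^i}T_j$, with probability at least $1-\delta$ all the matrices inverted in the estimates $q_j$, $j\in\mathcal I_{\rm GD}^i$, are invertible and $$\big\|\hat q_i^{\rm true}-\hat q_i^{\rm indirect}\big\|\ \le\ \sum_{j\in\mathcal I_{\rm GD}^i}\frac{\ell_j(T)\,(n_x^j+n_u^j)}{\sqrt T}\;G_j\;\|Q_j^{\rm true}\|_F .$$ -/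

import Mathlib

open MeasureTheory ProbabilityTheory Matrix

namespace CoopLQR

noncomputable section

/-! ### Matrix notation -/

open scoped Matrix.Norms.L2Operator in
/-- The spectral norm (largest singular value) of a real matrix. -/
def specNorm {m n : Type*} [Fintype m] [Fintype n] [DecidableEq n] (M : Matrix m n ℝ) : ℝ := ‖M‖

/-- `‖M‖₊ = 1 + ‖M‖`. -/
def specNormPlus {m n : Type*} [Fintype m] [Fintype n] [DecidableEq n] (M : Matrix m n ℝ) : ℝ :=
  1 + specNorm M

/-- The Frobenius norm. -/
def frobNorm {m n : Type*} [Fintype m] [Fintype n] (M : Matrix m n ℝ) : ℝ :=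
  Real.sqrt (∑ a, ∑ b, M a b ^ 2)

/-- The Euclidean norm of a coordinate vector. -/
def euclNorm {ι : Type*} [Fintype ι] (v : ι → ℝ) : ℝ := ‖WithLp.toLp 2 v‖

/-- `L` is `(τ, ρ)`-stable. -/
def IsTauRhoStable {n : Type*} [Fintype n] [DecidableEq n] (τ ρ : ℝ) (L : Matrix n n ℝ) : Prop :=
  1 ≤ τ ∧ 0 < ρ ∧ ρ < 1 ∧ ∀ k : ℕ, specNorm (L ^ k) ≤ τ * ρ ^ k

/-- The solution `P = ∑ₖ Xᵏ Y (Xᵀ)ᵏ` of the discrete Lyapunov equation `P = X P Xᵀ + Y`. -/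
def lyap {n : Type*} [Fintype n] [DecidableEq n] (X Y : Matrix n n ℝ) : Matrix n n ℝ :=
  ∑' k : ℕ, X ^ k * Y * Xᵀ ^ k

/-- `svec` of a symmetric matrix: the diagonal entries and `√2` times the off-diagonal entries of
the upper triangle. The positions of the upper triangle are indexed by unordered pairs. -/
def svec {ι : Type*} [DecidableEq ι] (M : Matrix ι ι ℝ) : Sym2 ι → ℝ :=
  Sym2.lift ⟨fun a b => if a = b then M a b else (M a b + M b a) / Real.sqrt 2, by
    intro a b
    by_cases h : a = b
    · subst h; rfl
    · simp only [if_neg h, if_neg (Ne.symm h), add_comm]⟩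

/-- The inverse operation of `svec`. -/
def smat {ι : Type*} [DecidableEq ι] (q : Sym2 ι → ℝ) : Matrix ι ι ℝ :=
  Matrix.of fun a b => if a = b then q s(a, b) else q s(a, b) / Real.sqrt 2

/-! ### LSTDQ for one linear system with state index `ι` and control index `κ` -/

section LSTDQ

variable {ι κ : Type*} [Fintype ι] [DecidableEq ι] [Fintype κ] [DecidableEq κ]

/-- `svec ([x; u] [x; u]ᵀ)`. -/
def feature (x : ι → ℝ) (u : κ → ℝ) : Sym2 (ι ⊕ κ) → ℝ :=
  svec (vecMulVec (Sum.elim x u) (Sum.elim x u))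

/-- `Φ`, with rows `φ₁, …, φ_T`. -/
def phiMat (T : ℕ) (x : ℕ → ι → ℝ) (u : ℕ → κ → ℝ) : Matrix (Fin T) (Sym2 (ι ⊕ κ)) ℝ :=
  Matrix.of fun t => feature (x (t + 1)) (u (t + 1))

/-- `Ψ₊`, with rows `ψ₂, …, ψ_{T+1}`. -/
def psiMat (T : ℕ) (K : Matrix κ ι ℝ) (x : ℕ → ι → ℝ) : Matrix (Fin T) (Sym2 (ι ⊕ κ)) ℝ :=
  Matrix.of fun t => feature (x (t + 2)) (K *ᵥ x (t + 2))

/-- `F`, all of whose rows are `svec (σ_w² [I; K] [I; K]ᵀ)`. -/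
def offsetMat (T : ℕ) (K : Matrix κ ι ℝ) (σw : ℝ) : Matrix (Fin T) (Sym2 (ι ⊕ κ)) ℝ :=
  Matrix.of fun _ => svec (σw ^ 2 • (fromRows 1 K * (fromRows 1 K)ᵀ))

/-- `Φᵀ (Φ - Ψ₊ + F)`. -/
def lstdqMat (T : ℕ) (K : Matrix κ ι ℝ) (σw : ℝ) (x : ℕ → ι → ℝ) (u : ℕ → κ → ℝ) :
    Matrix (Sym2 (ι ⊕ κ)) (Sym2 (ι ⊕ κ)) ℝ :=
  (phiMat T x u)ᵀ * (phiMat T x u - psiMat T K x + offsetMat T K σw)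

/-- The LSTDQ estimate `(Φᵀ (Φ - Ψ₊ + F))⁻¹ Φᵀ 𝐜`, `𝐜 = (c₁, …, c_T)`, of the parameter of the
Q-function of the policy `K`. -/
def lstdq (T : ℕ) (K : Matrix κ ι ℝ) (σw : ℝ) (x : ℕ → ι → ℝ) (u : ℕ → κ → ℝ) (c : ℕ → ℝ) :
    Sym2 (ι ⊕ κ) → ℝ :=
  (lstdqMat T K σw x u)⁻¹ *ᵥ ((phiMat T x u)ᵀ *ᵥ fun t : Fin T => c (t + 1))

/-- The matrix `diag(S, R) + [A B]ᵀ P [A B]`, with `P = (A + B K)ᵀ P (A + B K) + S + Kᵀ R K`, of the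
quadratic Q-function of the policy `u = K x`. -/
def qMat (A : Matrix ι ι ℝ) (B : Matrix ι κ ℝ) (K : Matrix κ ι ℝ) (S : Matrix ι ι ℝ)
    (R : Matrix κ κ ℝ) : Matrix (ι ⊕ κ) (ι ⊕ κ) ℝ :=
  fromBlocks S 0 0 R +
    (fromCols A B)ᵀ * lyap (A + B * K)ᵀ (S + Kᵀ * R * K) * fromCols A B

end LSTDQ

/-! ### The multi-agent system -/

/-- Indices of the coordinates of the stacked vector `v_s`, for a set `s` of agents with
`n`-dimensional components. -/
abbrev Idx {N : ℕ} (s : Finset (Fin N)) (n : ℕ) : Type := {i : Fin N // i ∈ s} × Fin n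

/-- The sub-vector `v_s` of a global vector `v`. -/
def subVec {N n : ℕ} (s : Finset (Fin N)) (v : Fin N × Fin n → ℝ) : Idx s n → ℝ :=
  fun p => v (p.1.1, p.2)

/-- The sub-matrix of a global block matrix with row and column blocks in `s`. -/
def subMat {N m n : ℕ} (s : Finset (Fin N)) (M : Matrix (Fin N × Fin m) (Fin N × Fin n) ℝ) :
    Matrix (Idx s m) (Idx s n) ℝ :=
  M.submatrix (fun p => (p.1.1, p.2)) (fun p => (p.1.1, p.2))

/-- The projection `P^n_{s₁,s₂}`, which maps `v_{s₂}` to `v_{s₁}` if `s₁ ⊆ s₂`. -/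
def proj {N : ℕ} (s₁ s₂ : Finset (Fin N)) (n : ℕ) : Matrix (Idx s₁ n) (Idx s₂ n) ℝ :=
  Matrix.of fun p q => if p.1.1 = q.1.1 ∧ p.2 = q.2 then 1 else 0

/-- `N` agents with `nx`-dimensional states and `nu`-dimensional controls, linear dynamics and
quadratic costs, together with their state, cost and observation couplings. -/
structure System (N nx nu : ℕ) where
  setS : Fin N → Finset (Fin N)
  setC : Fin N → Finset (Fin N)
  setO : Fin N → Finset (Fin N)
  A : Matrix (Fin N × Fin nx) (Fin N × Fin nx) ℝ
  B : Matrix (Fin N × Fin nx) (Fin N × Fin nu) ℝ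
  A_supp : ∀ i j a b, j ∉ setS i → A (i, a) (j, b) = 0
  B_supp : ∀ i j a b, j ∉ setS i → B (i, a) (j, b) = 0
  S : ∀ i, Matrix (Idx (setC i) nx) (Idx (setC i) nx) ℝ
  R : ∀ i, Matrix (Idx (setC i) nu) (Idx (setC i) nu) ℝ
  S_psd : ∀ i, (S i).PosSemidef
  R_pd : ∀ i, (R i).PosDef

namespace System

variable {N nx nu : ℕ} (M : System N nx nu)

/-- A gain in which the control of agent `i` uses only the states that agent `i` observes. -/
def IsStructuredGain (K : Matrix (Fin N × Fin nu) (Fin N × Fin nx) ℝ) : Prop :=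
  ∀ i j a b, j ∉ M.setO i → K (i, a) (j, b) = 0

/-- The cost of agent `i` at a global state and control. -/
def cost (i : Fin N) (x : Fin N × Fin nx → ℝ) (u : Fin N × Fin nu → ℝ) : ℝ :=
  subVec (M.setC i) x ⬝ᵥ (M.S i *ᵥ subVec (M.setC i) x) +
    subVec (M.setC i) u ⬝ᵥ (M.R i *ᵥ subVec (M.setC i) u)

/-- There is an edge from `j` to `i` in the union of the state graph and the observation graph. -/
def EdgeSO (j i : Fin N) : Prop := j ∈ M.setS i ∨ j ∈ M.setO i

open Classical in
/-- The value dependence set `I_Q^i`: the agents from which some agent of `I_C^i` can be reached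
(in zero or more steps) in the union of the state graph and the observation graph. -/
def IQ (i : Fin N) : Finset (Fin N) :=
  Finset.univ.filter fun j => ∃ k ∈ M.setC i, Relation.ReflTransGen M.EdgeSO j k

/-- The gradient dependence set `I_GD^i`. -/
def IGD (i : Fin N) : Finset (Fin N) := Finset.univ.filter fun j => i ∈ M.IQ j

/-- The set `I_Q̂^i`, the union of `I_Q^j` over `j ∈ I_GD^i`. -/
def IQhat (i : Fin N) : Finset (Fin N) := (M.IGD i).biUnion M.IQ

/-- The state cost of agent `j`, as a quadratic form in `x_s`, for `I_C^j ⊆ s`. -/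
def costS (j : Fin N) (s : Finset (Fin N)) : Matrix (Idx s nx) (Idx s nx) ℝ :=
  (proj (M.setC j) s nx)ᵀ * M.S j * proj (M.setC j) s nx

/-- The control cost of agent `j`, as a quadratic form in `u_s`, for `I_C^j ⊆ s`. -/
def costR (j : Fin N) (s : Finset (Fin N)) : Matrix (Idx s nu) (Idx s nu) ℝ :=
  (proj (M.setC j) s nu)ᵀ * M.R j * proj (M.setC j) s nu

/-- The matrix `Q_j^true` of the local Q-function of agent `j` under the policy `K`. -/
def qTrue (K : Matrix (Fin N × Fin nu) (Fin N × Fin nx) ℝ) (j : Fin N) :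
    Matrix (Idx (M.IQ j) nx ⊕ Idx (M.IQ j) nu) (Idx (M.IQ j) nx ⊕ Idx (M.IQ j) nu) ℝ :=
  qMat (subMat (M.IQ j) M.A) (subMat (M.IQ j) M.B) (subMat (M.IQ j) K)
    (M.costS j (M.IQ j)) (M.costR j (M.IQ j))

/-- The matrix `Q̂_i^true` of `Q̂_i`, the Q-function of the summed costs of the agents in `I_GD^i`,
under the policy `K`. -/
def qHatTrue (K : Matrix (Fin N × Fin nu) (Fin N × Fin nx) ℝ) (i : Fin N) :
    Matrix (Idx (M.IQhat i) nx ⊕ Idx (M.IQhat i) nu)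
      (Idx (M.IQhat i) nx ⊕ Idx (M.IQhat i) nu) ℝ :=
  qMat (subMat (M.IQhat i) M.A) (subMat (M.IQhat i) M.B) (subMat (M.IQhat i) K)
    (∑ j ∈ M.IGD i, M.costS j (M.IQhat i)) (∑ j ∈ M.IGD i, M.costR j (M.IQhat i))

/-- `Φᵀ (Φ - Ψ₊ + F)` for agent `j`, from the data of the agents in `I_Q^j`. -/
def agentLstdqMat (K : Matrix (Fin N × Fin nu) (Fin N × Fin nx) ℝ) (σw : ℝ) (T : ℕ)
    (x : ℕ → Fin N × Fin nx → ℝ) (u : ℕ → Fin N × Fin nu → ℝ) (j : Fin N) :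
    Matrix (Sym2 (Idx (M.IQ j) nx ⊕ Idx (M.IQ j) nu))
      (Sym2 (Idx (M.IQ j) nx ⊕ Idx (M.IQ j) nu)) ℝ :=
  lstdqMat T (subMat (M.IQ j) K) σw (fun t => subVec (M.IQ j) (x t))
    (fun t => subVec (M.IQ j) (u t))

/-- The LSTDQ estimate `q_j` of agent `j`, from its own costs and the data of the agents in
`I_Q^j`. -/
def agentLstdq (K : Matrix (Fin N × Fin nu) (Fin N × Fin nx) ℝ) (σw : ℝ) (T : ℕ)
    (x : ℕ → Fin N × Fin nx → ℝ) (u : ℕ → Fin N × Fin nu → ℝ) (j : Fin N) :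
    Sym2 (Idx (M.IQ j) nx ⊕ Idx (M.IQ j) nu) → ℝ :=
  lstdq T (subMat (M.IQ j) K) σw (fun t => subVec (M.IQ j) (x t))
    (fun t => subVec (M.IQ j) (u t)) (fun t => M.cost j (x t) (u t))

/-- The block diagonal projection from `(x, u)` of the agents in `I_Q̂^i` to `(x, u)` of the agents
in `I_Q^j`. -/
def projQ (i j : Fin N) :
    Matrix (Idx (M.IQ j) nx ⊕ Idx (M.IQ j) nu) (Idx (M.IQhat i) nx ⊕ Idx (M.IQhat i) nu) ℝ :=
  fromBlocks (proj (M.IQ j) (M.IQhat i) nx) 0 0 (proj (M.IQ j) (M.IQhat i) nu)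

/-- The indirect estimate of `svec Q̂_i^true`, assembled from the estimates `q_j`, `j ∈ I_GD^i`. -/
def qIndirect (K : Matrix (Fin N × Fin nu) (Fin N × Fin nx) ℝ) (σw : ℝ) (T : ℕ)
    (x : ℕ → Fin N × Fin nx → ℝ) (u : ℕ → Fin N × Fin nu → ℝ) (i : Fin N) :
    Sym2 (Idx (M.IQhat i) nx ⊕ Idx (M.IQhat i) nu) → ℝ :=
  ∑ j ∈ M.IGD i,
    svec ((M.projQ i j)ᵀ * smat (M.agentLstdq K σw T x u j) * M.projQ i j)

/-- The data-generating process: `x(0) ~ N(x₀, Σ₀)`, `u(t) = K_play x(t) + η(t)` and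
`x(t+1) = A x(t) + B u(t) + w(t)`, where `x(0)` and all `w(t) ~ N(0, σ_w² I)` and
`η(t) ~ N(0, σ_η² I)` are independent. -/
structure IsRollout {Ω : Type*} [MeasurableSpace Ω] (μ : Measure Ω)
    (Kplay : Matrix (Fin N × Fin nu) (Fin N × Fin nx) ℝ) (σw ση : ℝ)
    (x₀ : Fin N × Fin nx → ℝ) (Sigma₀ : Matrix (Fin N × Fin nx) (Fin N × Fin nx) ℝ)
    (x w : ℕ → Ω → Fin N × Fin nx → ℝ) (u η : ℕ → Ω → Fin N × Fin nu → ℝ) : Prop where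
  law_init : HasLaw (fun ω => WithLp.toLp 2 (x 0 ω))
    (multivariateGaussian (WithLp.toLp 2 x₀) Sigma₀) μ
  law_w : ∀ t, HasLaw (fun ω => WithLp.toLp 2 (w t ω)) (multivariateGaussian 0 (σw ^ 2 • 1)) μ
  law_η : ∀ t, HasLaw (fun ω => WithLp.toLp 2 (η t ω)) (multivariateGaussian 0 (ση ^ 2 • 1)) μ
  indep_w_η : ∀ t, IndepFun (w t) (η t) μ
  indep_time : iIndepFun (fun t ω => (w t ω, η t ω)) μ
  indep_init : IndepFun (x 0) (fun ω t => (w t ω, η t ω)) μ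
  control : ∀ t ω, u t ω = Kplay *ᵥ x t ω + η t ω
  dynamics : ∀ t ω, x (t + 1) ω = M.A *ᵥ x t ω + M.B *ᵥ u t ω + w t ω

/-! ### The quantities in the sample complexity and error bounds -/

/-- `n_x^j`. -/
def dimX (j : Fin N) : ℕ := nx * (M.IQ j).card

/-- `n_u^j`. -/
def dimU (j : Fin N) : ℕ := nu * (M.IQ j).card

/-- The stationary covariance of the data `x_{I_Q^j}(t)` generated by `K_play`. -/
def statCov (Kplay : Matrix (Fin N × Fin nu) (Fin N × Fin nx) ℝ) (σw ση : ℝ) (j : Fin N) :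
    Matrix (Idx (M.IQ j) nx) (Idx (M.IQ j) nx) ℝ :=
  lyap (subMat (M.IQ j) M.A + subMat (M.IQ j) M.B * subMat (M.IQ j) Kplay)
    (σw ^ 2 • 1 + ση ^ 2 • (subMat (M.IQ j) M.B * (subMat (M.IQ j) M.B)ᵀ))

/-- The second moment matrix of `N(x₀, Σ₀)`. -/
def initMoment (x₀ : Fin N × Fin nx → ℝ)
    (Sigma₀ : Matrix (Fin N × Fin nx) (Fin N × Fin nx) ℝ) :
    Matrix (Fin N × Fin nx) (Fin N × Fin nx) ℝ :=
  Sigma₀ + vecMulVec x₀ x₀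

/-- The noise scale `σ̄_j`. -/
def sigmaBar (Kplay : Matrix (Fin N × Fin nu) (Fin N × Fin nx) ℝ) (σw ση : ℝ)
    (x₀ : Fin N × Fin nx → ℝ) (Sigma₀ : Matrix (Fin N × Fin nx) (Fin N × Fin nx) ℝ)
    (τ ρ : ℝ) (j : Fin N) : ℝ :=
  Real.sqrt (τ ^ 2 * ρ ^ 4 * specNorm (subMat (M.IQ j) (initMoment x₀ Sigma₀)) +
    specNorm (M.statCov Kplay σw ση j) + σw ^ 2 +
    ση ^ 2 * specNorm (subMat (M.IQ j) M.B) ^ 2)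

/-- The system factor
`‖K_play‖₊² σ_w σ̄_j τ² ‖K‖₊⁴ (1 + ‖A‖² + ‖B‖²) / (σ_η² ρ² (1 - ρ²))`, where all matrices are
restricted to the agents in `I_Q^j`. -/
def sysFactor (K Kplay : Matrix (Fin N × Fin nu) (Fin N × Fin nx) ℝ) (σw ση : ℝ)
    (x₀ : Fin N × Fin nx → ℝ) (Sigma₀ : Matrix (Fin N × Fin nx) (Fin N × Fin nx) ℝ)
    (τ ρ : ℝ) (j : Fin N) : ℝ :=
  specNormPlus (subMat (M.IQ j) Kplay) ^ 2 / ση ^ 2 *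
    (σw * M.sigmaBar Kplay σw ση x₀ Sigma₀ τ ρ j) *
    (τ ^ 2 * specNormPlus (subMat (M.IQ j) K) ^ 4 *
      (1 + specNorm (subMat (M.IQ j) M.A) ^ 2 + specNorm (subMat (M.IQ j) M.B) ^ 2) /
      (ρ ^ 2 * (1 - ρ ^ 2)))

/-- The logarithm whose powers are the poly-logarithmic factors, for agent `j` among `m` agents and
`T` samples. -/
def logTerm (Kplay : Matrix (Fin N × Fin nu) (Fin N × Fin nx) ℝ) (σw ση : ℝ)
    (x₀ : Fin N × Fin nx → ℝ) (Sigma₀ : Matrix (Fin N × Fin nx) (Fin N × Fin nx) ℝ)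
    (τ δ : ℝ) (m T : ℕ) (j : Fin N) : ℝ :=
  Real.log (Real.exp 1 + m * T / δ + 1 / ση ^ 4 + τ + M.dimX j +
    specNorm (initMoment x₀ Sigma₀) + specNorm (subMat (M.IQ j) Kplay) +
    specNorm (M.statCov Kplay σw ση j))

end System

end

end CoopLQR

namespace CoopLQR

noncomputable section

/-! ### Exponential moments of quadratic functions of a standard Gaussian vector -/

/-! The set `IQ j` is closed under predecessors in the state and observation graphs, so the agents
outside it never influence those inside. Restriction to `IQ j` therefore intertwines `A`, `B` and
the gains with their submatrices, the Q-function of agent `j` lives on an autonomous sub-system, and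
the Q-function of the summed costs is the sum of the zero-padded `qTrue K j` (`qHatTrue_eq_sum`).
Zero-padding does not increase the Frobenius norm, so the error of the indirect estimate is at most
the sum of the errors of the `q_j`. It remains to treat LSTDQ for one linear system with failure
probability `δ / m`, and to take a union bound over the `m` agents of `IGD i`.

For one system let L be the closed loop map, D(e) = e - svec(Lᵀ smat(e) L), and Z(e) the vector of
TD noises of the form x ↦ [x; Kx]ᵀ smat(e) [x; Kx]. Algebra gives (Φ - Ψ₊ + F) e = Φ D(e) - Z(e)
(`tdMat_mulVec`), and the Bellman equation gives c = Φ D(q). Hence the error d of the estimate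
satisfies Φᵀ(Φ D(d) - Z(d)) = Φᵀ Z(q), and pairing with y = D(d) gives ‖Φ y‖² = ⟨Φ y, Z(d) + Z(q)⟩.
Three facts finish the argument (`lstdq_error_le`): stability bounds the inverse of D
(`frobNorm_le_invBound`); ‖Φ e‖ is at least a constant times √T ‖e‖; and |⟨Φ e, Z⟩| ≤ β ‖Φ e‖
uniformly in e. The term Z(d) is linear in d and is absorbed once √T is large, while Z(q) leaves an
error of order β / √T.

The two random facts are proved for a fixed direction e and extended to all e by a grid. No mixing
is needed, only that the noise of each step is independent of the past (`lintegral_prod_le`). Given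
the past, each entry of Φ e is a quadratic polynomial in a fresh Gaussian vector, and a small-ball
estimate (`integral_exp_neg_sq_quadratic_stdGauss_le`) is multiplied over the T steps. Given the
past, the TD noise is a centred quadratic polynomial; truncated at a logarithmic level it obeys
Hoeffding's lemma, and an exponential supermartingale gives the self-normalized bound
(`measure_dotProduct_centredNoise_gt_le`). The scale of the noise is `σw` times the size of A x + B
u, whose fluctuations are bounded by the stationary covariance plus a contracted contribution of the
initial moment; this is the origin of `sigmaBar`. -/

/-- The standard Gaussian measure on `n → ℝ`. -/
def stdGauss (n : Type*) [Fintype n] : Measure (n → ℝ) := Measure.pi fun _ => gaussianReal 0 1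

instance stdGauss_isProbabilityMeasure {n : Type*} [Fintype n] :
    IsProbabilityMeasure (stdGauss n) := by
  unfold stdGauss; infer_instance

/-- Completing the square. One complex identity serves twice: real parameters give exponential
moments, imaginary ones the decay of the characteristic function. -/
lemma norm_integral_cexp_quadratic_gaussianReal {s : ℂ} (hs : s.re < 1 / 2) (b : ℂ) :
    ‖∫ x : ℝ, Complex.exp (s * x ^ 2 + b * x) ∂gaussianReal 0 1‖ =
      (Real.sqrt ‖1 - 2 * s‖)⁻¹ * Real.exp (b ^ 2 / (2 * (1 - 2 * s))).re := by
  have h0 : (s - 1 / 2).re < 0 := by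
    simp only [Complex.sub_re]; norm_num; linarith
  have hne : (1 - 2 * s) ≠ 0 := by
    intro h
    have : (1 - 2 * s).re = 0 := by rw [h]; rfl
    simp at this; linarith
  have h1 : ∫ x : ℝ, Complex.exp (s * x ^ 2 + b * x) ∂gaussianReal 0 1 =
      ((Real.sqrt (2 * Real.pi))⁻¹ : ℝ) *
        ∫ x : ℝ, Complex.exp ((s - 1 / 2) * x ^ 2 + b * x + 0) := by
    rw [integral_gaussianReal_eq_integral_smul one_ne_zero, ← integral_const_mul]
    congr with x
    rw [gaussianPDFReal]
    push_cast
    rw [Complex.real_smul]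
    push_cast
    rw [mul_one, mul_assoc, ← Complex.exp_add]
    congr 2
    ring
  rw [h1, integral_cexp_quadratic h0, norm_mul, norm_mul, Complex.norm_exp]
  have h2 : -(s - 1 / 2) = (1 - 2 * s) / 2 := by ring
  have h3 : (0 - b ^ 2 / (4 * (s - 1 / 2))) = b ^ 2 / (2 * (1 - 2 * s)) := by
    have : (4 * (s - 1 / 2)) = - (2 * (1 - 2 * s)) := by ring
    rw [this, div_neg, zero_sub, neg_neg]
  rw [h2, h3]
  have h4 : ‖((Real.pi : ℂ) / ((1 - 2 * s) / 2)) ^ (1 / 2 : ℂ)‖ =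
      Real.sqrt (2 * Real.pi) / Real.sqrt ‖1 - 2 * s‖ := by
    rw [← Real.sqrt_div (by positivity)]
    symm
    rw [Real.sqrt_eq_iff_mul_self_eq (by positivity) (by positivity), ← norm_mul, ← sq,
      ← Complex.cpow_nat_mul]
    norm_num
    rw [abs_of_pos Real.pi_pos]
    field_simp
  rw [h4, ← mul_assoc]
  congr 1
  have : 0 < Real.sqrt (2 * Real.pi) := by positivity
  rw [Complex.norm_real, Real.norm_of_nonneg (by positivity)]
  field_simp

/-- The linear coefficient contributes only a factor of modulus at most one, so the decay in `t` is
uniform in `b`. -/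
lemma norm_integral_cexp_I_quadratic_gaussianReal_le (t a b : ℝ) :
    ‖∫ x : ℝ, Complex.exp (((t * a : ℝ) * Complex.I) * x ^ 2 + ((t * b : ℝ) * Complex.I) * x)
        ∂gaussianReal 0 1‖ ≤ (Real.sqrt (Real.sqrt (1 + 4 * t ^ 2 * a ^ 2)))⁻¹ := by
  rw [norm_integral_cexp_quadratic_gaussianReal (by simp)]
  have h1 : ‖1 - 2 * (((t * a : ℝ) : ℂ) * Complex.I)‖ = Real.sqrt (1 + 4 * t ^ 2 * a ^ 2) := by
    rw [Complex.norm_def, Complex.normSq_apply]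
    congr 1
    simp
    ring
  rw [h1]
  refine mul_le_of_le_one_right (by positivity) ?_
  rw [Real.exp_le_one_iff]
  have h2 : (((t * b : ℝ) : ℂ) * Complex.I) ^ 2 / (2 * (1 - 2 * (((t * a : ℝ) : ℂ) * Complex.I)))
      = ((-(t * b) ^ 2 / 2 : ℝ) : ℂ) * (1 - 2 * (((t * a : ℝ) : ℂ) * Complex.I))⁻¹ := by
    rw [mul_pow, Complex.I_sq, div_eq_mul_inv, mul_inv]
    push_cast
    ring
  rw [h2, Complex.re_ofReal_mul, Complex.inv_re]
  refine mul_nonpos_of_nonpos_of_nonneg ?_ (div_nonneg (by simp) (Complex.normSq_nonneg _))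
  have : 0 ≤ (t * b) ^ 2 := sq_nonneg _
  linarith

/-- Squared, this is `1 ≤ exp(2a + 4a²)(1 - 2a)`. For `a ≤ 0` the bound `1 + y ≤ exp y` suffices, as
`(1 + 2a + 4a²)(1 - 2a) = 1 - 8a³`; for `a ≥ 0` the quadratic term of the exponential is needed as
well. -/
lemma inv_sqrt_one_sub_two_mul_le {a : ℝ} (ha : |a| ≤ 1 / 4) :
    (Real.sqrt (1 - 2 * a))⁻¹ ≤ Real.exp (a + 2 * a ^ 2) := by
  obtain ⟨h1, h2⟩ := abs_le.1 ha
  have hpos : 0 < 1 - 2 * a := by linarith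
  have key : 1 ≤ Real.exp (2 * a + 4 * a ^ 2) * (1 - 2 * a) := by
    rcases le_total a 0 with h | h
    · have h3 := Real.add_one_le_exp (2 * a + 4 * a ^ 2)
      have h4 : 1 ≤ (2 * a + 4 * a ^ 2 + 1) * (1 - 2 * a) := by
        have : 0 ≤ (-a) ^ 3 := pow_nonneg (by linarith) 3
        nlinarith
      exact h4.trans (by gcongr)
    · have h3 := Real.quadratic_le_exp_of_nonneg (x := 2 * a + 4 * a ^ 2) (by positivity)
      have h4 : 1 ≤ (1 + (2 * a + 4 * a ^ 2) + (2 * a + 4 * a ^ 2) ^ 2 / 2) * (1 - 2 * a) := by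
        have h5 : 0 ≤ a ^ 2 * (1 - 4 * a) := mul_nonneg (sq_nonneg _) (by linarith)
        have h6 : 0 ≤ a ^ 2 * (1 - 4 * a) * a := by positivity
        have h7 : 0 ≤ a ^ 2 * (1 - 4 * a) * a ^ 2 := by positivity
        nlinarith
      exact h4.trans (by gcongr)
  have h5 : Real.exp (2 * a + 4 * a ^ 2) = Real.exp (a + 2 * a ^ 2) ^ 2 := by
    rw [← Real.exp_nat_mul]; congr 1; push_cast; ring
  rw [inv_le_comm₀ (by positivity) (Real.exp_pos _)]
  refine Real.le_sqrt_of_sq_le ?_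
  rw [inv_pow, ← h5]
  exact inv_le_of_inv_le₀ hpos (by rwa [inv_le_iff_one_le_mul₀ hpos])

lemma integrable_exp_quadratic_gaussianReal {a : ℝ} (ha : |a| ≤ 1 / 4) (b : ℝ) :
    Integrable (fun x : ℝ => Real.exp (a * x ^ 2 + b * x)) (gaussianReal 0 1) ∧
    ∫ x : ℝ, Real.exp (a * x ^ 2 + b * x) ∂gaussianReal 0 1 ≤
      Real.exp (a + 2 * a ^ 2 + b ^ 2) := by
  obtain ⟨h1, h2⟩ := abs_le.1 ha
  have h3 := norm_integral_cexp_quadratic_gaussianReal (s := (a : ℂ))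
    (by rw [Complex.ofReal_re]; linarith) (b : ℂ)
  have h4 : ∀ x : ℝ, Complex.exp ((a : ℂ) * x ^ 2 + b * x) =
      ((Real.exp (a * x ^ 2 + b * x) : ℝ) : ℂ) := by
    intro x; push_cast; rfl
  have h5 : ‖1 - 2 * (a : ℂ)‖ = 1 - 2 * a := by
    have : (1 - 2 * (a : ℂ)) = ((1 - 2 * a : ℝ) : ℂ) := by push_cast; rfl
    rw [this, Complex.norm_real, Real.norm_of_nonneg (by linarith)]
  have h6 : ((b : ℂ) ^ 2 / (2 * (1 - 2 * (a : ℂ)))).re = b ^ 2 / (2 * (1 - 2 * a)) := by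
    have : ((b : ℂ) ^ 2 / (2 * (1 - 2 * (a : ℂ)))) = ((b ^ 2 / (2 * (1 - 2 * a)) : ℝ) : ℂ) := by
      push_cast; rfl
    rw [this, Complex.ofReal_re]
  simp_rw [h4] at h3
  rw [integral_complex_ofReal, Complex.norm_real, h5, h6,
    Real.norm_of_nonneg (integral_nonneg fun _ => (Real.exp_pos _).le)] at h3
  constructor
  -- A non-integrable function has integral `0` by convention, while the closed form in `h3` is
  -- positive.
  · by_contra H
    rw [integral_undef H] at h3
    have : 0 < (Real.sqrt (1 - 2 * a))⁻¹ * Real.exp (b ^ 2 / (2 * (1 - 2 * a))) := by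
      have : 0 < 1 - 2 * a := by linarith
      positivity
    linarith
  · rw [h3, Real.exp_add]
    gcongr
    · exact inv_sqrt_one_sub_two_mul_le ha
    · rw [div_le_iff₀ (by linarith)]
      nlinarith [sq_nonneg b]

/-- Rotation invariance of the Gaussian measure: `f` passes to coordinates in an eigenbasis of `M`.
The three sums at the end are rotation invariants; they turn bounds in terms of eigenvalues into
bounds in terms of `M` and `b`. -/
lemma exists_measurePreserving_diagonalization {n : Type*} [Fintype n] [DecidableEq n]
    {M : Matrix n n ℝ} (hM : M.IsSymm) (b : n → ℝ) :
    ∃ (f : (n → ℝ) → n → ℝ) (a c : n → ℝ), MeasurePreserving f (stdGauss n) (stdGauss n) ∧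
      (∀ g, g ⬝ᵥ M *ᵥ g = ∑ i, a i * f g i ^ 2) ∧ (∀ g, b ⬝ᵥ g = ∑ i, c i * f g i) ∧
      ∑ i, a i = M.trace ∧ ∑ i, a i ^ 2 = ∑ i, ∑ j, M i j ^ 2 ∧ ∑ i, c i ^ 2 = ∑ i, b i ^ 2 := by
  have hH : M.IsHermitian := by
    rw [Matrix.IsHermitian, Matrix.conjTranspose_eq_transpose_of_trivial]; exact hM
  set U : Matrix n n ℝ := (hH.eigenvectorUnitary : Matrix n n ℝ) with hU
  have hUU : U * Uᵀ = 1 := by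
    have := Unitary.coe_mul_star_self hH.eigenvectorUnitary
    rwa [Unitary.coe_star, Matrix.star_eq_conjTranspose, Matrix.conjTranspose_eq_transpose_of_trivial] at this
  have hUU' : Uᵀ * U = 1 := by
    have := Unitary.coe_star_mul_self hH.eigenvectorUnitary
    rwa [Matrix.star_eq_conjTranspose, Matrix.conjTranspose_eq_transpose_of_trivial] at this
  have hspec : M = U * diagonal hH.eigenvalues * Uᵀ := by
    have := hH.spectral_theorem
    rw [Unitary.conjStarAlgAut_apply, Matrix.star_eq_conjTranspose,
      Matrix.conjTranspose_eq_transpose_of_trivial] at this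
    exact this
  have hdot : ∀ v : n → ℝ, v ⬝ᵥ v = ∑ i, v i ^ 2 := fun v => by
    simp [dotProduct, sq]
  refine ⟨fun g => Uᵀ *ᵥ g, hH.eigenvalues, Uᵀ *ᵥ b, ⟨by fun_prop, ?_⟩, ?_, ?_, ?_, ?_, ?_⟩
  · have h1 := stdGaussian_map hH.eigenvectorBasis.repr
    rw [← map_pi_eq_stdGaussian, Measure.map_map (by fun_prop) (by fun_prop)] at h1
    have h2 := congrArg (Measure.map (WithLp.ofLp : EuclideanSpace ℝ n → n → ℝ)) h1
    rw [Measure.map_map (by fun_prop) (by fun_prop), Measure.map_map (by fun_prop) (by fun_prop)]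
      at h2
    have h3 : (WithLp.ofLp ∘ WithLp.toLp 2 : (n → ℝ) → n → ℝ) = id := rfl
    rw [h3, Measure.map_id] at h2
    unfold stdGauss
    rw [← h2]
    congr 1
    · ext g i
      simp [OrthonormalBasis.repr_apply_apply, PiLp.inner_apply, mulVec, dotProduct, hU, mul_comm]
  · intro g
    conv_lhs => rw [hspec]
    rw [← mulVec_mulVec, ← mulVec_mulVec, dotProduct_mulVec, ← mulVec_transpose]
    simp only [dotProduct, mulVec_diagonal]
    refine Finset.sum_congr rfl fun i _ => by ring
  · intro g
    change _ = (Uᵀ *ᵥ b) ⬝ᵥ (Uᵀ *ᵥ g)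
    rw [dotProduct_mulVec, vecMul_transpose, mulVec_mulVec, hUU, one_mulVec]
  · have := hH.trace_eq_sum_eigenvalues
    simpa using this.symm
  · have h1 : ∀ X : Matrix n n ℝ, ∑ i, ∑ j, X i j ^ 2 = (X * Xᵀ).trace := fun X => by
      simp [Matrix.trace, Matrix.mul_apply, sq]
    rw [h1]
    conv_rhs => rw [hspec]
    rw [Matrix.transpose_mul, Matrix.transpose_mul, Matrix.transpose_transpose, diagonal_transpose]
    have : U * diagonal hH.eigenvalues * Uᵀ * (U * (diagonal hH.eigenvalues * Uᵀ)) =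
        U * (diagonal hH.eigenvalues * (Uᵀ * U) * diagonal hH.eigenvalues * Uᵀ) := by
      simp only [Matrix.mul_assoc]
    rw [this, hUU', Matrix.mul_one, Matrix.trace_mul_comm, Matrix.mul_assoc, hUU', Matrix.mul_one,
      diagonal_mul_diagonal, trace_diagonal]
    simp [sq]
  · rw [← hdot, ← hdot, dotProduct_mulVec, vecMul_transpose, mulVec_mulVec, hUU, one_mulVec]

/-- After diagonalization the integral factorizes. The Frobenius bound forces every eigenvalue into
`[-1/4, 1/4]`, the range of the one-dimensional estimate. -/
lemma integrable_exp_quadratic_stdGauss {n : Type*} [Fintype n] [DecidableEq n]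
    {M : Matrix n n ℝ} (hM : M.IsSymm) (hM4 : ∑ i, ∑ j, M i j ^ 2 ≤ (1 / 4) ^ 2) (b : n → ℝ) :
    Integrable (fun g : n → ℝ => Real.exp (g ⬝ᵥ M *ᵥ g + b ⬝ᵥ g)) (stdGauss n) ∧
    ∫ g : n → ℝ, Real.exp (g ⬝ᵥ M *ᵥ g + b ⬝ᵥ g) ∂stdGauss n ≤
      Real.exp (M.trace + 2 * (∑ i, ∑ j, M i j ^ 2) + ∑ i, b i ^ 2) := by
  obtain ⟨f, a, c, hf, h1, h2, h3, h4, h5⟩ := exists_measurePreserving_diagonalization hM b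
  have ha : ∀ i, |a i| ≤ 1 / 4 := by
    intro i
    refine abs_le_of_sq_le_sq ?_ (by norm_num)
    rw [← h4] at hM4
    exact (Finset.single_le_sum (fun i _ => sq_nonneg (a i)) (Finset.mem_univ i)).trans hM4
  have hexp : ∀ g, Real.exp (g ⬝ᵥ M *ᵥ g + b ⬝ᵥ g) =
      (fun y : n → ℝ => ∏ i, Real.exp (a i * y i ^ 2 + c i * y i)) (f g) := by
    intro g
    simp only [h1, h2, ← Finset.sum_add_distrib, Real.exp_sum]
  have hintegrable : Integrable (fun y : n → ℝ => ∏ i, Real.exp (a i * y i ^ 2 + c i * y i))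
      (stdGauss n) :=
    Integrable.fintype_prod (f := fun i (y : ℝ) => Real.exp (a i * y ^ 2 + c i * y))
      fun i => (integrable_exp_quadratic_gaussianReal (ha i) (c i)).1
  have hsm : AEStronglyMeasurable (fun y : n → ℝ => ∏ i, Real.exp (a i * y i ^ 2 + c i * y i))
      (Measure.map f (stdGauss n)) := by
    rw [hf.map_eq]; exact hintegrable.aestronglyMeasurable
  simp_rw [hexp]
  refine ⟨hf.integrable_comp_of_integrable hintegrable, ?_⟩
  rw [← integral_map hf.measurable.aemeasurable hsm, hf.map_eq, stdGauss,
    integral_fintype_prod_eq_prod (fun i (y : ℝ) => Real.exp (a i * y ^ 2 + c i * y)),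
    ← h3, ← h4, ← h5, Finset.mul_sum, ← Finset.sum_add_distrib, ← Finset.sum_add_distrib,
    Real.exp_sum]
  exact Finset.prod_le_prod (fun i _ => integral_nonneg fun _ => (Real.exp_pos _).le)
    fun i _ => (integrable_exp_quadratic_gaussianReal (ha i) (c i)).2

lemma one_add_sum_le_prod_one_add {n : Type*} (s : Finset n) (f : n → ℝ) (hf : ∀ i, 0 ≤ f i) :
    1 + ∑ i ∈ s, f i ≤ ∏ i ∈ s, (1 + f i) := by
  classical
  induction s using Finset.induction_on with
  | empty => simp
  | insert a s ha ih =>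
    rw [Finset.sum_insert ha, Finset.prod_insert ha]
    have h1 : 0 ≤ ∑ i ∈ s, f i := Finset.sum_nonneg fun i _ => hf i
    nlinarith [mul_le_mul_of_nonneg_left ih (add_nonneg zero_le_one (hf a)),
      mul_nonneg (hf a) h1]

/-- Each eigenvalue contributes a factor `(1 + 4t²aᵢ²)^(-1/4)`. Keeping only `1 + ∑ 4t²aᵢ²` of the
expanded product leaves the Frobenius norm, with no dependence on the dimension. -/
lemma norm_integral_cexp_I_quadratic_stdGauss_le {n : Type*} [Fintype n] [DecidableEq n]
    {M : Matrix n n ℝ} (hM : M.IsSymm) (b : n → ℝ) (d t : ℝ) :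
    ‖∫ g : n → ℝ, Complex.exp ((t * (g ⬝ᵥ M *ᵥ g + b ⬝ᵥ g + d) : ℝ) * Complex.I) ∂stdGauss n‖ ≤
      (Real.sqrt (Real.sqrt (1 + 4 * t ^ 2 * ∑ i, ∑ j, M i j ^ 2)))⁻¹ := by
  obtain ⟨f, a, c, hf, h1, h2, h3, h4, h5⟩ := exists_measurePreserving_diagonalization hM b
  have hexp : ∀ g, Complex.exp ((t * (g ⬝ᵥ M *ᵥ g + b ⬝ᵥ g + d) : ℝ) * Complex.I) =
      Complex.exp ((t * d : ℝ) * Complex.I) *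
      (fun y : n → ℝ => ∏ i, Complex.exp (((t * a i : ℝ) * Complex.I) * y i ^ 2 +
        ((t * c i : ℝ) * Complex.I) * y i)) (f g) := by
    intro g
    rw [h1, h2]
    simp only [← Complex.exp_sum, ← Complex.exp_add]
    congr 1
    push_cast
    rw [mul_add, mul_add, add_mul, add_comm, Finset.sum_add_distrib, add_mul, Finset.mul_sum,
      Finset.mul_sum, Finset.sum_mul, Finset.sum_mul]
    congr 2 <;> exact Finset.sum_congr rfl fun i _ => by ring
  simp_rw [hexp]
  rw [integral_const_mul, norm_mul, Complex.norm_exp_ofReal_mul_I, one_mul,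
    ← integral_map (φ := f) (f := fun y : n → ℝ => ∏ i, Complex.exp (((t * a i : ℝ) * Complex.I) *
      y i ^ 2 + ((t * c i : ℝ) * Complex.I) * y i)) hf.measurable.aemeasurable
      (Measurable.aestronglyMeasurable (by fun_prop)), hf.map_eq, stdGauss,
    integral_fintype_prod_eq_prod (fun i (y : ℝ) => Complex.exp (((t * a i : ℝ) * Complex.I) *
      y ^ 2 + ((t * c i : ℝ) * Complex.I) * y)), norm_prod]
  have hle : ∀ i, _ := fun i => norm_integral_cexp_I_quadratic_gaussianReal_le t (a i) (c i)
  refine (Finset.prod_le_prod (fun i _ => norm_nonneg _) fun i _ => hle i).trans ?_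
  rw [Finset.prod_inv_distrib, ← h4]
  refine inv_anti₀ (by positivity) ?_
  have hsq : ∀ (u : n → ℝ), (∀ i, 0 ≤ u i) → ∏ i, Real.sqrt (u i) = Real.sqrt (∏ i, u i) := by
    intro u hu
    rw [eq_comm, Real.sqrt_eq_iff_mul_self_eq (Finset.prod_nonneg fun i _ => hu i)
      (Finset.prod_nonneg fun i _ => Real.sqrt_nonneg _), ← Finset.prod_mul_distrib]
    exact Finset.prod_congr rfl fun i _ => (Real.mul_self_sqrt (hu i)).symm
  rw [hsq _ fun i => Real.sqrt_nonneg _, hsq _ fun i => by positivity]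
  refine Real.sqrt_le_sqrt (Real.sqrt_le_sqrt ?_)
  rw [Finset.mul_sum]
  exact one_add_sum_le_prod_one_add _ _ fun i => by positivity

/-- The density is at most `1/√(2π) ≤ 1/2` and the interval has length `1/2`. -/
lemma gaussianReal_Ioo_le : (gaussianReal 0 1).real (Set.Ioo (-(1 / 4)) (1 / 4)) ≤ 1 / 4 := by
  rw [measureReal_def, gaussianReal_apply _ one_ne_zero]
  have h1 : ∀ x : ℝ, gaussianPDF 0 1 x ≤ ENNReal.ofReal (1 / 2) := by
    intro x
    refine ENNReal.ofReal_le_ofReal ?_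
    rw [gaussianPDFReal, one_div]
    refine (mul_le_mul (b := (2 : ℝ)⁻¹) (d := 1) ?_ ?_ (Real.exp_pos _).le (by norm_num)).trans_eq
      (mul_one _)
    · refine inv_anti₀ (by norm_num) (Real.le_sqrt_of_sq_le ?_)
      have := Real.pi_gt_three
      norm_num
      linarith
    · rw [Real.exp_le_one_iff]
      have : 0 ≤ (x - 0) ^ 2 / (2 * ((1 : NNReal) : ℝ)) := by positivity
      rw [neg_div]
      linarith
  have h2 : ∫⁻ x in Set.Ioo (-(1 / 4) : ℝ) (1 / 4), gaussianPDF 0 1 x ≤ ENNReal.ofReal (1 / 4) := by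
    refine (lintegral_mono h1).trans ?_
    rw [setLIntegral_const, Real.volume_Ioo, ← ENNReal.ofReal_mul (by norm_num)]
    norm_num
  exact ENNReal.toReal_le_of_le_ofReal (by norm_num) h2

/-- Small-ball estimate for quadratic functions of a standard Gaussian vector. -/
lemma integral_exp_neg_sq_quadratic_stdGauss_le {n : Type*} [Fintype n] [DecidableEq n]
    {M : Matrix n n ℝ} (hM : M.IsSymm) (b : n → ℝ) (d : ℝ) {s : ℝ} (hs : 0 < s)
    (hsM : s ^ 2 ≤ ∑ i, ∑ j, M i j ^ 2) :
    ∫ g : n → ℝ, Real.exp (-(512 / s ^ 2 * (g ⬝ᵥ M *ᵥ g + b ⬝ᵥ g + d) ^ 2)) ∂stdGauss n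
      ≤ 1 / 2 := by
  set p : (n → ℝ) → ℝ := fun g => g ⬝ᵥ M *ᵥ g + b ⬝ᵥ g + d with hp
  have hpm : Measurable p := by
    simp only [hp, dotProduct, mulVec]; fun_prop
  -- Gaussian randomization: `exp(-512 p²/s²)` is the characteristic function of a standard normal
  -- variable at `32 p/s`, as `32²/2 = 512`. After Fubini, the decay of the characteristic function
  -- of `p` bounds the integral.
  have h1 : ∀ g, ((Real.exp (-(512 / s ^ 2 * p g ^ 2)) : ℝ) : ℂ) =
      ∫ h : ℝ, Complex.exp ((32 / s * h * p g : ℝ) * Complex.I) ∂gaussianReal 0 1 := by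
    intro g
    have := charFun_gaussianReal (μ := 0) (v := 1) (32 / s * p g)
    rw [charFun_apply_real] at this
    convert this.symm using 1
    · push_cast
      congr 1
      field_simp
      norm_num
      ring
    · refine integral_congr_ae (ae_of_all _ fun h => ?_)
      push_cast
      ring_nf
  have hintegrable : Integrable (Function.uncurry fun (g : n → ℝ) (h : ℝ) =>
      Complex.exp ((32 / s * h * p g : ℝ) * Complex.I)) ((stdGauss n).prod (gaussianReal 0 1)) := by
    refine (integrable_const (1 : ℝ)).mono' (Measurable.aestronglyMeasurable (by fun_prop))
      (ae_of_all _ fun q => ?_)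
    simp only [Function.uncurry]
    rw [Complex.norm_exp_ofReal_mul_I]
  have h2 : ((∫ g, Real.exp (-(512 / s ^ 2 * p g ^ 2)) ∂stdGauss n : ℝ) : ℂ) =
      ∫ h : ℝ, ∫ g : n → ℝ, Complex.exp ((32 / s * h * p g : ℝ) * Complex.I) ∂stdGauss n
        ∂gaussianReal 0 1 := by
    rw [← integral_integral_swap hintegrable, ← integral_complex_ofReal]
    simp_rw [h1]
  have h3 : ∀ h : ℝ, ‖∫ g : n → ℝ, Complex.exp ((32 / s * h * p g : ℝ) * Complex.I) ∂stdGauss n‖ ≤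
      Set.indicator (Set.Ioo (-(1 / 4)) (1 / 4)) 1 h + 1 / 4 := by
    intro h
    refine (norm_integral_cexp_I_quadratic_stdGauss_le hM b d (32 / s * h)).trans ?_
    by_cases hh : h ∈ Set.Ioo (-(1 / 4) : ℝ) (1 / 4)
    · rw [Set.indicator_of_mem hh]
      refine (inv_le_one_of_one_le₀ ?_).trans (by norm_num)
      rw [Real.one_le_sqrt, Real.one_le_sqrt]
      have : 0 ≤ ∑ i, ∑ j, M i j ^ 2 :=
        Finset.sum_nonneg fun i _ => Finset.sum_nonneg fun j _ => sq_nonneg _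
      have := mul_nonneg (sq_nonneg (32 / s * h)) this
      linarith
    -- For `|h| ≥ 1/4` the quantity under the fourth root is at least `4 · 32² / 16 = 256 = 4⁴`.
    · rw [Set.indicator_of_notMem hh, zero_add, one_div]
      refine inv_anti₀ (by norm_num) ?_
      refine Real.le_sqrt_of_sq_le (Real.le_sqrt_of_sq_le ?_)
      have h4 : (1 / 4 : ℝ) ^ 2 ≤ h ^ 2 := by
        rw [Set.mem_Ioo, not_and_or, not_lt, not_lt] at hh
        rcases hh with hh | hh <;> nlinarith
      have h5 : (32 / s * h) ^ 2 * s ^ 2 ≤ (32 / s * h) ^ 2 * ∑ i, ∑ j, M i j ^ 2 :=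
        mul_le_mul_of_nonneg_left hsM (sq_nonneg _)
      have h6 : (32 / s * h) ^ 2 * s ^ 2 = 1024 * h ^ 2 := by field_simp; ring
      rw [h6] at h5
      nlinarith
  have h0 : 0 ≤ ∫ g, Real.exp (-(512 / s ^ 2 * p g ^ 2)) ∂stdGauss n :=
    integral_nonneg fun _ => (Real.exp_pos _).le
  have h7 : ∫ g, Real.exp (-(512 / s ^ 2 * p g ^ 2)) ∂stdGauss n =
      ‖((∫ g, Real.exp (-(512 / s ^ 2 * p g ^ 2)) ∂stdGauss n : ℝ) : ℂ)‖ := by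
    rw [Complex.norm_real, Real.norm_of_nonneg h0]
  rw [h7, h2]
  have hi : Integrable (Set.indicator (Set.Ioo (-(1 / 4) : ℝ) (1 / 4)) (1 : ℝ → ℝ))
      (gaussianReal 0 1) := (integrable_const (1 : ℝ)).indicator measurableSet_Ioo
  refine (norm_integral_le_of_norm_le (hi.add (integrable_const (1 / 4 : ℝ)))
    (ae_of_all _ h3)).trans ?_
  simp only [Pi.add_apply]
  rw [integral_add hi (integrable_const _), integral_indicator_one measurableSet_Ioo]
  have := gaussianReal_Ioo_le
  simp
  norm_num at this
  linarith

end

end CoopLQR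

namespace CoopLQR

noncomputable section

/-! ### Euclidean, spectral and Frobenius norms -/

section Norms

variable {l m n : Type*} [Fintype l] [Fintype m] [Fintype n]

lemma euclNorm_eq_sqrt (v : n → ℝ) : euclNorm v = Real.sqrt (∑ i, v i ^ 2) := by
  simp [euclNorm, EuclideanSpace.norm_eq]

lemma euclNorm_nonneg (v : n → ℝ) : 0 ≤ euclNorm v := norm_nonneg _

lemma euclNorm_sq (v : n → ℝ) : euclNorm v ^ 2 = ∑ i, v i ^ 2 := by
  rw [euclNorm_eq_sqrt, Real.sq_sqrt (Finset.sum_nonneg fun i _ => sq_nonneg _)]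

lemma euclNorm_sq_eq_dotProduct (v : n → ℝ) : euclNorm v ^ 2 = v ⬝ᵥ v := by
  rw [euclNorm_sq]; simp [dotProduct, sq]

lemma euclNorm_add_le (v w : n → ℝ) : euclNorm (v + w) ≤ euclNorm v + euclNorm w :=
  norm_add_le (WithLp.toLp 2 v) (WithLp.toLp 2 w)

lemma euclNorm_smul (c : ℝ) (v : n → ℝ) : euclNorm (c • v) = |c| * euclNorm v :=
  norm_smul c (WithLp.toLp 2 v)

lemma euclNorm_zero : euclNorm (0 : n → ℝ) = 0 := norm_zero (E := EuclideanSpace ℝ n)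

lemma euclNorm_sum_le {α : Type*} (s : Finset α) (f : α → n → ℝ) :
    euclNorm (∑ i ∈ s, f i) ≤ ∑ i ∈ s, euclNorm (f i) := by
  unfold euclNorm
  rw [WithLp.toLp_sum]
  exact norm_sum_le _ _

lemma euclNorm_eq_zero_iff {v : n → ℝ} : euclNorm v = 0 ↔ v = 0 := by
  unfold euclNorm
  rw [norm_eq_zero, WithLp.toLp_eq_zero]

lemma abs_apply_le_euclNorm (v : n → ℝ) (i : n) : |v i| ≤ euclNorm v :=
  PiLp.norm_apply_le (WithLp.toLp 2 v) i

lemma abs_dotProduct_le (v w : n → ℝ) : |v ⬝ᵥ w| ≤ euclNorm v * euclNorm w := by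
  have h := abs_real_inner_le_norm (WithLp.toLp 2 w) (WithLp.toLp 2 v)
  rw [mul_comm] at h
  have h1 : inner ℝ (WithLp.toLp 2 w) (WithLp.toLp 2 v) = v ⬝ᵥ w := by
    simp [PiLp.inner_apply, dotProduct]
  rwa [h1] at h

lemma specNorm_nonneg [DecidableEq n] (M : Matrix m n ℝ) : 0 ≤ specNorm M :=
  open scoped Matrix.Norms.L2Operator in norm_nonneg M

lemma euclNorm_mulVec_le [DecidableEq n] (M : Matrix m n ℝ) (v : n → ℝ) :
    euclNorm (M *ᵥ v) ≤ specNorm M * euclNorm v :=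
  l2_opNorm_mulVec M (WithLp.toLp 2 v)

lemma specNorm_le_of_forall [DecidableEq n] {M : Matrix m n ℝ} {c : ℝ} (hc : 0 ≤ c)
    (h : ∀ v, euclNorm (M *ᵥ v) ≤ c * euclNorm v) : specNorm M ≤ c := by
  unfold specNorm
  rw [l2_opNorm_def]
  exact ContinuousLinearMap.opNorm_le_bound _ hc fun x => h x.ofLp

lemma specNorm_mul_le [DecidableEq n] [DecidableEq m] (M : Matrix l m ℝ) (M' : Matrix m n ℝ) :
    specNorm (M * M') ≤ specNorm M * specNorm M' :=
  l2_opNorm_mul M M'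

lemma specNorm_transpose [DecidableEq n] [DecidableEq m] (M : Matrix m n ℝ) :
    specNorm Mᵀ = specNorm M := by
  rw [← conjTranspose_eq_transpose_of_trivial]
  exact l2_opNorm_conjTranspose M

lemma one_le_specNormPlus [DecidableEq n] (M : Matrix m n ℝ) : 1 ≤ specNormPlus M := by
  unfold specNormPlus; linarith [specNorm_nonneg M]

lemma dotProduct_mulVec_le [DecidableEq n] (M : Matrix n n ℝ) (v : n → ℝ) :
    v ⬝ᵥ M *ᵥ v ≤ specNorm M * euclNorm v ^ 2 := by
  refine (le_abs_self _).trans ((abs_dotProduct_le _ _).trans ?_)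
  nlinarith [euclNorm_mulVec_le M v, euclNorm_nonneg v]

lemma frobNorm_nonneg (M : Matrix m n ℝ) : 0 ≤ frobNorm M := Real.sqrt_nonneg _

lemma frobNorm_sq (M : Matrix m n ℝ) : frobNorm M ^ 2 = ∑ a, ∑ b, M a b ^ 2 :=
  Real.sq_sqrt (Finset.sum_nonneg fun _ _ => Finset.sum_nonneg fun _ _ => sq_nonneg _)

lemma frobNorm_eq_euclNorm (M : Matrix m n ℝ) :
    frobNorm M = euclNorm fun p : m × n => M p.1 p.2 := by
  rw [frobNorm, euclNorm_eq_sqrt, Fintype.sum_prod_type]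

lemma frobNorm_add_le (M M' : Matrix m n ℝ) : frobNorm (M + M') ≤ frobNorm M + frobNorm M' := by
  simp only [frobNorm_eq_euclNorm]
  exact euclNorm_add_le _ _

lemma frobNorm_transpose (M : Matrix m n ℝ) : frobNorm Mᵀ = frobNorm M := by
  rw [frobNorm, frobNorm, Finset.sum_comm]
  rfl

lemma frobNorm_sq_eq_sum_euclNorm (M : Matrix m n ℝ) :
    frobNorm M ^ 2 = ∑ a, euclNorm (M a) ^ 2 := by
  simp only [frobNorm_sq, euclNorm_sq]

lemma frobNorm_mul_le_left [DecidableEq m] (M : Matrix l m ℝ) (M' : Matrix m n ℝ) :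
    frobNorm (M * M') ≤ specNorm M * frobNorm M' := by
  refine abs_le_of_sq_le_sq' ?_ (mul_nonneg (specNorm_nonneg _) (frobNorm_nonneg _)) |>.2
  rw [mul_pow, ← frobNorm_transpose (M * M'), ← frobNorm_transpose M', frobNorm_sq_eq_sum_euclNorm,
    frobNorm_sq_eq_sum_euclNorm, Finset.mul_sum]
  refine Finset.sum_le_sum fun a _ => ?_
  rw [← mul_pow]
  refine pow_le_pow_left₀ (euclNorm_nonneg _) ?_ 2
  exact euclNorm_mulVec_le M (M'ᵀ a)

lemma frobNorm_mul_le_right [DecidableEq m] [DecidableEq n] (M : Matrix l m ℝ) (M' : Matrix m n ℝ) :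
    frobNorm (M * M') ≤ frobNorm M * specNorm M' := by
  rw [← frobNorm_transpose, transpose_mul, mul_comm, ← specNorm_transpose, ← frobNorm_transpose M]
  exact frobNorm_mul_le_left _ _

lemma frobNorm_conj_le [DecidableEq m] [DecidableEq n] (M : Matrix m m ℝ) (X : Matrix m n ℝ) :
    frobNorm (Xᵀ * M * X) ≤ specNorm X ^ 2 * frobNorm M := by
  refine (frobNorm_mul_le_right _ _).trans ?_
  have := frobNorm_mul_le_left Xᵀ M
  rw [specNorm_transpose] at this
  nlinarith [specNorm_nonneg X]

lemma euclNorm_sumElim_sq (v : m → ℝ) (w : n → ℝ) :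
    euclNorm (Sum.elim v w) ^ 2 = euclNorm v ^ 2 + euclNorm w ^ 2 := by
  simp only [euclNorm_sq, Fintype.sum_sum_type, Sum.elim_inl, Sum.elim_inr]

lemma specNorm_fromRows_one_le [DecidableEq n] (K : Matrix m n ℝ) :
    specNorm (fromRows (1 : Matrix n n ℝ) K) ≤ specNormPlus K := by
  have hK := specNorm_nonneg K
  unfold specNormPlus
  refine specNorm_le_of_forall (by linarith) fun v => ?_
  refine abs_le_of_sq_le_sq' ?_ (mul_nonneg (by linarith) (euclNorm_nonneg _)) |>.2
  rw [fromRows_mulVec, euclNorm_sumElim_sq, one_mulVec]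
  have h1 := euclNorm_mulVec_le K v
  have h2 := pow_le_pow_left₀ (euclNorm_nonneg _) h1 2
  have h3 := mul_nonneg hK (sq_nonneg (euclNorm v))
  nlinarith

lemma specNorm_fromCols_sq_le [DecidableEq n] [DecidableEq l] (A : Matrix m n ℝ)
    (B : Matrix m l ℝ) :
    specNorm (fromCols A B) ^ 2 ≤ specNorm A ^ 2 + specNorm B ^ 2 := by
  have h : specNorm (fromCols A B) ≤ Real.sqrt (specNorm A ^ 2 + specNorm B ^ 2) := by
    refine specNorm_le_of_forall (Real.sqrt_nonneg _) fun v => ?_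
    refine abs_le_of_sq_le_sq' ?_ (mul_nonneg (Real.sqrt_nonneg _) (euclNorm_nonneg _)) |>.2
    rw [mul_pow, Real.sq_sqrt (by positivity), fromCols_mulVec]
    have h0 : euclNorm v ^ 2 = euclNorm (v ∘ Sum.inl) ^ 2 + euclNorm (v ∘ Sum.inr) ^ 2 := by
      rw [← euclNorm_sumElim_sq]
      congr 2
      ext i
      cases i <;> rfl
    have h1 := euclNorm_mulVec_le A (v ∘ Sum.inl)
    have h2 := euclNorm_mulVec_le B (v ∘ Sum.inr)
    have h3 := euclNorm_add_le (A *ᵥ (v ∘ Sum.inl)) (B *ᵥ (v ∘ Sum.inr))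
    have h4 := pow_le_pow_left₀ (euclNorm_nonneg _) (h3.trans (add_le_add h1 h2)) 2
    rw [h0]
    -- Cauchy–Schwarz for the pair of operator norms and the pair of block norms.
    nlinarith [sq_nonneg (specNorm A * euclNorm (v ∘ Sum.inr) -
      specNorm B * euclNorm (v ∘ Sum.inl))]
  have := pow_le_pow_left₀ (specNorm_nonneg _) h 2
  rwa [Real.sq_sqrt (by positivity)] at this

lemma specNorm_one_le [DecidableEq n] : specNorm (1 : Matrix n n ℝ) ≤ 1 :=
  specNorm_le_of_forall zero_le_one fun v => by rw [one_mulVec, one_mul]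

end Norms

/-! ### `svec` and `smat` -/

section Svec

variable {n : Type*} [DecidableEq n]

lemma svec_mk (M : Matrix n n ℝ) (a b : n) :
    svec M s(a, b) = if a = b then M a b else (M a b + M b a) / Real.sqrt 2 := rfl

lemma smat_apply (q : Sym2 n → ℝ) (a b : n) :
    smat q a b = if a = b then q s(a, b) else q s(a, b) / Real.sqrt 2 := rfl

lemma isSymm_smat (q : Sym2 n → ℝ) : (smat q).IsSymm := by
  ext a b
  simp only [transpose_apply, smat_apply, Sym2.eq_swap (a := b), eq_comm (a := b)]

lemma svec_smat (q : Sym2 n → ℝ) : svec (smat q) = q := by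
  ext s
  induction s using Sym2.ind with
  | _ a b =>
    rw [svec_mk, smat_apply, smat_apply, Sym2.eq_swap (a := b) (b := a)]
    split_ifs with h1 h2
    · rfl
    · exact absurd h2.symm h1
    · have : Real.sqrt 2 * Real.sqrt 2 = 2 := Real.mul_self_sqrt (by norm_num)
      have h0 : Real.sqrt 2 ≠ 0 := by positivity
      field_simp
      rw [sq, this]
      ring

lemma smat_svec {M : Matrix n n ℝ} (hM : M.IsSymm) : smat (svec M) = M := by
  ext a b
  rw [smat_apply, svec_mk]
  have h : M b a = M a b := hM.apply a b
  split_ifs with h1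
  · rfl
  · rw [h]
    have : Real.sqrt 2 * Real.sqrt 2 = 2 := Real.mul_self_sqrt (by norm_num)
    have h0 : Real.sqrt 2 ≠ 0 := by positivity
    field_simp
    rw [sq, this]
    ring

lemma svec_add (M M' : Matrix n n ℝ) : svec (M + M') = svec M + svec M' := by
  ext s
  induction s using Sym2.ind with
  | _ a b =>
    simp only [svec_mk, Pi.add_apply, Matrix.add_apply]
    split_ifs <;> ring

lemma svec_sub (M M' : Matrix n n ℝ) : svec (M - M') = svec M - svec M' := by
  ext s
  induction s using Sym2.ind with
  | _ a b =>
    simp only [svec_mk, Pi.sub_apply, Matrix.sub_apply]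
    split_ifs <;> ring

lemma svec_zero : svec (0 : Matrix n n ℝ) = 0 := by
  ext s
  induction s using Sym2.ind with
  | _ a b => simp [svec_mk]

lemma svec_sum {α : Type*} (s : Finset α) (f : α → Matrix n n ℝ) :
    svec (∑ i ∈ s, f i) = ∑ i ∈ s, svec (f i) := by
  classical
  induction s using Finset.induction_on with
  | empty => simp [svec_zero]
  | insert a s ha ih => rw [Finset.sum_insert ha, Finset.sum_insert ha, svec_add, ih]

lemma smat_sub (q r : Sym2 n → ℝ) : smat (q - r) = smat q - smat r := by
  ext a b
  simp only [smat_apply, Pi.sub_apply, Matrix.sub_apply]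
  split_ifs <;> ring

variable [Fintype n]

/-- The double sum is grouped along the fibres of `(a, b) ↦ s(a, b)`; over an off-diagonal pair both
sides give `(M a b + M b a) / √2` times the entry of `q`. No symmetry of `M` is needed, because
`svec` symmetrizes. -/
lemma svec_dotProduct (M : Matrix n n ℝ) (q : Sym2 n → ℝ) :
    svec M ⬝ᵥ q = ∑ a, ∑ b, M a b * smat q a b := by
  rw [← Fintype.sum_prod_type', ← Finset.sum_fiberwise (s := Finset.univ)
    (g := fun p : n × n => s(p.1, p.2)), dotProduct]
  refine Finset.sum_congr rfl fun s _ => ?_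
  induction s using Sym2.ind with
  | _ a b =>
    have hf : (Finset.univ.filter fun p : n × n => s(p.1, p.2) = s(a, b)) = {(a, b), (b, a)} := by
      ext ⟨x, y⟩
      simp
    rw [hf, svec_mk]
    by_cases h : a = b
    · subst h
      simp [smat_apply]
    · rw [Finset.sum_pair (by simp [h]), if_neg h]
      simp only [smat_apply, if_neg h, if_neg (Ne.symm h), Sym2.eq_swap (a := b) (b := a)]
      ring

lemma frobNorm_smat (q : Sym2 n → ℝ) : frobNorm (smat q) = euclNorm q := by
  rw [frobNorm, euclNorm_eq_sqrt]
  congr 1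
  have h := svec_dotProduct (smat q) q
  rw [svec_smat] at h
  simp only [sq]
  exact h.symm

/-- Only an inequality, because `svec` sees just the symmetric part of `M`. It follows by duality
from `svec_dotProduct` with `q = svec M`. -/
lemma euclNorm_svec_le (M : Matrix n n ℝ) : euclNorm (svec M) ≤ frobNorm M := by
  rcases (euclNorm_nonneg (svec M)).eq_or_lt with h0 | h0
  · rw [← h0]; exact frobNorm_nonneg _
  have h := svec_dotProduct M (svec M)
  have h1 : ∑ a, ∑ b, M a b * smat (svec M) a b ≤ frobNorm M * frobNorm (smat (svec M)) := by
    simp only [frobNorm_eq_euclNorm]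
    refine le_trans ?_ ((le_abs_self _).trans (abs_dotProduct_le _ _))
    rw [dotProduct, Fintype.sum_prod_type]
  rw [← h, ← euclNorm_sq_eq_dotProduct, frobNorm_smat, sq] at h1
  exact le_of_mul_le_mul_right h1 h0

lemma svec_vecMulVec_dotProduct (z : n → ℝ) (q : Sym2 n → ℝ) :
    svec (vecMulVec z z) ⬝ᵥ q = z ⬝ᵥ smat q *ᵥ z := by
  rw [svec_dotProduct]
  simp only [dotProduct, mulVec, vecMulVec_apply, Finset.mul_sum]
  exact Finset.sum_congr rfl fun a _ => Finset.sum_congr rfl fun b _ => by ring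

lemma abs_smat_dotProduct_le {z : n → ℝ} (q : Sym2 n → ℝ) :
    |svec (vecMulVec z z) ⬝ᵥ q| ≤ euclNorm z ^ 2 * euclNorm q := by
  refine (abs_dotProduct_le _ _).trans ?_
  refine mul_le_mul_of_nonneg_right ((euclNorm_svec_le _).trans ?_) (euclNorm_nonneg _)
  refine abs_le_of_sq_le_sq' ?_ (by positivity) |>.2
  rw [frobNorm_sq, euclNorm_sq, sq (∑ i, z i ^ 2), Finset.sum_mul_sum]
  simp [vecMulVec_apply, mul_pow]

end Svec

end

end CoopLQR

namespace CoopLQR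

noncomputable section

set_option linter.unusedSectionVars false

/-! ### The discrete Lyapunov equation -/

section Lyapunov

variable {n : Type*} [Fintype n] [DecidableEq n]

lemma abs_entry_le_specNorm {m : Type*} [Fintype m] (M : Matrix m n ℝ) (a : m) (b : n) :
    |M a b| ≤ specNorm M := by
  have h := euclNorm_mulVec_le M (Pi.single b 1)
  have h1 : euclNorm (Pi.single b 1 : n → ℝ) = 1 := by
    rw [euclNorm_eq_sqrt]
    simp [Pi.single_apply, Finset.sum_ite_eq']
  rw [h1, mul_one, mulVec_single_one] at h
  exact (abs_apply_le_euclNorm (M.col b) a).trans h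

lemma specNorm_pow_le {τ ρ : ℝ} {X : Matrix n n ℝ} (hX : IsTauRhoStable τ ρ X) (k : ℕ) :
    specNorm (X ^ k) ≤ τ * ρ ^ k := hX.2.2.2 k

lemma IsTauRhoStable.transpose {τ ρ : ℝ} {X : Matrix n n ℝ} (hX : IsTauRhoStable τ ρ X) :
    IsTauRhoStable τ ρ Xᵀ :=
  ⟨hX.1, hX.2.1, hX.2.2.1, fun k => by
    rw [← transpose_pow, specNorm_transpose]; exact hX.2.2.2 k⟩

lemma summable_lyap {τ ρ : ℝ} {X : Matrix n n ℝ} (hX : IsTauRhoStable τ ρ X) (Y : Matrix n n ℝ) :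
    Summable fun k : ℕ => X ^ k * Y * Xᵀ ^ k := by
  obtain ⟨hτ, hρ0, hρ1, hk⟩ := id hX
  refine Pi.summable.2 fun a => Pi.summable.2 fun b => ?_
  have hs : Summable fun k : ℕ => τ ^ 2 * specNorm Y * (ρ ^ 2) ^ k :=
    (summable_geometric_of_lt_one (by positivity) (by nlinarith)).mul_left _
  refine hs.of_norm_bounded fun k => ?_
  refine (abs_entry_le_specNorm _ a b).trans ((specNorm_mul_le _ _).trans ?_)
  have h1 := specNorm_mul_le (X ^ k) Y
  have h2 := specNorm_pow_le hX.transpose k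
  have h3 := hk k
  have h4 := specNorm_nonneg Y
  have h5 : 0 ≤ τ * ρ ^ k := by positivity
  calc specNorm (X ^ k * Y) * specNorm (Xᵀ ^ k)
      ≤ (τ * ρ ^ k * specNorm Y) * (τ * ρ ^ k) := by
        refine mul_le_mul (h1.trans ?_) h2 (specNorm_nonneg _) (by positivity)
        exact mul_le_mul_of_nonneg_right h3 h4
    _ = τ ^ 2 * specNorm Y * (ρ ^ 2) ^ k := by ring

lemma lyap_eq {τ ρ : ℝ} {X : Matrix n n ℝ} (hX : IsTauRhoStable τ ρ X) (Y : Matrix n n ℝ) :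
    lyap X Y = X * lyap X Y * Xᵀ + Y := by
  have hs := summable_lyap hX Y
  have h1 := hs.tsum_eq_zero_add
  unfold lyap
  have hc : Continuous fun M : Matrix n n ℝ => X * M * Xᵀ := by fun_prop
  have h2 : HasSum (fun k : ℕ => X * (X ^ k * Y * Xᵀ ^ k) * Xᵀ)
      (X * (∑' k : ℕ, X ^ k * Y * Xᵀ ^ k) * Xᵀ) :=
    hs.hasSum.map (⟨⟨fun M : Matrix n n ℝ => X * M * Xᵀ, by simp⟩,
      fun a b => by simp [Matrix.mul_add, Matrix.add_mul]⟩ : Matrix n n ℝ →+ Matrix n n ℝ) hc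
  have h3 : (fun k : ℕ => X * (X ^ k * Y * Xᵀ ^ k) * Xᵀ) =
      fun k => X ^ (k + 1) * Y * Xᵀ ^ (k + 1) := by
    ext1 k
    rw [pow_succ' X, pow_succ Xᵀ]
    simp only [Matrix.mul_assoc]
  rw [h3] at h2
  rw [← h2.tsum_eq]
  conv_lhs => rw [h1, add_comm]
  simp

lemma isSymm_lyap (X : Matrix n n ℝ) {Y : Matrix n n ℝ} (hY : Y.IsSymm) : (lyap X Y).IsSymm := by
  unfold lyap
  rw [Matrix.IsSymm, Matrix.transpose_tsum]
  refine tsum_congr fun k => ?_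
  rw [transpose_mul, transpose_mul, hY.eq, transpose_pow, transpose_pow, transpose_transpose,
    Matrix.mul_assoc]

/-- Partial sums of a series with nonnegative terms. With `Y` the covariance of the noise, this
bounds the noise-driven covariance at every finite time by the stationary one. -/
lemma sum_dotProduct_le_lyap {τ ρ : ℝ} {X : Matrix n n ℝ} (hX : IsTauRhoStable τ ρ X)
    {Y : Matrix n n ℝ} (hY : ∀ v, 0 ≤ v ⬝ᵥ Y *ᵥ v) (v : n → ℝ) (t : ℕ) :
    ∑ k ∈ Finset.range t, (Xᵀ ^ k *ᵥ v) ⬝ᵥ Y *ᵥ (Xᵀ ^ k *ᵥ v) ≤ v ⬝ᵥ lyap X Y *ᵥ v := by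
  have hs := (summable_lyap hX Y).hasSum
  have h1 : HasSum (fun k => v ⬝ᵥ (X ^ k * Y * Xᵀ ^ k) *ᵥ v) (v ⬝ᵥ lyap X Y *ᵥ v) := by
    have hc : Continuous fun M : Matrix n n ℝ => v ⬝ᵥ M *ᵥ v := by fun_prop
    exact hs.map (⟨⟨fun M : Matrix n n ℝ => v ⬝ᵥ M *ᵥ v, by simp⟩,
      fun a b => by simp [add_mulVec, dotProduct_add]⟩ : Matrix n n ℝ →+ ℝ) hc
  have h2 : ∀ k, v ⬝ᵥ (X ^ k * Y * Xᵀ ^ k) *ᵥ v = (Xᵀ ^ k *ᵥ v) ⬝ᵥ Y *ᵥ (Xᵀ ^ k *ᵥ v) := by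
    intro k
    rw [← mulVec_mulVec, ← mulVec_mulVec, dotProduct_mulVec, ← mulVec_transpose, transpose_pow]
  simp_rw [h2] at h1
  exact sum_le_hasSum _ (fun k _ => hY _) h1

end Lyapunov

/-! ### Deterministic analysis of LSTDQ -/

section Deterministic

variable {ι κ : Type*} [Fintype ι] [DecidableEq ι] [Fintype κ] [DecidableEq κ]

/-- The quadratic form `x ↦ [x; K x]ᵀ E [x; K x]`. -/
def policyForm (K : Matrix κ ι ℝ) (E : Matrix (ι ⊕ κ) (ι ⊕ κ) ℝ) : Matrix ι ι ℝ :=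
  (fromRows (1 : Matrix ι ι ℝ) K)ᵀ * E * fromRows (1 : Matrix ι ι ℝ) K

/-- The closed loop map `[x; u] ↦ [A x + B u; K (A x + B u)]`. -/
def closedLoop (A : Matrix ι ι ℝ) (B : Matrix ι κ ℝ) (K : Matrix κ ι ℝ) :
    Matrix (ι ⊕ κ) (ι ⊕ κ) ℝ :=
  fromRows (1 : Matrix ι ι ℝ) K * fromCols A B

/-- The noise `x⁺ᵀ P x⁺ - E[x⁺ᵀ P x⁺]` of a quadratic form at `x⁺ = m + w`. -/
def tdNoise (P : Matrix ι ι ℝ) (σw : ℝ) (m x : ι → ℝ) : ℝ :=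
  x ⬝ᵥ P *ᵥ x - m ⬝ᵥ P *ᵥ m - σw ^ 2 * P.trace

lemma isSymm_conj {m n : Type*} [Fintype m] {E : Matrix m m ℝ} (hE : E.IsSymm)
    (X : Matrix m n ℝ) : (Xᵀ * E * X).IsSymm := by
  rw [Matrix.IsSymm, transpose_mul, transpose_mul, transpose_transpose, hE.eq, Matrix.mul_assoc]

lemma dotProduct_conj_mulVec {m n : Type*} [Fintype m] [Fintype n] (E : Matrix m m ℝ)
    (X : Matrix m n ℝ) (v : n → ℝ) : v ⬝ᵥ (Xᵀ * E * X) *ᵥ v = (X *ᵥ v) ⬝ᵥ E *ᵥ (X *ᵥ v) := by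
  rw [← mulVec_mulVec, ← mulVec_mulVec, dotProduct_mulVec, ← mulVec_transpose, transpose_transpose]

lemma isSymm_policyForm {E : Matrix (ι ⊕ κ) (ι ⊕ κ) ℝ} (hE : E.IsSymm) (K : Matrix κ ι ℝ) :
    (policyForm K E).IsSymm := isSymm_conj hE _

lemma frobNorm_policyForm_le (K : Matrix κ ι ℝ) (E : Matrix (ι ⊕ κ) (ι ⊕ κ) ℝ) :
    frobNorm (policyForm K E) ≤ specNormPlus K ^ 2 * frobNorm E := by
  refine (frobNorm_conj_le _ _).trans ?_
  exact mul_le_mul_of_nonneg_right (pow_le_pow_left₀ (specNorm_nonneg _)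
    (specNorm_fromRows_one_le K) 2) (frobNorm_nonneg _)

lemma phiMat_mulVec (T : ℕ) (x : ℕ → ι → ℝ) (u : ℕ → κ → ℝ) (e : Sym2 (ι ⊕ κ) → ℝ) (t : Fin T) :
    (phiMat T x u *ᵥ e) t = Sum.elim (x (t + 1)) (u (t + 1)) ⬝ᵥ
      smat e *ᵥ Sum.elim (x (t + 1)) (u (t + 1)) :=
  svec_vecMulVec_dotProduct _ _

lemma psiMat_mulVec (T : ℕ) (K : Matrix κ ι ℝ) (x : ℕ → ι → ℝ) (e : Sym2 (ι ⊕ κ) → ℝ)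
    (t : Fin T) :
    (psiMat T K x *ᵥ e) t = x (t + 2) ⬝ᵥ policyForm K (smat e) *ᵥ x (t + 2) := by
  rw [policyForm, dotProduct_conj_mulVec, fromRows_mulVec, one_mulVec]
  exact svec_vecMulVec_dotProduct _ _

lemma offsetMat_mulVec (T : ℕ) (K : Matrix κ ι ℝ) (σw : ℝ) (e : Sym2 (ι ⊕ κ) → ℝ) (t : Fin T) :
    (offsetMat T K σw *ᵥ e) t = σw ^ 2 * (policyForm K (smat e)).trace := by
  have h : (offsetMat T K σw *ᵥ e) t =
      svec (σw ^ 2 • (fromRows (1 : Matrix ι ι ℝ) K * (fromRows (1 : Matrix ι ι ℝ) K)ᵀ)) ⬝ᵥ e := rfl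
  rw [h, svec_dotProduct, policyForm, Matrix.mul_assoc, trace_mul_comm, Matrix.mul_assoc]
  have hs := isSymm_smat e
  simp only [Matrix.trace, Matrix.diag, Finset.mul_sum, Matrix.smul_apply, smul_eq_mul, mul_assoc]
  refine Finset.sum_congr rfl fun a _ => ?_
  rw [Matrix.mul_apply (M := smat e), Finset.mul_sum]
  refine Finset.sum_congr rfl fun b _ => ?_
  have h1 : (fromRows (1 : Matrix ι ι ℝ) K * (fromRows (1 : Matrix ι ι ℝ) K)ᵀ) b a =
      (fromRows (1 : Matrix ι ι ℝ) K * (fromRows (1 : Matrix ι ι ℝ) K)ᵀ) a b := by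
    have : (fromRows (1 : Matrix ι ι ℝ) K * (fromRows (1 : Matrix ι ι ℝ) K)ᵀ).IsSymm := by
      rw [Matrix.IsSymm, transpose_mul, transpose_transpose]
    exact this.apply a b
  rw [h1]
  ring

lemma closedLoop_mulVec (A : Matrix ι ι ℝ) (B : Matrix ι κ ℝ) (K : Matrix κ ι ℝ)
    (x : ι → ℝ) (u : κ → ℝ) :
    closedLoop A B K *ᵥ Sum.elim x u = fromRows (1 : Matrix ι ι ℝ) K *ᵥ (A *ᵥ x + B *ᵥ u) := by
  rw [closedLoop, ← mulVec_mulVec, fromCols_mulVec]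
  rfl

/-- Purely algebraic, valid along any trajectory. The form at the next state splits into its value
at the mean `A x + B u`, which is the conjugation by `closedLoop`, the trace term, which the offset
cancels, and the TD noise. -/
lemma tdMat_mulVec (T : ℕ) (A : Matrix ι ι ℝ) (B : Matrix ι κ ℝ) (K : Matrix κ ι ℝ) (σw : ℝ)
    (x : ℕ → ι → ℝ) (u : ℕ → κ → ℝ) (e : Sym2 (ι ⊕ κ) → ℝ) :
    (phiMat T x u - psiMat T K x + offsetMat T K σw) *ᵥ e =
      phiMat T x u *ᵥ (e - svec ((closedLoop A B K)ᵀ * smat e * closedLoop A B K)) -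
      fun t : Fin T => tdNoise (policyForm K (smat e)) σw
        (A *ᵥ x (t + 1) + B *ᵥ u (t + 1)) (x (t + 2)) := by
  ext t
  rw [add_mulVec, sub_mulVec, mulVec_sub]
  simp only [Pi.add_apply, Pi.sub_apply]
  rw [psiMat_mulVec, offsetMat_mulVec, phiMat_mulVec T x u (svec _),
    smat_svec (isSymm_conj (isSymm_smat e) _), dotProduct_conj_mulVec, closedLoop_mulVec,
    ← dotProduct_conj_mulVec, tdNoise]
  change _ = _ - _ ⬝ᵥ policyForm K (smat e) *ᵥ _ - _
  ring

lemma fromCols_mul_fromRows_one (A : Matrix ι ι ℝ) (B : Matrix ι κ ℝ) (K : Matrix κ ι ℝ) :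
    fromCols A B * fromRows (1 : Matrix ι ι ℝ) K = A + B * K := by
  rw [fromCols_mul_fromRows, Matrix.mul_one]

/-- Since `fromCols A B * fromRows 1 K = A + B * K`, powers of the map on state-control pairs are
powers of the stable state matrix between two fixed factors. -/
lemma closedLoop_pow_succ (A : Matrix ι ι ℝ) (B : Matrix ι κ ℝ) (K : Matrix κ ι ℝ) (k : ℕ) :
    closedLoop A B K ^ (k + 1) = fromRows (1 : Matrix ι ι ℝ) K * (A + B * K) ^ k * fromCols A B := by
  induction k with
  | zero => simp [closedLoop]
  | succ k ih =>
    rw [pow_succ, ih, closedLoop, pow_succ, ← fromCols_mul_fromRows_one]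
    simp only [Matrix.mul_assoc]

/-- A bound for the norm of the inverse of `E ↦ E - Lᵀ E L`, `L = closedLoop A B K`. -/
def invBound (A : Matrix ι ι ℝ) (B : Matrix ι κ ℝ) (K : Matrix κ ι ℝ) (τ ρ : ℝ) : ℝ :=
  specNormPlus K ^ 2 * τ ^ 2 * (1 + specNorm A ^ 2 + specNorm B ^ 2) / (1 - ρ ^ 2)

lemma specNorm_closedLoop_pow_succ_sq_le {A : Matrix ι ι ℝ} {B : Matrix ι κ ℝ} {K : Matrix κ ι ℝ}
    {τ ρ : ℝ} (hK : IsTauRhoStable τ ρ (A + B * K)) (k : ℕ) :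
    specNorm (closedLoop A B K ^ (k + 1)) ^ 2 ≤
      specNormPlus K ^ 2 * τ ^ 2 * (specNorm A ^ 2 + specNorm B ^ 2) * (ρ ^ 2) ^ k := by
  rw [closedLoop_pow_succ]
  have h1 := specNorm_mul_le (fromRows (1 : Matrix ι ι ℝ) K * (A + B * K) ^ k) (fromCols A B)
  have h2 := specNorm_mul_le (fromRows (1 : Matrix ι ι ℝ) K) ((A + B * K) ^ k)
  have h3 := specNorm_fromRows_one_le K
  have h4 := specNorm_fromCols_sq_le A B
  have h5 := hK.2.2.2 k
  have h6 : 0 ≤ specNormPlus K := zero_le_one.trans (one_le_specNormPlus K)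
  have h7 : specNorm (fromRows (1 : Matrix ι ι ℝ) K * (A + B * K) ^ k) ≤ specNormPlus K * (τ * ρ ^ k) :=
    h2.trans (mul_le_mul h3 h5 (specNorm_nonneg _) h6)
  calc specNorm (fromRows (1 : Matrix ι ι ℝ) K * (A + B * K) ^ k * fromCols A B) ^ 2
      ≤ (specNorm (fromRows (1 : Matrix ι ι ℝ) K * (A + B * K) ^ k) * specNorm (fromCols A B)) ^ 2 :=
        pow_le_pow_left₀ (specNorm_nonneg _) h1 2
    _ = specNorm (fromRows (1 : Matrix ι ι ℝ) K * (A + B * K) ^ k) ^ 2 * specNorm (fromCols A B) ^ 2 := by ring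
    _ ≤ (specNormPlus K * (τ * ρ ^ k)) ^ 2 * (specNorm A ^ 2 + specNorm B ^ 2) :=
        mul_le_mul (pow_le_pow_left₀ (specNorm_nonneg _) h7 2) h4 (sq_nonneg _) (sq_nonneg _)
    _ = _ := by ring

/-- Iterating `hD` expands `D` into the series `∑ (Lᵏ)ᵀ Y Lᵏ`, whose terms decay geometrically and
whose remainder tends to zero. The term `k = 0` fits into `invBound` because `1 ≤ ‖K‖₊² τ² / (1 -
ρ²)`. -/
lemma frobNorm_le_invBound {A : Matrix ι ι ℝ} {B : Matrix ι κ ℝ} {K : Matrix κ ι ℝ} {τ ρ : ℝ}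
    (hK : IsTauRhoStable τ ρ (A + B * K)) {D Y : Matrix (ι ⊕ κ) (ι ⊕ κ) ℝ}
    (hD : D = Y + (closedLoop A B K)ᵀ * D * closedLoop A B K) :
    frobNorm D ≤ invBound A B K τ ρ * frobNorm Y := by
  obtain ⟨hτ, hρ0, hρ1, -⟩ := id hK
  set L := closedLoop A B K with hL
  set c := specNormPlus K ^ 2 * τ ^ 2 * (specNorm A ^ 2 + specNorm B ^ 2) with hc
  have hK1 := one_le_specNormPlus K
  have hc0 : 0 ≤ c := by positivity
  have hρ2 : ρ ^ 2 < 1 := by nlinarith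
  have hs : ∀ k, specNorm (L ^ (k + 1)) ^ 2 ≤ c * (ρ ^ 2) ^ k :=
    specNorm_closedLoop_pow_succ_sq_le hK
  have hstep : ∀ k, frobNorm ((L ^ k)ᵀ * D * L ^ k) ≤
      specNorm (L ^ k) ^ 2 * frobNorm Y + frobNorm ((L ^ (k + 1))ᵀ * D * L ^ (k + 1)) := by
    intro k
    have h1 : (L ^ k)ᵀ * D * L ^ k =
        (L ^ k)ᵀ * Y * L ^ k + (L ^ (k + 1))ᵀ * D * L ^ (k + 1) := by
      conv_lhs => rw [hD]
      rw [Matrix.mul_add, Matrix.add_mul, pow_succ', transpose_mul]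
      simp only [Matrix.mul_assoc]
    rw [h1]
    exact (frobNorm_add_le _ _).trans (add_le_add (frobNorm_conj_le _ _) le_rfl)
  have hsum : ∀ k, frobNorm D ≤ (1 + ∑ i ∈ Finset.range k, c * (ρ ^ 2) ^ i) * frobNorm Y +
      frobNorm ((L ^ (k + 1))ᵀ * D * L ^ (k + 1)) := by
    intro k
    induction k with
    | zero =>
      have h := hstep 0
      simp only [pow_zero, transpose_one, Matrix.one_mul, Matrix.mul_one] at h
      have h1 : specNorm (1 : Matrix (ι ⊕ κ) (ι ⊕ κ) ℝ) ^ 2 ≤ 1 :=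
        pow_le_one₀ (specNorm_nonneg _) specNorm_one_le
      have := mul_le_mul_of_nonneg_right h1 (frobNorm_nonneg Y)
      simp only [Finset.range_zero, Finset.sum_empty, add_zero]
      linarith
    | succ k ih =>
      have h := hstep (k + 1)
      have := mul_le_mul_of_nonneg_right (hs k) (frobNorm_nonneg Y)
      rw [Finset.sum_range_succ]
      linarith
  have hgeo : ∀ k, 1 + ∑ i ∈ Finset.range k, c * (ρ ^ 2) ^ i ≤ invBound A B K τ ρ := by
    intro k
    have h1 : ∑ i ∈ Finset.range k, (ρ ^ 2) ^ i ≤ (1 - ρ ^ 2)⁻¹ := by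
      have := (summable_geometric_of_lt_one (by positivity) hρ2).sum_le_tsum (Finset.range k)
        (fun i _ => by positivity)
      rwa [tsum_geometric_of_lt_one (by positivity) hρ2] at this
    rw [← Finset.mul_sum]
    have h2 := mul_le_mul_of_nonneg_left h1 hc0
    have h3 : invBound A B K τ ρ = specNormPlus K ^ 2 * τ ^ 2 * (1 - ρ ^ 2)⁻¹ +
        c * (1 - ρ ^ 2)⁻¹ := by
      rw [invBound, hc, div_eq_mul_inv]; ring
    have h4 : 1 ≤ specNormPlus K ^ 2 * τ ^ 2 := by
      nlinarith [one_le_pow₀ hK1 (n := 2), one_le_pow₀ hτ (n := 2)]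
    have h5 : 1 ≤ (1 - ρ ^ 2)⁻¹ := (one_le_inv₀ (by linarith)).2 (by nlinarith)
    have h6 : 1 ≤ specNormPlus K ^ 2 * τ ^ 2 * (1 - ρ ^ 2)⁻¹ := by nlinarith
    linarith
  have hall : ∀ k : ℕ, frobNorm D ≤
      invBound A B K τ ρ * frobNorm Y + c * (ρ ^ 2) ^ k * frobNorm D := by
    intro k
    refine (hsum k).trans (add_le_add ?_ ?_)
    · exact mul_le_mul_of_nonneg_right (hgeo k) (frobNorm_nonneg _)
    · exact (frobNorm_conj_le _ _).trans (mul_le_mul_of_nonneg_right (hs k) (frobNorm_nonneg _))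
  have hlim : Filter.Tendsto (fun k : ℕ => invBound A B K τ ρ * frobNorm Y +
      c * (ρ ^ 2) ^ k * frobNorm D) Filter.atTop
      (nhds (invBound A B K τ ρ * frobNorm Y + c * 0 * frobNorm D)) :=
    (((tendsto_pow_atTop_nhds_zero_of_lt_one (by positivity) hρ2).const_mul c).mul_const
      _).const_add _
  have := ge_of_tendsto' hlim hall
  simpa using this

/-- The symmetric matrix with entries `1/2` at `(i, j)` and `(j, i)`, or `1` if `i = j`. -/
def symSingle (i j : ι) : Matrix ι ι ℝ := (1 / 2 : ℝ) • (single i j 1 + single j i 1)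

lemma isSymm_symSingle (i j : ι) : (symSingle i j).IsSymm := by
  rw [Matrix.IsSymm, symSingle, transpose_smul, transpose_add, transpose_single, transpose_single,
    add_comm]

lemma frobNorm_symSingle_le (i j : ι) : frobNorm (symSingle i j) ≤ 1 := by
  have h1 : ∀ i j : ι, frobNorm (single i j (1 : ℝ)) = 1 := by
    intro i j
    rw [frobNorm, Real.sqrt_eq_one]
    simp [Matrix.single_apply, ite_and]
  have h2 : frobNorm (symSingle i j) = 1 / 2 * frobNorm (single i j (1 : ℝ) + single j i 1) := by
    rw [frobNorm_eq_euclNorm, frobNorm_eq_euclNorm]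
    have := euclNorm_smul (1 / 2) fun p : ι × ι =>
      (single i j (1 : ℝ) + single j i 1 : Matrix ι ι ℝ) p.1 p.2
    rw [abs_of_pos (by norm_num : (0 : ℝ) < 1 / 2)] at this
    exact this
  have h3 := frobNorm_add_le (single i j (1 : ℝ)) (single j i 1)
  rw [h1, h1] at h3
  linarith

lemma eq_sum_symSingle {P : Matrix ι ι ℝ} (hP : P.IsSymm) :
    P = ∑ i, ∑ j, P i j • symSingle i j := by
  have h1 : P = ∑ i, ∑ j, single i j (P i j) := matrix_eq_sum_single P
  have h2 : P = ∑ i, ∑ j, single j i (P i j) := by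
    rw [Finset.sum_comm]
    conv_lhs => rw [h1]
    refine Finset.sum_congr rfl fun i _ => Finset.sum_congr rfl fun j _ => ?_
    rw [hP.apply]
  have h3 : P = (1 / 2 : ℝ) • (P + P) := by
    ext a b; simp; ring
  calc P = (1 / 2 : ℝ) • (P + P) := h3
    _ = (1 / 2 : ℝ) • ((∑ i, ∑ j, single i j (P i j)) + ∑ i, ∑ j, single j i (P i j)) := by
        rw [← h1, ← h2]
    _ = _ := by
        rw [← Finset.sum_add_distrib, Finset.smul_sum]
        refine Finset.sum_congr rfl fun i _ => ?_
        rw [← Finset.sum_add_distrib, Finset.smul_sum]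
        refine Finset.sum_congr rfl fun j _ => ?_
        rw [symSingle, smul_comm (P i j), smul_add (P i j), smul_single, smul_single, smul_eq_mul,
          mul_one]

lemma tdNoise_sum {α : Type*} (s : Finset α) (c : α → ℝ) (P : α → Matrix ι ι ℝ) (σw : ℝ)
    (m x : ι → ℝ) :
    tdNoise (∑ i ∈ s, c i • P i) σw m x = ∑ i ∈ s, c i * tdNoise (P i) σw m x := by
  classical
  induction s using Finset.induction_on with
  | empty => simp [tdNoise]
  | insert a s ha ih =>
    rw [Finset.sum_insert ha, Finset.sum_insert ha, ← ih]
    simp only [tdNoise, add_mulVec, dotProduct_add, smul_mulVec, dotProduct_smul, trace_add,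
      trace_smul, smul_eq_mul]
    ring

/-- Cauchy–Schwarz over the `card²` entries. The factor `card ι` is the source of the additional
`n_x` in the sample size condition. -/
lemma sum_abs_le_card_mul_frobNorm (P : Matrix ι ι ℝ) :
    ∑ i, ∑ j, |P i j| ≤ Fintype.card ι * frobNorm P := by
  rw [frobNorm_eq_euclNorm, ← Fintype.sum_prod_type']
  have h := abs_dotProduct_le (fun p : ι × ι => |P p.1 p.2|) (fun _ => 1)
  have h1 : euclNorm (fun _ : ι × ι => (1 : ℝ)) = Fintype.card ι := by
    rw [euclNorm_eq_sqrt]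
    simp
  have h2 : euclNorm (fun p : ι × ι => |P p.1 p.2|) = euclNorm fun p : ι × ι => P p.1 p.2 := by
    simp [euclNorm_eq_sqrt]
  rw [h1, h2, mul_comm] at h
  refine le_trans ?_ ((le_abs_self _).trans h)
  simp [dotProduct]

/-- If the design matrix is well conditioned and the TD noise is small in all directions, then the
LSTDQ equations are uniquely solvable, with a small error. -/
lemma lstdq_error_le (T : ℕ) {A : Matrix ι ι ℝ} {B : Matrix ι κ ℝ} {K : Matrix κ ι ℝ} {σw : ℝ}
    {x : ℕ → ι → ℝ} {u : ℕ → κ → ℝ} {τ ρ a β : ℝ} (hK : IsTauRhoStable τ ρ (A + B * K))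
    (ha : 0 < a) (hΦ : ∀ e, a * euclNorm e ≤ euclNorm (phiMat T x u *ᵥ e))
    (hβ : ∀ i j e, |(phiMat T x u *ᵥ e) ⬝ᵥ (fun t : Fin T => tdNoise (symSingle i j) σw
        (A *ᵥ x (t + 1) + B *ᵥ u (t + 1)) (x (t + 2)))| ≤ β * euclNorm (phiMat T x u *ᵥ e))
    (hcond : 2 * (β * Fintype.card ι * specNormPlus K ^ 2 * invBound A B K τ ρ) ≤ a) :
    IsUnit (lstdqMat T K σw x u).det ∧
    ∀ (q : Sym2 (ι ⊕ κ) → ℝ) (c : ℕ → ℝ) (βq : ℝ), 0 ≤ βq →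
      (∀ e, |(phiMat T x u *ᵥ e) ⬝ᵥ (fun t : Fin T => tdNoise (policyForm K (smat q)) σw
        (A *ᵥ x (t + 1) + B *ᵥ u (t + 1)) (x (t + 2)))| ≤ βq * euclNorm (phiMat T x u *ᵥ e)) →
      ((fun t : Fin T => c (t + 1)) = phiMat T x u *ᵥ
        (q - svec ((closedLoop A B K)ᵀ * smat q * closedLoop A B K))) →
      euclNorm (lstdq T K σw x u c - q) ≤ 2 * invBound A B K τ ρ / a * βq := by
  obtain ⟨hτ, hρ0, hρ1, -⟩ := id hK
  set Φ := phiMat T x u with hΦdef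
  set Z : Matrix ι ι ℝ → Fin T → ℝ := fun P t => tdNoise P σw
        (A *ᵥ x (t + 1) + B *ᵥ u (t + 1)) (x (t + 2)) with hZ
  set H := invBound A B K τ ρ with hH
  have hK1 := one_le_specNormPlus K
  have hH0 : 0 < H := by
    rw [hH, invBound]
    have : 0 < 1 - ρ ^ 2 := by nlinarith
    positivity
  -- The matrix in the noise will depend on the data, so no single event can be attached to it.
  -- Linearity of the TD noise in `P` transfers the bound from the basis matrices.
  have hβsym : ∀ P : Matrix ι ι ℝ, P.IsSymm → ∀ e,
      |(Φ *ᵥ e) ⬝ᵥ Z P| ≤ β * Fintype.card ι * frobNorm P * euclNorm (Φ *ᵥ e) := by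
    intro P hP e
    have h1 : Z P = ∑ i, ∑ j, P i j • Z (symSingle i j) := by
      ext t
      have h2 : ∑ i, ∑ j, P i j • symSingle i j =
          ∑ p : ι × ι, P p.1 p.2 • symSingle p.1 p.2 := by rw [Fintype.sum_prod_type]
      have h3 := eq_sum_symSingle hP
      rw [h2] at h3
      simp only [hZ]
      conv_lhs => rw [h3]
      rw [tdNoise_sum, Fintype.sum_prod_type]
      simp [Finset.sum_apply]
    rw [h1, dotProduct_sum]
    simp only [dotProduct_sum, dotProduct_smul, smul_eq_mul]
    rcases (euclNorm_nonneg (Φ *ᵥ e)).eq_or_lt with h0 | h0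
    · have : Φ *ᵥ e = 0 := euclNorm_eq_zero_iff.1 h0.symm
      simp [this, euclNorm_zero]
    -- No sign of `β` is assumed; nonnegativity is read off from `hβ` once an index exists, and
    -- empty `ι` is treated apart.
    have hβ0 : ∀ i j : ι, 0 ≤ β := fun i j =>
      nonneg_of_mul_nonneg_left ((abs_nonneg _).trans (hβ i j e)) h0
    calc |∑ i, ∑ j, P i j * ((Φ *ᵥ e) ⬝ᵥ Z (symSingle i j))|
        ≤ ∑ i, ∑ j, |P i j| * (β * euclNorm (Φ *ᵥ e)) := by
          refine (Finset.abs_sum_le_sum_abs _ _).trans (Finset.sum_le_sum fun i _ => ?_)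
          refine (Finset.abs_sum_le_sum_abs _ _).trans (Finset.sum_le_sum fun j _ => ?_)
          rw [abs_mul]
          exact mul_le_mul_of_nonneg_left (hβ i j e) (abs_nonneg _)
      _ = (∑ i, ∑ j, |P i j|) * (β * euclNorm (Φ *ᵥ e)) := by
          simp only [Finset.sum_mul]
      _ ≤ Fintype.card ι * frobNorm P * (β * euclNorm (Φ *ᵥ e)) := by
          rcases isEmpty_or_nonempty ι with hι | ⟨⟨i⟩⟩
          · simp
          · exact mul_le_mul_of_nonneg_right (sum_abs_le_card_mul_frobNorm P)
              (mul_nonneg (hβ0 i i) h0.le)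
      _ = _ := by ring
  have hX : ∀ e, lstdqMat T K σw x u *ᵥ e = Φᵀ *ᵥ (Φ *ᵥ
      (e - svec ((closedLoop A B K)ᵀ * smat e * closedLoop A B K)) - Z (policyForm K (smat e))) := by
    intro e
    rw [lstdqMat, ← mulVec_mulVec, tdMat_mulVec T A B K σw x u e]
  -- Used twice: `r = 0` gives injectivity, and `r` equal to the noise of `q` gives the error bound.
  have main : ∀ (d : Sym2 (ι ⊕ κ) → ℝ) (r : Fin T → ℝ) (βr : ℝ), 0 ≤ βr →
      (∀ e, |(Φ *ᵥ e) ⬝ᵥ r| ≤ βr * euclNorm (Φ *ᵥ e)) →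
      lstdqMat T K σw x u *ᵥ d = Φᵀ *ᵥ r → euclNorm d ≤ 2 * H / a * βr := by
    intro d r βr hβr hr hd
    set y := d - svec ((closedLoop A B K)ᵀ * smat d * closedLoop A B K) with hy
    have h1 : smat d = smat y + (closedLoop A B K)ᵀ * smat d * closedLoop A B K := by
      rw [hy, smat_sub, smat_svec (isSymm_conj (isSymm_smat d) _), sub_add_cancel]
    have h2 := frobNorm_le_invBound hK h1
    rw [frobNorm_smat, frobNorm_smat] at h2
    -- The normal equations are paired with `y` rather than with `d`, which produces `‖Φ y‖²` on one
    -- side.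
    have h3 : euclNorm (Φ *ᵥ y) ^ 2 =
        (Φ *ᵥ y) ⬝ᵥ Z (policyForm K (smat d)) + (Φ *ᵥ y) ⬝ᵥ r := by
      have h4 := congrArg (fun v => y ⬝ᵥ v) (hd.symm.trans (hX d))
      simp only [dotProduct_mulVec, vecMul_transpose] at h4
      rw [dotProduct_sub] at h4
      rw [euclNorm_sq_eq_dotProduct, h4]
      ring
    have h4 := hβsym _ (isSymm_policyForm (isSymm_smat d) K) y
    have h5 := hr y
    have h6 : euclNorm (Φ *ᵥ y) ^ 2 ≤ (β * Fintype.card ι * frobNorm (policyForm K (smat d)) + βr) *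
        euclNorm (Φ *ᵥ y) := by
      rw [h3]
      linarith [le_abs_self ((Φ *ᵥ y) ⬝ᵥ Z (policyForm K (smat d))),
        le_abs_self ((Φ *ᵥ y) ⬝ᵥ r)]
    rcases (euclNorm_nonneg d).eq_or_lt with hd0 | hd0
    · rw [← hd0]
      positivity
    have hy0 : 0 < euclNorm y := by
      by_contra hc
      have : euclNorm y = 0 := le_antisymm (not_lt.1 hc) (euclNorm_nonneg y)
      rw [this, mul_zero] at h2
      linarith
    have hΦy : 0 < euclNorm (Φ *ᵥ y) := lt_of_lt_of_le (by positivity) (hΦ y)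
    have h7 : euclNorm (Φ *ᵥ y) ≤ β * Fintype.card ι * frobNorm (policyForm K (smat d)) + βr := by
      rw [sq] at h6
      exact le_of_mul_le_mul_right h6 hΦy
    have h8 := frobNorm_policyForm_le K (smat d)
    rw [frobNorm_smat] at h8
    have hβ0 : 0 ≤ β * Fintype.card ι := by
      rcases isEmpty_or_nonempty ι with hι | ⟨⟨i⟩⟩
      · simp
      · exact mul_nonneg (nonneg_of_mul_nonneg_left ((abs_nonneg _).trans (hβ i i y)) hΦy)
          (Nat.cast_nonneg _)
    have h9 : a * euclNorm y ≤
        β * Fintype.card ι * (specNormPlus K ^ 2 * euclNorm d) + βr :=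
      (hΦ y).trans (h7.trans (add_le_add (mul_le_mul_of_nonneg_left h8 hβ0) le_rfl))
    have h10 : a * euclNorm d ≤
        H * (β * Fintype.card ι * (specNormPlus K ^ 2 * euclNorm d) + βr) := by
      have := mul_le_mul_of_nonneg_left h2 ha.le
      have h11 := mul_le_mul_of_nonneg_left h9 hH0.le
      linarith
    -- By `hcond` the noise caused by `d` itself uses up at most half of `a ‖d‖`; the other half
    -- bounds `‖d‖`.
    have h12 := mul_le_mul_of_nonneg_right hcond hd0.le
    rw [div_mul_eq_mul_div, le_div_iff₀ ha]
    linarith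
  have hinj : Function.Injective (lstdqMat T K σw x u).mulVec := by
    intro d d' h
    have h1 : lstdqMat T K σw x u *ᵥ (d - d') = Φᵀ *ᵥ 0 := by
      rw [mulVec_sub, mulVec_zero, sub_eq_zero]; exact h
    have h2 := main _ 0 0 le_rfl (fun e => by simp) h1
    rw [mul_zero] at h2
    exact sub_eq_zero.1 (euclNorm_eq_zero_iff.1 (le_antisymm h2 (euclNorm_nonneg _)))
  have hunit : IsUnit (lstdqMat T K σw x u).det :=
    (Matrix.isUnit_iff_isUnit_det _).1 (mulVec_injective_iff_isUnit.1 hinj)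
  refine ⟨hunit, fun q c βq hβq0 hβq hc => main _ _ βq hβq0 hβq ?_⟩
  rw [mulVec_sub, lstdq, mulVec_mulVec, Matrix.mul_nonsing_inv _ hunit, one_mulVec, hX, mulVec_sub,
    hc]
  exact sub_sub_cancel _ _

end Deterministic

end

end CoopLQR

namespace CoopLQR

noncomputable section

set_option linter.unusedSectionVars false

/-! ### The Bellman equation -/

section Bellman

variable {ι κ : Type*} [Fintype ι] [DecidableEq ι] [Fintype κ] [DecidableEq κ]

lemma isSymm_qMat {A : Matrix ι ι ℝ} {B : Matrix ι κ ℝ} {K : Matrix κ ι ℝ}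
    {S : Matrix ι ι ℝ} {R : Matrix κ κ ℝ} (hS : S.IsSymm) (hR : R.IsSymm) :
    (qMat A B K S R).IsSymm := by
  refine Matrix.IsSymm.add ?_ (isSymm_conj (isSymm_lyap _ (hS.add (isSymm_conj hR K))) _)
  exact Matrix.IsSymm.fromBlocks hS (by simp) hR

lemma fromRows_one_conj_fromBlocks (K : Matrix κ ι ℝ) (S : Matrix ι ι ℝ) (R : Matrix κ κ ℝ) :
    (fromRows (1 : Matrix ι ι ℝ) K)ᵀ * fromBlocks S 0 0 R * fromRows (1 : Matrix ι ι ℝ) K =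
      S + Kᵀ * R * K := by
  rw [transpose_fromRows, fromCols_mul_fromBlocks, fromCols_mul_fromRows]
  simp

/-- By the Lyapunov equation `[I; K]ᵀ Q [I; K]` is the value matrix `P`, so conjugating `Q` with the
closed loop gives exactly the second summand of `qMat`. -/
lemma qMat_sub_closedLoop {A : Matrix ι ι ℝ} {B : Matrix ι κ ℝ} {K : Matrix κ ι ℝ}
    {S : Matrix ι ι ℝ} {R : Matrix κ κ ℝ} {τ ρ : ℝ} (hK : IsTauRhoStable τ ρ (A + B * K)) :
    qMat A B K S R - (closedLoop A B K)ᵀ * qMat A B K S R * closedLoop A B K =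
      fromBlocks S 0 0 R := by
  have hP := lyap_eq hK.transpose (S + Kᵀ * R * K)
  rw [transpose_transpose] at hP
  set P := lyap (A + B * K)ᵀ (S + Kᵀ * R * K) with hPdef
  have h1 : (fromRows (1 : Matrix ι ι ℝ) K)ᵀ * qMat A B K S R * fromRows (1 : Matrix ι ι ℝ) K =
      P := by
    rw [qMat, Matrix.mul_add, Matrix.add_mul, fromRows_one_conj_fromBlocks, ← hPdef]
    have h2 : (fromRows (1 : Matrix ι ι ℝ) K)ᵀ * ((fromCols A B)ᵀ * P * fromCols A B) *
        fromRows (1 : Matrix ι ι ℝ) K = (A + B * K)ᵀ * P * (A + B * K) := by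
      rw [← fromCols_mul_fromRows_one, transpose_mul]
      simp only [Matrix.mul_assoc]
    rw [h2, add_comm]
    exact hP.symm
  have h3 : (closedLoop A B K)ᵀ * qMat A B K S R * closedLoop A B K =
      (fromCols A B)ᵀ * P * fromCols A B := by
    rw [closedLoop, transpose_mul, ← h1]
    simp only [Matrix.mul_assoc]
  rw [h3, qMat, ← hPdef, add_sub_cancel_right]

lemma phiMat_mulVec_qMat (T : ℕ) {A : Matrix ι ι ℝ} {B : Matrix ι κ ℝ} {K : Matrix κ ι ℝ}
    {S : Matrix ι ι ℝ} {R : Matrix κ κ ℝ} {τ ρ : ℝ} (hK : IsTauRhoStable τ ρ (A + B * K))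
    (hS : S.IsSymm) (hR : R.IsSymm) (x : ℕ → ι → ℝ) (u : ℕ → κ → ℝ) :
    phiMat T x u *ᵥ (svec (qMat A B K S R) -
      svec ((closedLoop A B K)ᵀ * smat (svec (qMat A B K S R)) * closedLoop A B K)) =
    fun t : Fin T => x (t + 1) ⬝ᵥ S *ᵥ x (t + 1) + u (t + 1) ⬝ᵥ R *ᵥ u (t + 1) := by
  ext t
  rw [smat_svec (isSymm_qMat hS hR), ← svec_sub, qMat_sub_closedLoop hK, phiMat_mulVec,
    smat_svec (Matrix.IsSymm.fromBlocks hS (by simp) hR), fromBlocks_mulVec]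
  simp [dotProduct, Fintype.sum_sum_type]

end Bellman

/-! ### Restriction to closed sets of agents -/

section Restriction

variable {N : ℕ}

/-- The inclusion of the coordinates of a smaller set of agents. -/
def idxIncl {s₁ s₂ : Finset (Fin N)} (h : s₁ ⊆ s₂) (n : ℕ) : Idx s₁ n → Idx s₂ n :=
  fun p => (⟨p.1.1, h p.1.2⟩, p.2)

lemma idxIncl_injective {s₁ s₂ : Finset (Fin N)} (h : s₁ ⊆ s₂) (n : ℕ) :
    Function.Injective (idxIncl h n) := by
  rintro ⟨⟨a, ha⟩, b⟩ ⟨⟨a', ha'⟩, b'⟩ hab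
  simp only [idxIncl, Prod.mk.injEq, Subtype.mk.injEq] at hab
  simp [hab.1, hab.2]

lemma proj_apply {s₁ s₂ : Finset (Fin N)} (h : s₁ ⊆ s₂) (n : ℕ) (p : Idx s₁ n) (q : Idx s₂ n) :
    proj s₁ s₂ n p q = if idxIncl h n p = q then 1 else 0 := by
  obtain ⟨⟨a, ha⟩, b⟩ := p
  obtain ⟨⟨a', ha'⟩, b'⟩ := q
  simp [proj, idxIncl]

lemma proj_mul {s₁ s₂ : Finset (Fin N)} (h : s₁ ⊆ s₂) (n : ℕ) {l : Type*}
    (X : Matrix (Idx s₂ n) l ℝ) : proj s₁ s₂ n * X = X.submatrix (idxIncl h n) id := by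
  ext p q
  simp [Matrix.mul_apply, proj_apply h]

lemma proj_mulVec {s₁ s₂ : Finset (Fin N)} (h : s₁ ⊆ s₂) (n : ℕ) (v : Idx s₂ n → ℝ) :
    proj s₁ s₂ n *ᵥ v = v ∘ idxIncl h n := by
  ext p
  simp [mulVec, dotProduct, proj_apply h]

lemma proj_mul_proj {s₁ s₂ s₃ : Finset (Fin N)} (h₁ : s₁ ⊆ s₂) (n : ℕ) :
    proj s₁ s₂ n * proj s₂ s₃ n = proj s₁ s₃ n := by
  rw [proj_mul h₁]
  ext p q
  rfl

/-- The rows of `M` in `s` have no entries in columns outside `s`. -/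
def ClosedOn {m n : ℕ} (s : Finset (Fin N)) (M : Matrix (Fin N × Fin m) (Fin N × Fin n) ℝ) : Prop :=
  ∀ i ∈ s, ∀ j ∉ s, ∀ a b, M (i, a) (j, b) = 0

lemma sum_eq_sum_idx {n : ℕ} (s : Finset (Fin N)) (f : Fin N × Fin n → ℝ)
    (hf : ∀ j ∉ s, ∀ b, f (j, b) = 0) : ∑ q, f q = ∑ q : Idx s n, f (q.1.1, q.2) := by
  rw [Fintype.sum_prod_type, Fintype.sum_prod_type]
  refine Eq.symm ((Finset.sum_coe_sort s fun j => ∑ b, f (j, b)).trans ?_)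
  exact Finset.sum_subset (Finset.subset_univ s)
    fun j _ hj => Finset.sum_eq_zero fun b _ => hf j hj b

lemma subVec_mulVec {m n : ℕ} {s : Finset (Fin N)}
    {M : Matrix (Fin N × Fin m) (Fin N × Fin n) ℝ} (hM : ClosedOn s M) (v : Fin N × Fin n → ℝ) :
    subVec s (M *ᵥ v) = subMat s M *ᵥ subVec s v := by
  ext p
  simp only [subVec, subMat, mulVec, dotProduct, submatrix_apply]
  exact sum_eq_sum_idx s (fun q => M (p.1.1, p.2) q * v q) fun j hj b => by
    rw [hM _ p.1.2 j hj, zero_mul]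

/-- Rows in `s₁` have no entries in columns outside `s₁`, so forgetting the coordinates of `s₂`
outside `s₁` commutes with the dynamics. -/
lemma proj_mul_subMat {m n : ℕ} {s₁ s₂ : Finset (Fin N)} (h : s₁ ⊆ s₂)
    {M : Matrix (Fin N × Fin m) (Fin N × Fin n) ℝ} (hM : ClosedOn s₁ M) :
    proj s₁ s₂ m * subMat s₂ M = subMat s₁ M * proj s₁ s₂ n := by
  rw [proj_mul h]
  ext p q
  simp only [submatrix_apply, id, subMat, Matrix.mul_apply, idxIncl]
  by_cases hq : q.1.1 ∈ s₁
  · rw [Finset.sum_eq_single (⟨q.1.1, hq⟩, q.2)]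
    · simp [proj]
    · rintro ⟨⟨a, ha⟩, b⟩ _ hab
      have : ¬ (a = q.1.1 ∧ b = q.2) := by
        rintro ⟨rfl, rfl⟩; exact hab rfl
      simp [proj, this]
    · simp
  · rw [hM _ p.1.2 _ hq]
    symm
    refine Finset.sum_eq_zero fun r _ => ?_
    have : ¬ (r.1.1 = q.1.1 ∧ r.2 = q.2) := by
      rintro ⟨h1, -⟩; exact hq (h1 ▸ r.1.2)
    simp [proj, this]

lemma euclNorm_comp_le {m n : Type*} [Fintype m] [Fintype n] {f : m → n}
    (hf : Function.Injective f) (v : n → ℝ) : euclNorm (v ∘ f) ≤ euclNorm v := by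
  classical
  rw [euclNorm_eq_sqrt, euclNorm_eq_sqrt]
  refine Real.sqrt_le_sqrt ?_
  have := Finset.sum_image (s := Finset.univ) (f := fun i => v i ^ 2) (g := f) (fun a _ b _ h => hf h)
  simp only [Function.comp]
  rw [← this]
  exact Finset.sum_le_sum_of_subset_of_nonneg (Finset.subset_univ _) fun i _ _ => sq_nonneg _

end Restriction

/-! ### Decomposition of the summed Q-function -/

section Decomposition

/-- Stability is required of the small matrices `Xj j` only. Every term of the series for `X`
factors through them, which gives convergence and the value of the sum at once. -/
lemma lyap_sum_conj {α n : Type*} [Fintype n] [DecidableEq n] {k : α → Type*} [∀ j, Fintype (k j)]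
    [∀ j, DecidableEq (k j)] (s : Finset α) {τ ρ : α → ℝ} {X : Matrix n n ℝ}
    {Xj Y : ∀ j, Matrix (k j) (k j) ℝ} (hXj : ∀ j ∈ s, IsTauRhoStable (τ j) (ρ j) (Xj j))
    {P : ∀ j, Matrix (k j) n ℝ} (hP : ∀ j ∈ s, X * (P j)ᵀ = (P j)ᵀ * Xj j) :
    lyap X (∑ j ∈ s, (P j)ᵀ * Y j * P j) = ∑ j ∈ s, (P j)ᵀ * lyap (Xj j) (Y j) * P j := by
  have hpow : ∀ j ∈ s, ∀ i : ℕ, X ^ i * (P j)ᵀ = (P j)ᵀ * Xj j ^ i := by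
    intro j hj i
    induction i with
    | zero => simp
    | succ i ih => rw [pow_succ, Matrix.mul_assoc, hP j hj, ← Matrix.mul_assoc, ih, pow_succ,
        Matrix.mul_assoc]
  refine HasSum.tsum_eq ?_
  have h1 : ∀ i : ℕ, X ^ i * (∑ j ∈ s, (P j)ᵀ * Y j * P j) * Xᵀ ^ i =
      ∑ j ∈ s, (P j)ᵀ * (Xj j ^ i * Y j * (Xj j)ᵀ ^ i) * P j := by
    intro i
    rw [Matrix.mul_sum, Matrix.sum_mul]
    refine Finset.sum_congr rfl fun j hj => ?_
    have h2 := hpow j hj i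
    have h3 := congrArg Matrix.transpose h2
    rw [transpose_mul, transpose_mul, transpose_transpose, transpose_pow, transpose_pow] at h3
    calc X ^ i * ((P j)ᵀ * Y j * P j) * Xᵀ ^ i
        = (X ^ i * (P j)ᵀ) * Y j * (P j * Xᵀ ^ i) := by simp only [Matrix.mul_assoc]
      _ = _ := by rw [h2, h3]; simp only [Matrix.mul_assoc]
  simp_rw [h1]
  refine hasSum_sum fun j hj => ?_
  have hc : Continuous fun M : Matrix (k j) (k j) ℝ => (P j)ᵀ * M * P j := by fun_prop
  exact (summable_lyap (hXj j hj) (Y j)).hasSum.map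
    (⟨⟨fun M : Matrix (k j) (k j) ℝ => (P j)ᵀ * M * P j, by simp⟩,
      fun a b => by simp [Matrix.mul_add, Matrix.add_mul]⟩ :
      Matrix (k j) (k j) ℝ →+ Matrix n n ℝ) hc

lemma fromBlocks_sum {α m n : Type*} (s : Finset α) (S : α → Matrix m m ℝ) (R : α → Matrix n n ℝ) :
    fromBlocks (∑ j ∈ s, S j) 0 0 (∑ j ∈ s, R j) = ∑ j ∈ s, fromBlocks (S j) 0 0 (R j) := by
  classical
  induction s using Finset.induction_on with
  | empty => simp
  | insert a s ha ih =>
    rw [Finset.sum_insert ha, Finset.sum_insert ha, Finset.sum_insert ha, ← ih, fromBlocks_add]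
    simp

/-- The relations `hA`, `hB`, `hK` make each small system a factor of the large one. They pass to
the closed loop matrices, hence to the Lyapunov solutions; the remaining blocks of `qMat` are
conjugated directly. -/
lemma qMat_sum_conj {α ι κ : Type*} [Fintype ι] [DecidableEq ι] [Fintype κ] [DecidableEq κ]
    {ι' κ' : α → Type*} [∀ j, Fintype (ι' j)] [∀ j, DecidableEq (ι' j)] [∀ j, Fintype (κ' j)]
    [∀ j, DecidableEq (κ' j)] (s : Finset α) {τ ρ : α → ℝ}
    {A : Matrix ι ι ℝ} {B : Matrix ι κ ℝ} {K : Matrix κ ι ℝ}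
    {A' : ∀ j, Matrix (ι' j) (ι' j) ℝ} {B' : ∀ j, Matrix (ι' j) (κ' j) ℝ}
    {K' : ∀ j, Matrix (κ' j) (ι' j) ℝ} {S : ∀ j, Matrix (ι' j) (ι' j) ℝ}
    {R : ∀ j, Matrix (κ' j) (κ' j) ℝ} {P : ∀ j, Matrix (ι' j) ι ℝ} {U : ∀ j, Matrix (κ' j) κ ℝ}
    (hst : ∀ j ∈ s, IsTauRhoStable (τ j) (ρ j) (A' j + B' j * K' j))
    (hA : ∀ j ∈ s, P j * A = A' j * P j) (hB : ∀ j ∈ s, P j * B = B' j * U j)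
    (hK : ∀ j ∈ s, U j * K = K' j * P j) :
    qMat A B K (∑ j ∈ s, (P j)ᵀ * S j * P j) (∑ j ∈ s, (U j)ᵀ * R j * U j) =
      ∑ j ∈ s, (fromBlocks (P j) 0 0 (U j))ᵀ * qMat (A' j) (B' j) (K' j) (S j) (R j) *
        fromBlocks (P j) 0 0 (U j) := by
  have hcl : ∀ j ∈ s, (A + B * K)ᵀ * (P j)ᵀ = (P j)ᵀ * (A' j + B' j * K' j)ᵀ := by
    intro j hj
    rw [← transpose_mul, ← transpose_mul, Matrix.mul_add, Matrix.add_mul, hA j hj,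
      ← Matrix.mul_assoc, hB j hj, Matrix.mul_assoc, hK j hj, Matrix.mul_assoc]
  have hY : ∑ j ∈ s, (P j)ᵀ * S j * P j + Kᵀ * (∑ j ∈ s, (U j)ᵀ * R j * U j) * K =
      ∑ j ∈ s, (P j)ᵀ * (S j + (K' j)ᵀ * R j * K' j) * P j := by
    rw [Matrix.mul_sum, Matrix.sum_mul, ← Finset.sum_add_distrib]
    refine Finset.sum_congr rfl fun j hj => ?_
    rw [Matrix.mul_add, Matrix.add_mul]
    congr 1
    have h1 := congrArg Matrix.transpose (hK j hj)
    rw [transpose_mul, transpose_mul] at h1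
    calc Kᵀ * ((U j)ᵀ * R j * U j) * K = (Kᵀ * (U j)ᵀ) * R j * (U j * K) := by
          simp only [Matrix.mul_assoc]
      _ = _ := by rw [h1, hK j hj]; simp only [Matrix.mul_assoc]
  rw [qMat, hY, lyap_sum_conj s (fun j hj => (hst j hj).transpose) hcl, fromBlocks_sum,
    Matrix.mul_sum, Matrix.sum_mul, ← Finset.sum_add_distrib]
  refine Finset.sum_congr rfl fun j hj => ?_
  rw [qMat, Matrix.mul_add, Matrix.add_mul]
  congr 1
  · rw [fromBlocks_transpose, fromBlocks_multiply, fromBlocks_multiply]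
    simp
  · have h2 : P j * fromCols A B = fromCols (A' j) (B' j) * fromBlocks (P j) 0 0 (U j) := by
      rw [mul_fromCols, fromCols_mul_fromBlocks, hA j hj, hB j hj]
      simp
    have h3 := congrArg Matrix.transpose h2
    rw [transpose_mul, transpose_mul] at h3
    set L := lyap (A' j + B' j * K' j)ᵀ (S j + (K' j)ᵀ * R j * K' j)
    calc (fromCols A B)ᵀ * ((P j)ᵀ * L * P j) * fromCols A B
        = ((fromCols A B)ᵀ * (P j)ᵀ) * L * (P j * fromCols A B) := by simp only [Matrix.mul_assoc]
      _ = _ := by rw [h2, h3]; simp only [Matrix.mul_assoc]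

end Decomposition

/-! ### Dependence sets and the error of the indirect estimate. -/

namespace System

variable {N nx nu : ℕ} (M : System N nx nu)

lemma mem_IQ {i j : Fin N} :
    j ∈ M.IQ i ↔ ∃ k ∈ M.setC i, Relation.ReflTransGen M.EdgeSO j k := by
  simp [IQ]

lemma setC_subset_IQ (i : Fin N) : M.setC i ⊆ M.IQ i :=
  fun k hk => M.mem_IQ.2 ⟨k, hk, Relation.ReflTransGen.refl⟩

/-- Prepending an edge to a path. This closure under predecessors makes the system restricted to `IQ
i` autonomous. -/
lemma mem_IQ_of_edge {i j k : Fin N} (hj : j ∈ M.IQ i) (h : M.EdgeSO k j) : k ∈ M.IQ i := by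
  obtain ⟨l, hl, hjl⟩ := M.mem_IQ.1 hj
  exact M.mem_IQ.2 ⟨l, hl, Relation.ReflTransGen.head h hjl⟩

lemma closedOn_A (i : Fin N) : ClosedOn (M.IQ i) M.A :=
  fun _ hj _ hk _ _ => M.A_supp _ _ _ _ fun h => hk (M.mem_IQ_of_edge hj (Or.inl h))

lemma closedOn_B (i : Fin N) : ClosedOn (M.IQ i) M.B :=
  fun _ hj _ hk _ _ => M.B_supp _ _ _ _ fun h => hk (M.mem_IQ_of_edge hj (Or.inl h))

lemma closedOn_gain {K : Matrix (Fin N × Fin nu) (Fin N × Fin nx) ℝ} (hK : M.IsStructuredGain K)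
    (i : Fin N) : ClosedOn (M.IQ i) K :=
  fun _ hj _ hk _ _ => hK _ _ _ _ fun h => hk (M.mem_IQ_of_edge hj (Or.inr h))

lemma IQ_subset_IQhat {i j : Fin N} (hj : j ∈ M.IGD i) : M.IQ j ⊆ M.IQhat i :=
  Finset.subset_biUnion_of_mem M.IQ hj

lemma isSymm_costS (j : Fin N) (s : Finset (Fin N)) : (M.costS j s).IsSymm :=
  isSymm_conj (by
    have := (M.S_psd j).isHermitian
    rwa [Matrix.IsHermitian, conjTranspose_eq_transpose_of_trivial] at this) _

lemma isSymm_costR (j : Fin N) (s : Finset (Fin N)) : (M.costR j s).IsSymm :=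
  isSymm_conj (by
    have := (M.R_pd j).isHermitian
    rwa [Matrix.IsHermitian, conjTranspose_eq_transpose_of_trivial] at this) _

lemma isSymm_qTrue (K : Matrix (Fin N × Fin nu) (Fin N × Fin nx) ℝ) (j : Fin N) :
    (M.qTrue K j).IsSymm :=
  isSymm_qMat (M.isSymm_costS _ _) (M.isSymm_costR _ _)

lemma cost_eq (j : Fin N) (x : Fin N × Fin nx → ℝ) (u : Fin N × Fin nu → ℝ) :
    M.cost j x u = subVec (M.IQ j) x ⬝ᵥ M.costS j (M.IQ j) *ᵥ subVec (M.IQ j) x +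
      subVec (M.IQ j) u ⬝ᵥ M.costR j (M.IQ j) *ᵥ subVec (M.IQ j) u := by
  rw [costS, costR, dotProduct_conj_mulVec, dotProduct_conj_mulVec,
    proj_mulVec (M.setC_subset_IQ j), proj_mulVec (M.setC_subset_IQ j)]
  rfl

lemma qHatTrue_eq_sum {K : Matrix (Fin N × Fin nu) (Fin N × Fin nx) ℝ} (hK : M.IsStructuredGain K)
    {i : Fin N} {τ ρ : Fin N → ℝ} (hst : ∀ j ∈ M.IGD i, IsTauRhoStable (τ j) (ρ j)
      (subMat (M.IQ j) M.A + subMat (M.IQ j) M.B * subMat (M.IQ j) K)) :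
    M.qHatTrue K i = ∑ j ∈ M.IGD i, (M.projQ i j)ᵀ * M.qTrue K j * M.projQ i j := by
  have hS : ∀ j ∈ M.IGD i, M.costS j (M.IQhat i) = (proj (M.IQ j) (M.IQhat i) nx)ᵀ *
      M.costS j (M.IQ j) * proj (M.IQ j) (M.IQhat i) nx := by
    intro j _
    rw [costS, costS, ← proj_mul_proj (M.setC_subset_IQ j) nx, transpose_mul]
    simp only [Matrix.mul_assoc]
  have hR : ∀ j ∈ M.IGD i, M.costR j (M.IQhat i) = (proj (M.IQ j) (M.IQhat i) nu)ᵀ *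
      M.costR j (M.IQ j) * proj (M.IQ j) (M.IQhat i) nu := by
    intro j _
    rw [costR, costR, ← proj_mul_proj (M.setC_subset_IQ j) nu, transpose_mul]
    simp only [Matrix.mul_assoc]
  rw [qHatTrue, Finset.sum_congr rfl hS, Finset.sum_congr rfl hR]
  exact qMat_sum_conj (M.IGD i) hst
    (fun j hj => proj_mul_subMat (M.IQ_subset_IQhat hj) (M.closedOn_A j))
    (fun j hj => proj_mul_subMat (M.IQ_subset_IQhat hj) (M.closedOn_B j))
    (fun j hj => proj_mul_subMat (M.IQ_subset_IQhat hj) (M.closedOn_gain hK j))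

lemma specNorm_projQ_le {i j : Fin N} (hj : j ∈ M.IGD i) : specNorm (M.projQ i j) ≤ 1 := by
  refine specNorm_le_of_forall zero_le_one fun v => ?_
  have h := M.IQ_subset_IQhat hj
  have h1 : M.projQ i j *ᵥ v = v ∘ Sum.map (idxIncl h nx) (idxIncl h nu) := by
    rw [projQ, fromBlocks_mulVec, zero_mulVec, zero_mulVec, add_zero, zero_add, proj_mulVec h,
      proj_mulVec h]
    ext p
    cases p <;> rfl
  rw [h1, one_mul]
  exact euclNorm_comp_le ((idxIncl_injective h nx).sumMap (idxIncl_injective h nu)) v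

/-- The error of the indirect estimate is at most the sum of the errors of the estimates `q_j`. -/
lemma euclNorm_qHatTrue_sub_qIndirect_le {K : Matrix (Fin N × Fin nu) (Fin N × Fin nx) ℝ}
    (hK : M.IsStructuredGain K) {i : Fin N} {τ ρ : Fin N → ℝ}
    (hst : ∀ j ∈ M.IGD i, IsTauRhoStable (τ j) (ρ j)
      (subMat (M.IQ j) M.A + subMat (M.IQ j) M.B * subMat (M.IQ j) K))
    (σw : ℝ) (T : ℕ) (x : ℕ → Fin N × Fin nx → ℝ) (u : ℕ → Fin N × Fin nu → ℝ) :
    euclNorm (svec (M.qHatTrue K i) - M.qIndirect K σw T x u i) ≤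
      ∑ j ∈ M.IGD i, euclNorm (M.agentLstdq K σw T x u j - svec (M.qTrue K j)) := by
  rw [M.qHatTrue_eq_sum hK hst, svec_sum, qIndirect, ← Finset.sum_sub_distrib]
  refine (euclNorm_sum_le _ _).trans (Finset.sum_le_sum fun j hj => ?_)
  rw [← svec_sub, ← Matrix.sub_mul, ← Matrix.mul_sub]
  refine (euclNorm_svec_le _).trans ((frobNorm_conj_le _ _).trans ?_)
  have h1 : M.qTrue K j - smat (M.agentLstdq K σw T x u j) =
      smat (svec (M.qTrue K j) - M.agentLstdq K σw T x u j) := by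
    rw [smat_sub, smat_svec (M.isSymm_qTrue K j)]
  have h2 : euclNorm (svec (M.qTrue K j) - M.agentLstdq K σw T x u j) =
      euclNorm (M.agentLstdq K σw T x u j - svec (M.qTrue K j)) := by
    have := euclNorm_smul (-1) (M.agentLstdq K σw T x u j - svec (M.qTrue K j))
    rw [abs_neg, abs_one, one_mul] at this
    rw [← this]
    congr 1
    simp
  rw [h1, frobNorm_smat, h2]
  exact mul_le_of_le_one_left (euclNorm_nonneg _)
    (pow_le_one₀ (specNorm_nonneg _) (M.specNorm_projQ_le hj))

end System

end

end CoopLQR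

namespace CoopLQR

noncomputable section

set_option linter.unusedSectionVars false

open scoped ENNReal

/-! ### Linear systems driven by Gaussian noise -/

section Driven

variable {ι κ : Type*} [Fintype ι] [DecidableEq ι] [Fintype κ] [DecidableEq κ]

/-- The next state and control `(A x + B u + σ_w g₁, K_play (A x + B u + σ_w g₁) + σ_η g₂)`. -/
def stepFun (A : Matrix ι ι ℝ) (B : Matrix ι κ ℝ) (Kp : Matrix κ ι ℝ) (σw ση : ℝ)
    (z : (ι → ℝ) × (κ → ℝ)) (g : ι ⊕ κ → ℝ) : (ι → ℝ) × (κ → ℝ) :=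
  (A *ᵥ z.1 + B *ᵥ z.2 + σw • (g ∘ Sum.inl),
    Kp *ᵥ (A *ᵥ z.1 + B *ᵥ z.2 + σw • (g ∘ Sum.inl)) + ση • (g ∘ Sum.inr))

/-- The trajectory with initial value `z` and noise sequence `g`. -/
def traj (A : Matrix ι ι ℝ) (B : Matrix ι κ ℝ) (Kp : Matrix κ ι ℝ) (σw ση : ℝ)
    (z : (ι → ℝ) × (κ → ℝ)) (g : ℕ → ι ⊕ κ → ℝ) : ℕ → (ι → ℝ) × (κ → ℝ)
  | 0 => z
  | t + 1 => stepFun A B Kp σw ση (traj A B Kp σw ση z g t) (g t)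

/-- The first `t` terms of a sequence, followed by zeros. -/
def truncSeq {G : Type*} [Zero G] (t : ℕ) (g : ℕ → G) : ℕ → G := fun s => if s < t then g s else 0

/-- A state-control process `z` driven by independent standard Gaussian noise `g`, with sub-Gaussian
initial value. -/
structure IsDriven {Ω : Type*} [MeasurableSpace Ω] (μ : Measure Ω) (A : Matrix ι ι ℝ)
    (B : Matrix ι κ ℝ) (Kp : Matrix κ ι ℝ) (σw ση m₀ : ℝ) (z : ℕ → Ω → (ι → ℝ) × (κ → ℝ))
    (g : ℕ → Ω → ι ⊕ κ → ℝ) : Prop where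
  aemeasurable_init : AEMeasurable (z 0) μ
  law_noise : ∀ t, HasLaw (g t) (stdGauss (ι ⊕ κ)) μ
  indep : ∀ t, IndepFun (fun ω => (z 0 ω, truncSeq t fun s => g s ω)) (g t) μ
  step : ∀ t ω, z (t + 1) ω = stepFun A B Kp σw ση (z t ω) (g t ω)
  init_mgf : ∀ v : ι → ℝ,
    ∫⁻ ω, ENNReal.ofReal (Real.exp (v ⬝ᵥ (A *ᵥ (z 0 ω).1 + B *ᵥ (z 0 ω).2))) ∂μ ≤
      ENNReal.ofReal (Real.exp (1 / 2 + m₀ * euclNorm ((A + B * Kp)ᵀ *ᵥ v) ^ 2 / 2 +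
        ση ^ 2 * euclNorm (Bᵀ *ᵥ v) ^ 2 / 2))

variable {A : Matrix ι ι ℝ} {B : Matrix ι κ ℝ} {Kp : Matrix κ ι ℝ} {σw ση m₀ : ℝ}

lemma measurable_stepFun : Measurable (Function.uncurry (stepFun A B Kp σw ση)) := by
  refine Measurable.prodMk ?_ ?_ <;>
  · refine measurable_pi_lambda _ fun i => ?_
    simp only [mulVec, dotProduct, Pi.add_apply, Pi.smul_apply, Function.comp, smul_eq_mul]
    fun_prop

lemma measurable_traj (t : ℕ) :
    Measurable fun p : ((ι → ℝ) × (κ → ℝ)) × (ℕ → ι ⊕ κ → ℝ) =>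
      traj A B Kp σw ση p.1 p.2 t := by
  induction t with
  | zero => exact measurable_fst
  | succ t ih =>
    have h2 : Measurable fun p : ((ι → ℝ) × (κ → ℝ)) × (ℕ → ι ⊕ κ → ℝ) => p.2 t :=
      (measurable_pi_apply t).comp measurable_snd
    have h1 : Measurable fun p : ((ι → ℝ) × (κ → ℝ)) × (ℕ → ι ⊕ κ → ℝ) =>
        (traj A B Kp σw ση p.1 p.2 t, p.2 t) := ih.prodMk h2
    have h3 : (fun p : ((ι → ℝ) × (κ → ℝ)) × (ℕ → ι ⊕ κ → ℝ) =>
        traj A B Kp σw ση p.1 p.2 (t + 1)) = Function.uncurry (stepFun A B Kp σw ση) ∘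
        fun p => (traj A B Kp σw ση p.1 p.2 t, p.2 t) := rfl
    rw [h3]
    exact measurable_stepFun.comp h1

lemma traj_congr {z : (ι → ℝ) × (κ → ℝ)} {g g' : ℕ → ι ⊕ κ → ℝ} {t : ℕ}
    (h : ∀ s < t, g s = g' s) : traj A B Kp σw ση z g t = traj A B Kp σw ση z g' t := by
  induction t with
  | zero => rfl
  | succ t ih =>
    simp only [traj]
    rw [ih fun s hs => h s (hs.trans t.lt_succ_self), h t t.lt_succ_self]

variable {Ω : Type*} [MeasurableSpace Ω] {μ : Measure Ω} [IsProbabilityMeasure μ]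
  {z : ℕ → Ω → (ι → ℝ) × (κ → ℝ)} {g : ℕ → Ω → ι ⊕ κ → ℝ}

namespace IsDriven

lemma eq_traj (h : IsDriven μ A B Kp σw ση m₀ z g) (t : ℕ) (ω : Ω) :
    z t ω = traj A B Kp σw ση (z 0 ω) (fun s => g s ω) t := by
  induction t with
  | zero => rfl
  | succ t ih => rw [h.step, ih]; rfl

/-- Padding the past noise with zeros gives the history a type that does not depend on `t`; all
states up to time `t` are functions of it. -/
lemma eq_traj_truncSeq (h : IsDriven μ A B Kp σw ση m₀ z g) {s t : ℕ} (hst : s ≤ t) (ω : Ω) :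
    z s ω = traj A B Kp σw ση (z 0 ω) (truncSeq t fun s => g s ω) s := by
  rw [h.eq_traj]
  exact traj_congr fun r hr => by simp [truncSeq, hr.trans_le hst]

lemma aemeasurable_noise (h : IsDriven μ A B Kp σw ση m₀ z g) (t : ℕ) : AEMeasurable (g t) μ :=
  (h.law_noise t).aemeasurable

lemma aemeasurable_hist (h : IsDriven μ A B Kp σw ση m₀ z g) (t : ℕ) :
    AEMeasurable (fun ω => (z 0 ω, truncSeq t fun s => g s ω)) μ := by
  refine h.aemeasurable_init.prodMk (aemeasurable_pi_lambda _ fun s => ?_)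
  by_cases hs : s < t
  · simp only [truncSeq, hs, if_true]; exact h.aemeasurable_noise s
  · simp only [truncSeq, hs, if_false]; exact aemeasurable_const

lemma aemeasurable_state (h : IsDriven μ A B Kp σw ση m₀ z g) (t : ℕ) : AEMeasurable (z t) μ := by
  have : z t = (fun p : ((ι → ℝ) × (κ → ℝ)) × (ℕ → ι ⊕ κ → ℝ) => traj A B Kp σw ση p.1 p.2 t) ∘
      fun ω => (z 0 ω, truncSeq t fun s => g s ω) := by
    ext1 ω; exact h.eq_traj_truncSeq le_rfl ω
  rw [this]
  exact (measurable_traj t).comp_aemeasurable (h.aemeasurable_hist t)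

/-- The tower property without conditional expectations: `g t` is independent of the history, so the
joint law is a product, and Fubini integrates `g t` first. It is essential that `hc` is uniform in
the current state. -/
lemma lintegral_hist_mul_le (h : IsDriven μ A B Kp σw ση m₀ z g) (t : ℕ)
    {F : ((ι → ℝ) × (κ → ℝ)) × (ℕ → ι ⊕ κ → ℝ) → ℝ≥0∞} (hF : Measurable F)
    {f : (ι → ℝ) × (κ → ℝ) → (ι ⊕ κ → ℝ) → ℝ≥0∞} (hf : Measurable (Function.uncurry f))
    {c : ℝ≥0∞} (hc : ∀ z, ∫⁻ g, f z g ∂stdGauss (ι ⊕ κ) ≤ c) :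
    ∫⁻ ω, F (z 0 ω, truncSeq t fun s => g s ω) * f (z t ω) (g t ω) ∂μ ≤
      c * ∫⁻ ω, F (z 0 ω, truncSeq t fun s => g s ω) ∂μ := by
  have hH := h.aemeasurable_hist t
  have hg := h.aemeasurable_noise t
  set H : Ω → ((ι → ℝ) × (κ → ℝ)) × (ℕ → ι ⊕ κ → ℝ) :=
    fun ω => (z 0 ω, truncSeq t fun s => g s ω) with hHdef
  set k : (((ι → ℝ) × (κ → ℝ)) × (ℕ → ι ⊕ κ → ℝ)) × (ι ⊕ κ → ℝ) → ℝ≥0∞ :=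
    fun q => F q.1 * f (traj A B Kp σw ση q.1.1 q.1.2 t) q.2 with hk
  have hkm : Measurable k :=
    (hF.comp measurable_fst).mul (hf.comp (((measurable_traj t).comp measurable_fst).prodMk
      measurable_snd))
  have h1 : ∀ ω, F (H ω) * f (z t ω) (g t ω) = k (H ω, g t ω) := by
    intro ω; rw [hk, h.eq_traj_truncSeq le_rfl ω]
  have h2 : Measure.map (fun ω => (H ω, g t ω)) μ = (Measure.map H μ).prod (stdGauss (ι ⊕ κ)) := by
    rw [(h.indep t).map_prod_eq_prod_map_map hH hg, (h.law_noise t).map_eq]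
  calc ∫⁻ ω, F (H ω) * f (z t ω) (g t ω) ∂μ = ∫⁻ ω, k (H ω, g t ω) ∂μ := by simp_rw [h1]
    _ = ∫⁻ q, k q ∂(Measure.map H μ).prod (stdGauss (ι ⊕ κ)) := by
        rw [← h2, lintegral_map' hkm.aemeasurable (hH.prodMk hg)]
    _ = ∫⁻ p, ∫⁻ y, k (p, y) ∂stdGauss (ι ⊕ κ) ∂Measure.map H μ :=
        lintegral_prod _ hkm.aemeasurable
    _ ≤ ∫⁻ p, c * F p ∂Measure.map H μ := by
        refine lintegral_mono fun p => ?_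
        simp only [hk]
        rw [lintegral_const_mul _ hf.of_uncurry_left, mul_comm]
        exact mul_le_mul_left (hc _) _
    _ = c * ∫⁻ ω, F (H ω) ∂μ := by
        rw [lintegral_const_mul _ hF, lintegral_map' hF.aemeasurable hH]

/-- Bounds given the past multiply over the steps. The small-ball estimate and the exponential
supermartingale are both instances. -/
lemma lintegral_prod_le (h : IsDriven μ A B Kp σw ση m₀ z g) (t₀ : ℕ)
    {f : (ι → ℝ) × (κ → ℝ) → (ι ⊕ κ → ℝ) → ℝ≥0∞} (hf : Measurable (Function.uncurry f))
    {c : ℝ≥0∞} (hc : ∀ z, ∫⁻ g, f z g ∂stdGauss (ι ⊕ κ) ≤ c) (n : ℕ) :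
    ∫⁻ ω, ∏ k ∈ Finset.range n, f (z (t₀ + k) ω) (g (t₀ + k) ω) ∂μ ≤ c ^ n := by
  induction n with
  | zero => simp
  | succ n ih =>
    set F : ((ι → ℝ) × (κ → ℝ)) × (ℕ → ι ⊕ κ → ℝ) → ℝ≥0∞ := fun p =>
      ∏ k ∈ Finset.range n, f (traj A B Kp σw ση p.1 p.2 (t₀ + k)) (p.2 (t₀ + k)) with hF
    have hFm : Measurable F := Finset.measurable_prod _ fun k _ =>
      hf.comp ((measurable_traj _).prodMk ((measurable_pi_apply _).comp measurable_snd))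
    have h1 : ∀ ω, F (z 0 ω, truncSeq (t₀ + n) fun s => g s ω) =
        ∏ k ∈ Finset.range n, f (z (t₀ + k) ω) (g (t₀ + k) ω) := by
      intro ω
      refine Finset.prod_congr rfl fun k hk => ?_
      have hk' : t₀ + k < t₀ + n := by have := Finset.mem_range.1 hk; omega
      rw [h.eq_traj_truncSeq hk'.le ω]
      simp [truncSeq, Finset.mem_range.1 hk]
    have h2 := h.lintegral_hist_mul_le (t₀ + n) hFm hf hc
    simp_rw [h1] at h2
    simp_rw [Finset.prod_range_succ]
    refine h2.trans ?_
    rw [pow_succ']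
    exact mul_le_mul_right ih _

lemma lintegral_le (h : IsDriven μ A B Kp σw ση m₀ z g) (t : ℕ)
    {f : (ι → ℝ) × (κ → ℝ) → (ι ⊕ κ → ℝ) → ℝ≥0∞} (hf : Measurable (Function.uncurry f))
    {c : ℝ≥0∞} (hc : ∀ z, ∫⁻ g, f z g ∂stdGauss (ι ⊕ κ) ≤ c) :
    ∫⁻ ω, f (z t ω) (g t ω) ∂μ ≤ c := by
  simpa using h.lintegral_prod_le t hf hc 1

end IsDriven

lemma lintegral_exp_dotProduct_stdGauss {n : Type*} [Fintype n] (b : n → ℝ) :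
    ∫⁻ y, ENNReal.ofReal (Real.exp (b ⬝ᵥ y)) ∂stdGauss n =
      ENNReal.ofReal (Real.exp (euclNorm b ^ 2 / 2)) := by
  have h1 : ∀ y : n → ℝ, Real.exp (b ⬝ᵥ y) = ∏ i, Real.exp (b i * y i) := fun y => by
    rw [dotProduct, Real.exp_sum]
  have hi : Integrable (fun y : n → ℝ => ∏ i, Real.exp (b i * y i)) (stdGauss n) :=
    Integrable.fintype_prod (f := fun i (y : ℝ) => Real.exp (b i * y))
      fun i => integrable_exp_mul_gaussianReal (b i)
  simp_rw [h1]
  rw [← ofReal_integral_eq_lintegral_ofReal hi (ae_of_all _ fun y => by positivity), stdGauss,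
    integral_fintype_prod_eq_prod (fun i (y : ℝ) => Real.exp (b i * y))]
  have h2 : ∀ i, ∫ y, Real.exp (b i * y) ∂gaussianReal 0 1 = Real.exp (b i ^ 2 / 2) := by
    intro i
    have := congrFun (mgf_id_gaussianReal (μ := 0) (v := 1)) (b i)
    simpa [mgf] using this
  simp_rw [h2]
  rw [← Real.exp_sum, ← Finset.sum_div, euclNorm_sq]

namespace IsDriven

/-- Integrating out the last noise replaces `v` by `Lᵀ v`, hence the induction for all `v`
simultaneously. The mean at time `t` does not contain `w(t)`; the last term removes it from the sum,
which is kept in the form of a partial sum of the Lyapunov series. -/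
lemma lintegral_exp_mean_le (h : IsDriven μ A B Kp σw ση m₀ z g) (t : ℕ) (v : ι → ℝ) :
    ∫⁻ ω, ENNReal.ofReal (Real.exp (v ⬝ᵥ (A *ᵥ (z t ω).1 + B *ᵥ (z t ω).2))) ∂μ ≤
      ENNReal.ofReal (Real.exp (1 / 2 + m₀ * euclNorm ((A + B * Kp)ᵀ ^ (t + 1) *ᵥ v) ^ 2 / 2 +
        (∑ k ∈ Finset.range (t + 1), (σw ^ 2 * euclNorm ((A + B * Kp)ᵀ ^ k *ᵥ v) ^ 2 +
          ση ^ 2 * euclNorm (Bᵀ *ᵥ ((A + B * Kp)ᵀ ^ k *ᵥ v)) ^ 2)) / 2 -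
        σw ^ 2 * euclNorm v ^ 2 / 2)) := by
  induction t generalizing v with
  | zero =>
    refine (h.init_mgf v).trans (le_of_eq ?_)
    congr 2
    simp
    ring
  | succ t ih =>
    set L := A + B * Kp with hL
    set F : ((ι → ℝ) × (κ → ℝ)) × (ℕ → ι ⊕ κ → ℝ) → ℝ≥0∞ := fun p => ENNReal.ofReal (Real.exp
      ((Lᵀ *ᵥ v) ⬝ᵥ (A *ᵥ (traj A B Kp σw ση p.1 p.2 t).1 + B *ᵥ (traj A B Kp σw ση p.1 p.2 t).2)))
      with hF
    set b : ι ⊕ κ → ℝ := Sum.elim (σw • (Lᵀ *ᵥ v)) (ση • (Bᵀ *ᵥ v)) with hb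
    set f : (ι → ℝ) × (κ → ℝ) → (ι ⊕ κ → ℝ) → ℝ≥0∞ := fun _ y =>
      ENNReal.ofReal (Real.exp (b ⬝ᵥ y)) with hf
    have hFm : Measurable F := by
      have hm : Measurable fun q : (ι → ℝ) × (κ → ℝ) =>
          (Lᵀ *ᵥ v) ⬝ᵥ (A *ᵥ q.1 + B *ᵥ q.2) := by
        simp only [mulVec, dotProduct, Pi.add_apply]
        fun_prop
      exact (hm.comp (measurable_traj t)).exp.ennreal_ofReal
    have hfm : Measurable (Function.uncurry f) := by
      simp only [hf, Function.uncurry_def, dotProduct]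
      fun_prop
    have h1 := h.lintegral_hist_mul_le t hFm hfm
      (c := ENNReal.ofReal (Real.exp (euclNorm b ^ 2 / 2)))
      fun _ => (lintegral_exp_dotProduct_stdGauss b).le
    have h2 : ∀ ω, F (z 0 ω, truncSeq t fun s => g s ω) = ENNReal.ofReal (Real.exp
        ((Lᵀ *ᵥ v) ⬝ᵥ (A *ᵥ (z t ω).1 + B *ᵥ (z t ω).2))) := by
      intro ω; simp only [hF, ← h.eq_traj_truncSeq le_rfl ω]
    have h3 : ∀ ω, ENNReal.ofReal (Real.exp (v ⬝ᵥ (A *ᵥ (z (t + 1) ω).1 + B *ᵥ (z (t + 1) ω).2))) =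
        F (z 0 ω, truncSeq t fun s => g s ω) * f (z t ω) (g t ω) := by
      intro ω
      rw [h2, hf, ← ENNReal.ofReal_mul (Real.exp_pos _).le, ← Real.exp_add, h.step]
      congr 2
      simp only [stepFun]
      set m := A *ᵥ (z t ω).1 + B *ᵥ (z t ω).2
      have h4 : A *ᵥ (m + σw • (g t ω ∘ Sum.inl)) + B *ᵥ (Kp *ᵥ (m + σw • (g t ω ∘ Sum.inl)) +
          ση • (g t ω ∘ Sum.inr)) =
          L *ᵥ m + (σw • (L *ᵥ (g t ω ∘ Sum.inl)) + ση • (B *ᵥ (g t ω ∘ Sum.inr))) := by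
        rw [mulVec_add B, mulVec_mulVec, ← add_assoc, ← add_mulVec, ← hL, mulVec_add, mulVec_smul,
          mulVec_smul, add_assoc]
      have h5 : b ⬝ᵥ g t ω = (σw • (Lᵀ *ᵥ v)) ⬝ᵥ (g t ω ∘ Sum.inl) +
          (ση • (Bᵀ *ᵥ v)) ⬝ᵥ (g t ω ∘ Sum.inr) := by
        simp [hb, dotProduct, Fintype.sum_sum_type]
      rw [h4, h5, dotProduct_add, dotProduct_add, dotProduct_smul, dotProduct_smul,
        smul_dotProduct, smul_dotProduct, dotProduct_mulVec v L, dotProduct_mulVec v L,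
        dotProduct_mulVec v B, mulVec_transpose, mulVec_transpose]
    have hbn : euclNorm b ^ 2 = σw ^ 2 * euclNorm (Lᵀ *ᵥ v) ^ 2 + ση ^ 2 * euclNorm (Bᵀ *ᵥ v) ^ 2 := by
      rw [hb, euclNorm_sumElim_sq, euclNorm_smul, euclNorm_smul, mul_pow, mul_pow, sq_abs, sq_abs]
    simp_rw [h3]
    refine h1.trans ?_
    simp_rw [h2]
    refine (mul_le_mul_right (ih (Lᵀ *ᵥ v)) _).trans (le_of_eq ?_)
    rw [← ENNReal.ofReal_mul (Real.exp_pos _).le, ← Real.exp_add, hbn]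
    congr 2
    have h6 : ∀ k, Lᵀ ^ k *ᵥ (Lᵀ *ᵥ v) = Lᵀ ^ (k + 1) *ᵥ v := fun k => by
      rw [mulVec_mulVec, ← pow_succ]
    simp only [h6]
    rw [Finset.sum_range_succ' _ (t + 1)]
    simp only [pow_zero, one_mulVec]
    ring

lemma sum_noise_le_lyap {τ ρ : ℝ} {L : Matrix ι ι ℝ} (hst : IsTauRhoStable τ ρ L)
    (B : Matrix ι κ ℝ) (σw ση : ℝ) (v : ι → ℝ) (t : ℕ) :
    ∑ k ∈ Finset.range t, (σw ^ 2 * euclNorm (Lᵀ ^ k *ᵥ v) ^ 2 +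
          ση ^ 2 * euclNorm (Bᵀ *ᵥ (Lᵀ ^ k *ᵥ v)) ^ 2) ≤
      specNorm (lyap L (σw ^ 2 • 1 + ση ^ 2 • (B * Bᵀ))) * euclNorm v ^ 2 := by
  have h1 : ∀ y : ι → ℝ, y ⬝ᵥ (σw ^ 2 • (1 : Matrix ι ι ℝ) + ση ^ 2 • (B * Bᵀ)) *ᵥ y =
      σw ^ 2 * euclNorm y ^ 2 + ση ^ 2 * euclNorm (Bᵀ *ᵥ y) ^ 2 := by
    intro y
    rw [add_mulVec, smul_mulVec, smul_mulVec, one_mulVec, dotProduct_add, dotProduct_smul,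
      dotProduct_smul, ← euclNorm_sq_eq_dotProduct, ← mulVec_mulVec, dotProduct_mulVec,
      ← mulVec_transpose, ← euclNorm_sq_eq_dotProduct, smul_eq_mul, smul_eq_mul]
  have h2 := sum_dotProduct_le_lyap hst (Y := σw ^ 2 • (1 : Matrix ι ι ℝ) + ση ^ 2 • (B * Bᵀ))
    (fun y => by rw [h1]; positivity) v t
  simp_rw [h1] at h2
  exact h2.trans (dotProduct_mulVec_le _ _)

lemma measure_lt_le_of_lintegral_exp_le {X : Ω → ℝ} (hX : AEMeasurable X μ) {c : ℝ}
    (h : ∫⁻ ω, ENNReal.ofReal (Real.exp (X ω)) ∂μ ≤ ENNReal.ofReal (Real.exp c)) (r : ℝ) :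
    μ {ω | r ≤ X ω} ≤ ENNReal.ofReal (Real.exp (c - r)) := by
  have h1 := meas_ge_le_lintegral_div (μ := μ) (f := fun ω => ENNReal.ofReal (Real.exp (X ω)))
    hX.exp.ennreal_ofReal (ε := ENNReal.ofReal (Real.exp r))
    (by simpa using Real.exp_pos r) ENNReal.ofReal_ne_top
  have h2 : {ω | r ≤ X ω} ⊆
      {ω | ENNReal.ofReal (Real.exp r) ≤ ENNReal.ofReal (Real.exp (X ω))} := fun ω hω =>
    ENNReal.ofReal_le_ofReal (Real.exp_le_exp.2 hω)
  refine (measure_mono h2).trans (h1.trans ?_)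
  rw [Real.exp_sub, ENNReal.ofReal_div_of_pos (Real.exp_pos _)]
  exact ENNReal.div_le_div_right h _

/-- Exponential tail of the linear functionals of `A x(t) + B u(t)`. -/
lemma measure_abs_mean_gt_le (h : IsDriven μ A B Kp σw ση m₀ z g) {τ ρ : ℝ}
    (hst : IsTauRhoStable τ ρ (A + B * Kp)) (t : ℕ) (v : ι → ℝ) {s : ℝ} (hs : 0 < s)
    (hsv : m₀ * euclNorm ((A + B * Kp)ᵀ ^ (t + 1) *ᵥ v) ^ 2 +
      specNorm (lyap (A + B * Kp) (σw ^ 2 • 1 + ση ^ 2 • (B * Bᵀ))) * euclNorm v ^ 2 ≤ s ^ 2)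
    (r : ℝ) :
    μ {ω | r * s < |v ⬝ᵥ (A *ᵥ (z t ω).1 + B *ᵥ (z t ω).2)|} ≤
      ENNReal.ofReal (2 * Real.exp (1 - r)) := by
  have key : ∀ v' : ι → ℝ, m₀ * euclNorm ((A + B * Kp)ᵀ ^ (t + 1) *ᵥ v') ^ 2 +
      specNorm (lyap (A + B * Kp) (σw ^ 2 • 1 + ση ^ 2 • (B * Bᵀ))) * euclNorm v' ^ 2 ≤ s ^ 2 →
      μ {ω | r * s < v' ⬝ᵥ (A *ᵥ (z t ω).1 + B *ᵥ (z t ω).2)} ≤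
        ENNReal.ofReal (Real.exp (1 - r)) := by
    intro v' hv'
    -- Rescaling by `s` makes the exponent at most `1/2 + 1/2`. The resulting exponential tail is
    -- weaker than a Gaussian one, which costs only logarithmic factors.
    set y := s⁻¹ • v' with hy
    have hm : AEMeasurable (fun ω => y ⬝ᵥ (A *ᵥ (z t ω).1 + B *ᵥ (z t ω).2)) μ := by
      have hm : Measurable fun q : (ι → ℝ) × (κ → ℝ) => y ⬝ᵥ (A *ᵥ q.1 + B *ᵥ q.2) := by
        simp only [mulVec, dotProduct, Pi.add_apply]
        fun_prop
      exact hm.comp_aemeasurable (h.aemeasurable_state t)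
    have hn : ∀ X : Matrix ι ι ℝ, euclNorm (X *ᵥ y) ^ 2 = euclNorm (X *ᵥ v') ^ 2 / s ^ 2 := by
      intro X
      rw [hy, mulVec_smul, euclNorm_smul, mul_pow, sq_abs]
      field_simp
    have hn1 : euclNorm y ^ 2 = euclNorm v' ^ 2 / s ^ 2 := by
      have := hn 1; rwa [one_mulVec, one_mulVec] at this
    have h1 : ∫⁻ ω, ENNReal.ofReal (Real.exp (y ⬝ᵥ (A *ᵥ (z t ω).1 + B *ᵥ (z t ω).2))) ∂μ ≤
        ENNReal.ofReal (Real.exp 1) := by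
      refine (h.lintegral_exp_mean_le t y).trans (ENNReal.ofReal_le_ofReal (Real.exp_le_exp.2 ?_))
      have h2 := sum_noise_le_lyap hst B σw ση y (t + 1)
      have h3 : 0 ≤ σw ^ 2 * euclNorm y ^ 2 := by positivity
      have h4 : m₀ * euclNorm ((A + B * Kp)ᵀ ^ (t + 1) *ᵥ y) ^ 2 +
          specNorm (lyap (A + B * Kp) (σw ^ 2 • 1 + ση ^ 2 • (B * Bᵀ))) * euclNorm y ^ 2 ≤ 1 := by
        rw [hn, hn1, ← mul_div_assoc, ← mul_div_assoc, ← add_div]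
        exact (div_le_one (by positivity)).2 hv'
      linarith
    refine le_trans (measure_mono fun ω hω => ?_) (measure_lt_le_of_lintegral_exp_le hm h1 r)
    simp only [Set.mem_ofPred_eq, hy, smul_dotProduct, smul_eq_mul] at hω ⊢
    rw [← div_eq_inv_mul, le_div_iff₀ hs]
    exact hω.le
  have h1 := key v hsv
  have h2 := key (-v) (by
    have := euclNorm_smul (-1) v
    rw [abs_neg, abs_one, one_mul, neg_one_smul] at this
    have h3 := euclNorm_smul (-1) ((A + B * Kp)ᵀ ^ (t + 1) *ᵥ v)
    rw [abs_neg, abs_one, one_mul, neg_one_smul] at h3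
    rwa [mulVec_neg, this, h3])
  refine (measure_mono (t := {ω | r * s < v ⬝ᵥ (A *ᵥ (z t ω).1 + B *ᵥ (z t ω).2)} ∪
    {ω | r * s < (-v) ⬝ᵥ (A *ᵥ (z t ω).1 + B *ᵥ (z t ω).2)}) fun ω hω => ?_).trans
    ((measure_union_le _ _).trans ((add_le_add h1 h2).trans (le_of_eq ?_)))
  · simp only [Set.mem_ofPred_eq, Set.mem_union, neg_dotProduct] at hω ⊢
    exact lt_abs.1 hω
  · rw [← ENNReal.ofReal_add (Real.exp_pos _).le (Real.exp_pos _).le]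
    congr 1
    ring

end IsDriven

end Driven

end

end CoopLQR

namespace CoopLQR

noncomputable section

set_option linter.unusedSectionVars false

open scoped ENNReal

/-! ### Concentration of the TD noise -/

section Noise

variable {ι κ : Type*} [Fintype ι] [DecidableEq ι] [Fintype κ] [DecidableEq κ]

lemma tdNoise_add {P : Matrix ι ι ℝ} (hP : P.IsSymm) (σw : ℝ) (m y : ι → ℝ) :
    tdNoise P σw m (m + σw • y) =
      σw ^ 2 * (y ⬝ᵥ P *ᵥ y) + 2 * σw * ((P *ᵥ m) ⬝ᵥ y) - σw ^ 2 * P.trace := by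
  have h1 : m ⬝ᵥ P *ᵥ y = (P *ᵥ m) ⬝ᵥ y := by
    rw [dotProduct_mulVec, ← mulVec_transpose, hP.eq]
  have h2 : y ⬝ᵥ P *ᵥ m = (P *ᵥ m) ⬝ᵥ y := dotProduct_comm _ _
  simp only [tdNoise, mulVec_add, mulVec_smul, dotProduct_add, add_dotProduct, smul_dotProduct,
    dotProduct_smul, smul_eq_mul, h1, h2]
  ring

/-- `θ` times the noise is `gᵀMg + b·g - tr M` with `M` supported on the state noise. The trace
cancels the first-order term of the Gaussian moment; what remains is `2(θs)²` from the quadratic and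
`4(θs)²` from the linear part. -/
lemma integrable_exp_tdNoise {P : Matrix ι ι ℝ} (hP : P.IsSymm) {σw : ℝ} {m : ι → ℝ}
    {s θ : ℝ} (hσw : 0 ≤ σw) (hPs : σw ^ 2 * frobNorm P ≤ s) (hms : σw * euclNorm (P *ᵥ m) ≤ s)
    (hθ : |θ| * s ≤ 1 / 4) :
    Integrable (fun g : ι ⊕ κ → ℝ => Real.exp (θ * tdNoise P σw m (m + σw • (g ∘ Sum.inl))))
      (stdGauss (ι ⊕ κ)) ∧
    ∫ g : ι ⊕ κ → ℝ, Real.exp (θ * tdNoise P σw m (m + σw • (g ∘ Sum.inl))) ∂stdGauss (ι ⊕ κ) ≤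
      Real.exp (6 * (θ * s) ^ 2) := by
  set M : Matrix (ι ⊕ κ) (ι ⊕ κ) ℝ := fromBlocks ((θ * σw ^ 2) • P) 0 0 0 with hM
  set b : ι ⊕ κ → ℝ := Sum.elim ((2 * θ * σw) • (P *ᵥ m)) 0 with hb
  have hMs : M.IsSymm := Matrix.IsSymm.fromBlocks (hP.smul _) (by simp) (by simp [Matrix.IsSymm])
  have hMf : ∑ i, ∑ j, M i j ^ 2 = (θ * σw ^ 2) ^ 2 * frobNorm P ^ 2 := by
    simp [hM, Fintype.sum_sum_type, frobNorm_sq, mul_pow, Finset.mul_sum]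
  have hMt : M.trace = θ * σw ^ 2 * P.trace := by
    simp [hM, Matrix.trace, Fintype.sum_sum_type, Finset.mul_sum]
  have hbn : ∑ i, b i ^ 2 = 4 * θ ^ 2 * (σw * euclNorm (P *ᵥ m)) ^ 2 := by
    simp only [hb, Fintype.sum_sum_type, Sum.elim_inl, Sum.elim_inr, Pi.smul_apply, smul_eq_mul,
      Pi.zero_apply]
    rw [mul_pow σw, euclNorm_sq, Finset.mul_sum, Finset.mul_sum]
    simp
    exact Finset.sum_congr rfl fun i _ => by ring
  have hexp : ∀ g : ι ⊕ κ → ℝ, Real.exp (θ * tdNoise P σw m (m + σw • (g ∘ Sum.inl))) =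
      Real.exp (-M.trace) * Real.exp (g ⬝ᵥ M *ᵥ g + b ⬝ᵥ g) := by
    intro g
    rw [← Real.exp_add, tdNoise_add hP, hMt]
    have h1 : g ⬝ᵥ M *ᵥ g = θ * σw ^ 2 * ((g ∘ Sum.inl) ⬝ᵥ P *ᵥ (g ∘ Sum.inl)) := by
      have : g = Sum.elim (g ∘ Sum.inl) (g ∘ Sum.inr) := by ext i; cases i <;> rfl
      rw [this, hM, fromBlocks_mulVec]
      simp [dotProduct, Fintype.sum_sum_type, smul_mulVec, Finset.mul_sum]
      exact Finset.sum_congr rfl fun i _ => by ring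
    have h2 : b ⬝ᵥ g = 2 * θ * σw * ((P *ᵥ m) ⬝ᵥ (g ∘ Sum.inl)) := by
      simp [hb, dotProduct, Fintype.sum_sum_type, Finset.mul_sum]
      exact Finset.sum_congr rfl fun i _ => by ring
    rw [h1, h2]
    congr 1
    ring
  have hs0 : 0 ≤ s := (mul_nonneg hσw (euclNorm_nonneg _)).trans hms
  have hθs : (θ * s) ^ 2 ≤ (1 / 4) ^ 2 := by
    rw [← sq_abs (θ * s), abs_mul, abs_of_nonneg hs0]
    exact pow_le_pow_left₀ (by positivity) hθ 2
  have hPs2 : (σw ^ 2 * frobNorm P) ^ 2 ≤ s ^ 2 :=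
    pow_le_pow_left₀ (mul_nonneg (sq_nonneg _) (frobNorm_nonneg _)) hPs 2
  have hms2 : (σw * euclNorm (P *ᵥ m)) ^ 2 ≤ s ^ 2 :=
    pow_le_pow_left₀ (mul_nonneg hσw (euclNorm_nonneg _)) hms 2
  have h3 : (θ * σw ^ 2) ^ 2 * frobNorm P ^ 2 ≤ (θ * s) ^ 2 := by
    have := mul_le_mul_of_nonneg_left hPs2 (sq_nonneg θ)
    nlinarith
  have h4 : 4 * θ ^ 2 * (σw * euclNorm (P *ᵥ m)) ^ 2 ≤ 4 * (θ * s) ^ 2 := by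
    have := mul_le_mul_of_nonneg_left hms2 (sq_nonneg θ)
    nlinarith
  have h5 := integrable_exp_quadratic_stdGauss hMs (by rw [hMf]; exact h3.trans hθs) b
  simp_rw [hexp]
  refine ⟨h5.1.const_mul _, ?_⟩
  rw [integral_const_mul]
  refine (mul_le_mul_of_nonneg_left h5.2 (Real.exp_pos _).le).trans ?_
  rw [← Real.exp_add, Real.exp_le_exp, hMf, hbn]
  linarith

/-- A random variable with Gaussian-type exponential moments near `0` is centred. -/
lemma integral_nonpos_of_integral_exp_le {G : Type*} [MeasurableSpace G] {γ : Measure G}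
    [IsProbabilityMeasure γ] {Y : G → ℝ} (hY : Integrable Y γ) {s : ℝ} (hs : 0 < s)
    (hi : ∀ θ, 0 < θ → θ * s ≤ 1 / 4 → Integrable (fun g => Real.exp (θ * Y g)) γ)
    (h : ∀ θ, 0 < θ → θ * s ≤ 1 / 4 → ∫ g, Real.exp (θ * Y g) ∂γ ≤ Real.exp (6 * (θ * s) ^ 2)) :
    ∫ g, Y g ∂γ ≤ 0 := by
  have h1 : ∀ θ, 0 < θ → θ * s ≤ 1 / 4 → ∫ g, Y g ∂γ ≤ θ * (12 * s ^ 2) := by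
    intro θ hθ hθs
    have h2 : ∫ g, (1 + θ * Y g) ∂γ ≤ ∫ g, Real.exp (θ * Y g) ∂γ := by
      refine integral_mono ((integrable_const _).add (hY.const_mul _)) (hi θ hθ hθs) fun g => ?_
      have := Real.add_one_le_exp (θ * Y g)
      simp only
      linarith
    rw [integral_add (integrable_const _) (hY.const_mul _), integral_const_mul] at h2
    simp only [integral_const, probReal_univ, smul_eq_mul, mul_one] at h2
    have h3 := h2.trans (h θ hθ hθs)
    have h4 : 0 ≤ θ * s := by positivity
    have h5 : Real.exp (6 * (θ * s) ^ 2) ≤ 1 + 2 * (6 * (θ * s) ^ 2) := by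
      have h6 : 6 * (θ * s) ^ 2 ≤ 3 / 8 := by nlinarith
      have h7 := Real.one_sub_inv_le_log_of_pos (x := 1 + 2 * (6 * (θ * s) ^ 2)) (by positivity)
      rw [← Real.le_log_iff_exp_le (by positivity)]
      refine le_trans ?_ h7
      rw [le_sub_iff_add_le, ← le_sub_iff_add_le', inv_le_comm₀ (by positivity) (by linarith),
        inv_le_iff_one_le_mul₀ (by linarith)]
      nlinarith [sq_nonneg (θ * s)]
    have h6 : θ * ∫ g, Y g ∂γ ≤ θ * (θ * (12 * s ^ 2)) := by nlinarith
    exact le_of_mul_le_mul_left h6 hθ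
  by_contra hc
  push Not at hc
  set e := ∫ g, Y g ∂γ
  -- If the mean `e` were positive, `θ ≤ e / (24 s²)` would make the bound `12 θ s²` at most `e /
  -- 2`; the other entry of the minimum keeps `θ` admissible.
  have h2 := h1 (min (1 / (4 * s)) (e / (24 * s ^ 2))) (by positivity) (by
    refine (mul_le_mul_of_nonneg_right (min_le_left _ _) hs.le).trans (le_of_eq ?_)
    field_simp)
  have h3 : min (1 / (4 * s)) (e / (24 * s ^ 2)) * (12 * s ^ 2) ≤ e / 2 := by
    refine (mul_le_mul_of_nonneg_right (min_le_right _ _) (by positivity)).trans (le_of_eq ?_)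
    field_simp
    norm_num
  linarith

/-- As `Y` has mean zero, the bias of truncation is, up to sign, the mean of the discarded tail. For
`θ = 1/(4s)` the level `4sℓ` satisfies `θ · 4sℓ = ℓ`; beyond it `|Y| / (4sℓ)` is at most `(2/ℓ)
exp(-ℓ/2) exp(θ|Y|)`, and the exponential moments at `±θ` are at most `exp(3/8) ≤ 2` each. -/
lemma abs_integral_indicator_le {G : Type*} [MeasurableSpace G] {γ : Measure G}
    [IsProbabilityMeasure γ] {Y : G → ℝ} (hYm : Measurable Y) {s ℓ : ℝ} (hs : 0 < s) (hℓ : 1 ≤ ℓ)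
    (hi : ∀ θ, |θ| * s ≤ 1 / 4 → Integrable (fun g => Real.exp (θ * Y g)) γ)
    (h : ∀ θ, |θ| * s ≤ 1 / 4 → ∫ g, Real.exp (θ * Y g) ∂γ ≤ Real.exp (6 * (θ * s) ^ 2)) :
    |∫ g, (if |Y g| ≤ 4 * s * ℓ then Y g / (4 * s * ℓ) else 0) ∂γ| ≤ 8 * Real.exp (-ℓ / 2) := by
  set θ : ℝ := 1 / (4 * s) with hθ
  have hθ0 : 0 < θ := by positivity
  have hθs : |θ| * s ≤ 1 / 4 := by
    rw [abs_of_pos hθ0, hθ]; apply le_of_eq; field_simp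
  have hθs' : |-θ| * s ≤ 1 / 4 := by rwa [abs_neg]
  have hi1 := hi θ hθs
  have hi2 := hi (-θ) hθs'
  have hexp38 : ∀ θ' : ℝ, (θ' * s) ^ 2 = (1 / 4) ^ 2 → Real.exp (6 * (θ' * s) ^ 2) ≤ 2 := by
    intro θ' h'
    rw [h']
    have := Real.exp_one_lt_d9
    have h2 : Real.exp (6 * (1 / 4) ^ 2) ^ 8 ≤ 2 ^ 8 := by
      rw [← Real.exp_nat_mul]
      norm_num
      have h3 : Real.exp 3 = Real.exp 1 ^ 3 := by rw [← Real.exp_nat_mul]; norm_num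
      rw [h3]
      calc Real.exp 1 ^ 3 ≤ 3 ^ 3 := pow_le_pow_left₀ (Real.exp_pos _).le (by linarith) 3
        _ ≤ 256 := by norm_num
    exact le_of_pow_le_pow_left₀ (by norm_num) (by norm_num) h2
  have hθs2 : (θ * s) ^ 2 = (1 / 4) ^ 2 := by rw [hθ]; congr 1; field_simp
  have hb1 := (h θ hθs).trans (hexp38 θ hθs2)
  have hb2 := (h (-θ) hθs').trans (hexp38 (-θ) (by rw [neg_mul, neg_sq, hθs2]))
  have habs : ∀ y : ℝ, Real.exp (θ * |y|) ≤ Real.exp (θ * y) + Real.exp (-θ * y) := by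
    intro y
    rcases abs_cases y with ⟨h1, -⟩ | ⟨h1, -⟩ <;> rw [h1]
    · linarith [Real.exp_pos (-θ * y)]
    · rw [mul_neg, ← neg_mul]; linarith [Real.exp_pos (θ * y)]
  have hYi : Integrable Y γ := by
    refine ((hi1.add hi2).const_mul (1 / θ)).mono' hYm.aestronglyMeasurable (ae_of_all _ fun g => ?_)
    simp only [Pi.add_apply]
    have h1 := Real.add_one_le_exp (θ * |Y g|)
    have h2 := habs (Y g)
    rw [Real.norm_eq_abs, ← mul_le_mul_iff_right₀ hθ0, ← mul_assoc, mul_one_div_cancel hθ0.ne',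
      one_mul]
    linarith
  have hmean : ∫ g, Y g ∂γ = 0 := by
    refine le_antisymm (integral_nonpos_of_integral_exp_le hYi hs
      (fun θ h0 h1 => hi θ (by rwa [abs_of_pos h0]))
      (fun θ h0 h1 => h θ (by rwa [abs_of_pos h0]))) ?_
    have := integral_nonpos_of_integral_exp_le hYi.neg hs
      (fun θ h0 h1 => by
        have := hi (-θ) (by rwa [abs_neg, abs_of_pos h0])
        simpa using this)
      (fun θ h0 h1 => by
        have := h (-θ) (by rwa [abs_neg, abs_of_pos h0])
        simpa using this)
    simp only [Pi.neg_apply, integral_neg] at this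
    linarith
  set b := 4 * s * ℓ with hb
  have hb0 : 0 < b := by positivity
  have hθb : θ * b = ℓ := by rw [hθ, hb]; field_simp
  have hsplit : ∫ g, (if |Y g| ≤ b then Y g / b else 0) ∂γ =
      - ∫ g, (if |Y g| ≤ b then 0 else Y g / b) ∂γ := by
    have hms : MeasurableSet {g | |Y g| ≤ b} := measurableSet_le hYm.abs measurable_const
    have h1 : Integrable (fun g => if |Y g| ≤ b then Y g / b else 0) γ := by
      refine (hYi.div_const b).mono (Measurable.ite hms (by fun_prop)
        measurable_const).aestronglyMeasurable (ae_of_all _ fun g => ?_)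
      split_ifs <;> simp; positivity
    have h2 : Integrable (fun g => if |Y g| ≤ b then 0 else Y g / b) γ := by
      refine (hYi.div_const b).mono (Measurable.ite hms measurable_const
        (by fun_prop)).aestronglyMeasurable (ae_of_all _ fun g => ?_)
      split_ifs <;> simp; positivity
    rw [eq_neg_iff_add_eq_zero, ← integral_add h1 h2]
    have : ∀ g, (if |Y g| ≤ b then Y g / b else 0) + (if |Y g| ≤ b then 0 else Y g / b) =
        Y g / b := by intro g; split_ifs <;> simp
    simp_rw [this]
    rw [integral_div, hmean, zero_div]
  rw [hsplit, abs_neg]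
  have hdom : ∀ g, ‖(if |Y g| ≤ b then 0 else Y g / b)‖ ≤
      2 / ℓ * Real.exp (-ℓ / 2) * (Real.exp (θ * Y g) + Real.exp (-θ * Y g)) := by
    intro g
    have hℓ0 : 0 < ℓ := by linarith
    split_ifs with hg
    · simp; positivity
    · push Not at hg
      rw [norm_div, Real.norm_eq_abs, Real.norm_of_nonneg hb0.le]
      refine le_trans ?_ (mul_le_mul_of_nonneg_left (habs (Y g)) (by positivity))
      have h1 := Real.add_one_le_exp (θ * |Y g| / 2)
      have h2 : (1 : ℝ) ≤ Real.exp ((θ * |Y g| - ℓ) / 2) := by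
        refine Real.one_le_exp ?_
        have := mul_lt_mul_of_pos_left hg hθ0
        rw [hθb] at this
        linarith
      have h3 : Real.exp (-ℓ / 2) * Real.exp (θ * |Y g|) =
          Real.exp (θ * |Y g| / 2) * Real.exp ((θ * |Y g| - ℓ) / 2) := by
        rw [← Real.exp_add, ← Real.exp_add]; congr 1; ring
      rw [mul_assoc, h3, div_le_iff₀ hb0]
      have h4 : θ * |Y g| / 2 ≤ Real.exp (θ * |Y g| / 2) * Real.exp ((θ * |Y g| - ℓ) / 2) :=
        le_trans (by linarith) (le_mul_of_one_le_right (Real.exp_pos _).le h2)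
      have h5 : 2 / ℓ * b = 2 / θ := by rw [← hθb]; field_simp
      calc |Y g| = 2 / θ * (θ * |Y g| / 2) := by field_simp
        _ ≤ 2 / θ * (Real.exp (θ * |Y g| / 2) * Real.exp ((θ * |Y g| - ℓ) / 2)) :=
            mul_le_mul_of_nonneg_left h4 (by positivity)
        _ = _ := by rw [← h5]; ring
  refine (norm_integral_le_of_norm_le ((hi1.add hi2).const_mul _) (ae_of_all _ hdom)).trans ?_
  simp only [Pi.add_apply]
  rw [integral_const_mul, integral_add hi1 hi2]
  have h6 : 2 / ℓ * Real.exp (-ℓ / 2) ≤ 2 * Real.exp (-ℓ / 2) := by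
    refine mul_le_mul_of_nonneg_right ?_ (Real.exp_pos _).le
    exact div_le_self (by norm_num) hℓ
  have h7 : 0 ≤ ∫ g, Real.exp (θ * Y g) ∂γ := integral_nonneg fun _ => (Real.exp_pos _).le
  have h8 : 0 ≤ ∫ g, Real.exp (-θ * Y g) ∂γ := integral_nonneg fun _ => (Real.exp_pos _).le
  nlinarith [Real.exp_pos (-ℓ / 2)]

lemma measurable_euclNorm {n : Type*} [Fintype n] : Measurable (euclNorm : (n → ℝ) → ℝ) := by
  have : (euclNorm : (n → ℝ) → ℝ) = fun v => Real.sqrt (∑ i, v i ^ 2) := by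
    ext v; exact euclNorm_eq_sqrt v
  rw [this]
  fun_prop

/-- The conditional mean `A x + B u` of the next state. -/
def meanFun (A : Matrix ι ι ℝ) (B : Matrix ι κ ℝ) (z : (ι → ℝ) × (κ → ℝ)) : ι → ℝ :=
  A *ᵥ z.1 + B *ᵥ z.2

/-- The TD noise as a function of the current state and control and of the driving noise. -/
def noiseFun (A : Matrix ι ι ℝ) (B : Matrix ι κ ℝ) (σw : ℝ) (P : Matrix ι ι ℝ)
    (z : (ι → ℝ) × (κ → ℝ)) (g : ι ⊕ κ → ℝ) : ℝ :=
  tdNoise P σw (meanFun A B z) (meanFun A B z + σw • (g ∘ Sum.inl))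

/-- The TD noise, truncated at `b` and divided by `b`. -/
def truncNoise (A : Matrix ι ι ℝ) (B : Matrix ι κ ℝ) (σw : ℝ) (P : Matrix ι ι ℝ) (s b : ℝ)
    (z : (ι → ℝ) × (κ → ℝ)) (g : ι ⊕ κ → ℝ) : ℝ :=
  if σw * euclNorm (P *ᵥ meanFun A B z) ≤ s then
    if |noiseFun A B σw P z g| ≤ b then noiseFun A B σw P z g / b else 0
  else 0

variable {A : Matrix ι ι ℝ} {B : Matrix ι κ ℝ} {Kp : Matrix κ ι ℝ} {σw ση m₀ : ℝ}

lemma measurable_noiseFun (P : Matrix ι ι ℝ) :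
    Measurable (Function.uncurry (noiseFun A B σw P : (ι → ℝ) × (κ → ℝ) → (ι ⊕ κ → ℝ) → ℝ)) := by
  simp only [Function.uncurry_def, noiseFun, meanFun, tdNoise, mulVec, dotProduct, Pi.add_apply,
    Pi.smul_apply, Function.comp, smul_eq_mul]
  fun_prop

lemma measurable_meanBound (P : Matrix ι ι ℝ) :
    Measurable fun z : (ι → ℝ) × (κ → ℝ) => σw * euclNorm (P *ᵥ meanFun A B z) := by
  refine Measurable.const_mul (measurable_euclNorm.comp ?_) _
  refine measurable_pi_lambda _ fun i => ?_
  simp only [meanFun, mulVec, dotProduct, Pi.add_apply]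
  fun_prop

lemma measurable_truncNoise (P : Matrix ι ι ℝ) (s b : ℝ) :
    Measurable (Function.uncurry
      (truncNoise A B σw P s b : (ι → ℝ) × (κ → ℝ) → (ι ⊕ κ → ℝ) → ℝ)) := by
  have h := measurable_noiseFun (A := A) (B := B) (σw := σw) P
  refine Measurable.ite (measurableSet_le ((measurable_meanBound P).comp measurable_fst)
    measurable_const) (Measurable.ite (measurableSet_le h.abs measurable_const) (h.div_const b)
    measurable_const) measurable_const

lemma abs_truncNoise_le (P : Matrix ι ι ℝ) (s : ℝ) {b : ℝ} (hb : 0 < b)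
    (z : (ι → ℝ) × (κ → ℝ)) (g : ι ⊕ κ → ℝ) : |truncNoise A B σw P s b z g| ≤ 1 := by
  unfold truncNoise
  split_ifs with h1 h2
  · rw [abs_div, abs_of_pos hb]; exact (div_le_one hb).2 h2
  · simp
  · simp

lemma abs_integral_truncNoise_le {P : Matrix ι ι ℝ} (hP : P.IsSymm) (hσw : 0 ≤ σw) {s ℓ : ℝ}
    (hs : 0 < s) (hℓ : 1 ≤ ℓ) (hPs : σw ^ 2 * frobNorm P ≤ s) (z : (ι → ℝ) × (κ → ℝ)) :
    |∫ g, truncNoise A B σw P s (4 * s * ℓ) z g ∂stdGauss (ι ⊕ κ)| ≤ 8 * Real.exp (-ℓ / 2) := by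
  by_cases hz : σw * euclNorm (P *ᵥ meanFun A B z) ≤ s
  · simp only [truncNoise, hz, if_true]
    exact abs_integral_indicator_le (measurable_noiseFun P).of_uncurry_left hs hℓ
      (fun θ hθ => (integrable_exp_tdNoise hP hσw hPs hz hθ).1)
      (fun θ hθ => (integrable_exp_tdNoise hP hσw hPs hz hθ).2)
  · simp only [truncNoise, hz, if_false, integral_zero, abs_zero]
    positivity

variable {Ω : Type*} [MeasurableSpace Ω] {μ : Measure Ω} [IsProbabilityMeasure μ]
  {z : ℕ → Ω → (ι → ℝ) × (κ → ℝ)} {g : ℕ → Ω → ι ⊕ κ → ℝ}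

namespace IsDriven

/-- Chernoff's bound at `θ = ±1/(4s)`, where `6(θs)² ≤ 1`. The moment is controlled only for states
with small `P m`, so the integrand is set to zero at the others. -/
lemma measure_noise_gt_le (h : IsDriven μ A B Kp σw ση m₀ z g) {P : Matrix ι ι ℝ} (hP : P.IsSymm)
    (hσw : 0 ≤ σw) {s : ℝ} (hs : 0 < s) (hPs : σw ^ 2 * frobNorm P ≤ s) (t : ℕ) (ℓ : ℝ) :
    μ {ω | σw * euclNorm (P *ᵥ meanFun A B (z t ω)) ≤ s ∧
      4 * s * ℓ < |noiseFun A B σw P (z t ω) (g t ω)|} ≤ ENNReal.ofReal (2 * Real.exp (1 - ℓ)) := by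
  have key : ∀ θ : ℝ, |θ| * s ≤ 1 / 4 → μ {ω | σw * euclNorm (P *ᵥ meanFun A B (z t ω)) ≤ s ∧
      ℓ ≤ θ * noiseFun A B σw P (z t ω) (g t ω)} ≤ ENNReal.ofReal (Real.exp (1 - ℓ)) := by
    intro θ hθ
    set f : (ι → ℝ) × (κ → ℝ) → (ι ⊕ κ → ℝ) → ℝ≥0∞ := fun z g =>
      if σw * euclNorm (P *ᵥ meanFun A B z) ≤ s then
        ENNReal.ofReal (Real.exp (θ * noiseFun A B σw P z g)) else 0 with hf
    have hfm : Measurable (Function.uncurry f) :=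
      Measurable.ite (measurableSet_le ((measurable_meanBound P).comp measurable_fst)
        measurable_const) (((measurable_noiseFun P).const_mul θ).exp.ennreal_ofReal)
        measurable_const
    have hc : ∀ z, ∫⁻ g, f z g ∂stdGauss (ι ⊕ κ) ≤ ENNReal.ofReal (Real.exp 1) := by
      intro z
      by_cases hz : σw * euclNorm (P *ᵥ meanFun A B z) ≤ s
      · obtain ⟨h1, h2⟩ := integrable_exp_tdNoise (κ := κ) hP hσw hPs hz hθ
        simp only [hf, hz, if_true, noiseFun]
        rw [← ofReal_integral_eq_lintegral_ofReal h1 (ae_of_all _ fun _ => (Real.exp_pos _).le)]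
        refine ENNReal.ofReal_le_ofReal (h2.trans (Real.exp_le_exp.2 ?_))
        have : (θ * s) ^ 2 ≤ (1 / 4) ^ 2 := by
          rw [← sq_abs, abs_mul, abs_of_pos hs]
          exact pow_le_pow_left₀ (by positivity) hθ 2
        linarith
      · simp [hf, hz]
    have h1 := h.lintegral_le t hfm hc
    have hae : AEMeasurable (fun ω => f (z t ω) (g t ω)) μ := by
      have h2 : AEMeasurable (fun ω => (z t ω, g t ω)) μ :=
        (h.aemeasurable_state t).prodMk (h.aemeasurable_noise t)
      have h3 : (fun ω => f (z t ω) (g t ω)) = Function.uncurry f ∘ fun ω => (z t ω, g t ω) := rfl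
      rw [h3]
      exact hfm.comp_aemeasurable h2
    have h2 := meas_ge_le_lintegral_div (μ := μ) (f := fun ω => f (z t ω) (g t ω)) hae
      (ε := ENNReal.ofReal (Real.exp ℓ)) (by simpa using Real.exp_pos ℓ) ENNReal.ofReal_ne_top
    refine (measure_mono fun ω hω => ?_).trans (h2.trans ?_)
    · simp only [Set.mem_ofPred_eq, hf] at hω ⊢
      rw [if_pos hω.1]
      exact ENNReal.ofReal_le_ofReal (Real.exp_le_exp.2 hω.2)
    · rw [Real.exp_sub, ENNReal.ofReal_div_of_pos (Real.exp_pos _)]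
      exact ENNReal.div_le_div_right h1 _
  have hθ : |1 / (4 * s)| * s ≤ 1 / 4 := by
    rw [abs_of_pos (by positivity)]; apply le_of_eq; field_simp
  have h1 := key (1 / (4 * s)) hθ
  have h2 := key (-(1 / (4 * s))) (by rwa [abs_neg])
  refine (measure_mono fun ω hω => ?_).trans
    ((measure_union_le _ _).trans ((add_le_add h1 h2).trans (le_of_eq ?_)))
  · simp only [Set.mem_ofPred_eq, Set.mem_union] at hω ⊢
    obtain ⟨hω1, hω2⟩ := hω
    rcases lt_abs.1 hω2 with h3 | h3
    · refine Or.inl ⟨hω1, ?_⟩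
      rw [one_div_mul_eq_div, le_div_iff₀ (by positivity)]
      linarith
    · refine Or.inr ⟨hω1, ?_⟩
      rw [neg_mul, ← mul_neg, one_div_mul_eq_div, le_div_iff₀ (by positivity)]
      linarith
  · rw [← ENNReal.ofReal_add (Real.exp_pos _).le (Real.exp_pos _).le]
    congr 1
    ring

lemma measure_abs_coord_gt_le (h : IsDriven μ A B Kp σw ση m₀ z g) (t : ℕ) (i : ι ⊕ κ) (r : ℝ) :
    μ {ω | r < |g t ω i|} ≤ ENNReal.ofReal (2 * Real.exp (1 - r)) := by
  have key : ∀ c : ℝ, c ^ 2 = 1 → μ {ω | r ≤ c * g t ω i} ≤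
      ENNReal.ofReal (Real.exp (1 - r)) := by
    intro c hc
    have h1 := lintegral_exp_dotProduct_stdGauss (Pi.single i c : ι ⊕ κ → ℝ)
    have h2 : euclNorm (Pi.single i c : ι ⊕ κ → ℝ) ^ 2 = 1 := by
      rw [euclNorm_sq]; simp [Pi.single_apply, hc]
    rw [h2, ← (h.law_noise t).map_eq, lintegral_map' (Measurable.aemeasurable (by
      simp only [dotProduct]; fun_prop)) (h.aemeasurable_noise t)] at h1
    simp only [single_dotProduct] at h1
    refine measure_lt_le_of_lintegral_exp_le ?_ (h1.le.trans (ENNReal.ofReal_le_ofReal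
      (Real.exp_le_exp.2 (by norm_num)))) r
    exact ((measurable_pi_apply i).comp_aemeasurable (h.aemeasurable_noise t)).const_mul c
  have h1 := key 1 (by norm_num)
  have h2 := key (-1) (by norm_num)
  refine (measure_mono fun ω hω => ?_).trans
    ((measure_union_le _ _).trans ((add_le_add h1 h2).trans (le_of_eq ?_)))
  · simp only [Set.mem_ofPred_eq, Set.mem_union] at hω ⊢
    rcases lt_abs.1 hω with h3 | h3
    · exact Or.inl (by linarith)
    · exact Or.inr (by linarith)
  · rw [← ENNReal.ofReal_add (Real.exp_pos _).le (Real.exp_pos _).le]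
    congr 1
    ring

end IsDriven

end Noise

end

end CoopLQR

namespace CoopLQR

noncomputable section

set_option linter.unusedSectionVars false

open scoped ENNReal

/-! ### Discretization -/

section Grid

variable {D : Type*} [Fintype D] [DecidableEq D] {m : Type*} [Fintype m]

lemma euclNorm_le_card_mul {v : D → ℝ} {ε : ℝ} (h : ∀ i, |v i| ≤ ε) :
    euclNorm v ≤ Fintype.card D * ε := by
  have h1 : euclNorm v = euclNorm (∑ i, Pi.single i (v i)) := by
    congr 1
    exact (Finset.univ_sum_single v).symm
  rw [h1]
  refine (euclNorm_sum_le _ _).trans ?_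
  have h2 : ∀ i ∈ Finset.univ, euclNorm (Pi.single i (v i) : D → ℝ) ≤ ε := by
    intro i _
    rw [euclNorm_eq_sqrt]
    simp only [Pi.single_apply, ite_pow, ne_eq, OfNat.ofNat_ne_zero, not_false_eq_true, zero_pow,
      Finset.sum_ite_eq', Finset.mem_univ, if_true]
    rw [Real.sqrt_sq_eq_abs]
    exact h i
  simpa using Finset.sum_le_sum h2

-- The points `R k / N` with integers `|kᵢ| ≤ N`, reached by rounding down.
variable (D) in
lemma exists_grid {R : ℝ} (hR : 0 < R) {N : ℕ} (hN : 0 < N) :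
    ∃ S : Finset (D → ℝ), S.card ≤ (2 * N + 1) ^ Fintype.card D ∧
      ∀ v : D → ℝ, (∀ i, |v i| ≤ R) → ∃ a ∈ S, ∀ i, |(v - a) i| ≤ R / N := by
  classical
  have hN' : (0 : ℝ) < N := by exact_mod_cast hN
  refine ⟨(Fintype.piFinset fun _ : D => Finset.Icc (-N : ℤ) N).image
    fun k i => R * k i / N, ?_, ?_⟩
  · refine Finset.card_image_le.trans ?_
    rw [Fintype.card_piFinset, Finset.prod_const, Int.card_Icc, Finset.card_univ]
    refine Nat.pow_le_pow_left ?_ _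
    omega
  · intro v hv
    refine ⟨fun i => R * ⌊v i * N / R⌋ / N, Finset.mem_image.2
      ⟨fun i => ⌊v i * N / R⌋, ?_, rfl⟩, fun i => ?_⟩
    · rw [Fintype.mem_piFinset]
      intro i
      obtain ⟨h1, h2⟩ := abs_le.1 (hv i)
      rw [Finset.mem_Icc]
      constructor
      · rw [Int.le_floor, le_div_iff₀ hR]
        push_cast
        nlinarith
      · rw [← Int.floor_natCast (R := ℝ)]
        refine Int.floor_le_floor ?_
        rw [div_le_iff₀ hR]
        nlinarith
    · have h1 := Int.floor_le (v i * N / R)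
      have h2 := (Int.lt_floor_add_one (v i * N / R)).le
      have h3 : (v - fun i => R * ⌊v i * N / R⌋ / N) i =
          R / N * (v i * N / R - ⌊v i * N / R⌋) := by
        simp only [Pi.sub_apply]
        field_simp
      rw [h3, abs_mul, abs_of_pos (by positivity), abs_of_nonneg (by linarith)]
      exact mul_le_of_le_one_right (by positivity) (by linarith)

/-- A grid point `a` close to a unit vector has norm at least `1/2`, hence `‖Φ a‖ ≥ c/2`; moving
back to the unit vector loses at most `c/4`. -/
lemma le_euclNorm_mulVec_of_grid (Φ : Matrix m D ℝ) {F c : ℝ} {N : ℕ} (hN : 0 < N)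
    {S : Finset (D → ℝ)}
    (hS : ∀ v : D → ℝ, (∀ i, |v i| ≤ 1) → ∃ a ∈ S, ∀ i, |(v - a) i| ≤ 1 / N)
    (hF : ∀ v, euclNorm (Φ *ᵥ v) ≤ F * euclNorm v) (hF0 : 0 ≤ F) (hc : 0 ≤ c)
    (hd : 2 * (Fintype.card D : ℝ) ≤ N) (hFN : 4 * F * Fintype.card D ≤ c * N)
    (hgrid : ∀ a ∈ S, a ≠ 0 → c * euclNorm a ≤ euclNorm (Φ *ᵥ a)) (e : D → ℝ) :
    c / 4 * euclNorm e ≤ euclNorm (Φ *ᵥ e) := by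
  have hN' : (0 : ℝ) < N := by exact_mod_cast hN
  rcases (euclNorm_nonneg e).eq_or_lt with h0 | h0
  · rw [← h0, mul_zero]; exact euclNorm_nonneg _
  set v := (euclNorm e)⁻¹ • e with hv
  have hv1 : euclNorm v = 1 := by
    rw [hv, euclNorm_smul, abs_of_pos (by positivity), inv_mul_cancel₀ h0.ne']
  obtain ⟨a, haS, ha⟩ := hS v fun i => (abs_apply_le_euclNorm v i).trans hv1.le
  have h1 := euclNorm_le_card_mul ha
  have h2 : euclNorm (v - a) ≤ 1 / 2 := by
    refine h1.trans ?_
    rw [mul_one_div, div_le_iff₀ hN']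
    linarith
  have h3 : euclNorm v ≤ euclNorm a + euclNorm (v - a) := by
    simpa using euclNorm_add_le a (v - a)
  have h4 : a ≠ 0 := by
    rintro rfl
    rw [euclNorm_zero] at h3
    linarith
  have h5 := hgrid a haS h4
  have h6 : euclNorm (Φ *ᵥ a) ≤ euclNorm (Φ *ᵥ v) + euclNorm (Φ *ᵥ (v - a)) := by
    have h7 := euclNorm_add_le (Φ *ᵥ v) (-(Φ *ᵥ (v - a)))
    have h8 := euclNorm_smul (-1) (Φ *ᵥ (v - a))
    rw [abs_neg, abs_one, one_mul, neg_one_smul] at h8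
    rw [h8, ← mulVec_neg, ← mulVec_add] at h7
    simpa using h7
  have h7 : euclNorm (Φ *ᵥ (v - a)) ≤ c / 4 := by
    refine (hF _).trans ((mul_le_mul_of_nonneg_left h1 hF0).trans ?_)
    rw [mul_one_div, ← mul_div_assoc, div_le_iff₀ hN']
    linarith
  have h8 : c / 4 ≤ euclNorm (Φ *ᵥ v) := by
    have h9 : c * (1 / 2) ≤ c * euclNorm a := mul_le_mul_of_nonneg_left (by linarith) hc
    linarith
  rw [hv, mulVec_smul, euclNorm_smul, abs_of_pos (by positivity), ← div_eq_inv_mul,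
    le_div_iff₀ h0] at h8
  exact h8

/-- The quadratic inequality on the grid is a surrogate for the self-normalized one. Scaling `e` to
`‖Φ e‖ = l` balances its two terms: `l² + (2l)²/2` plus the discretization error `1` is at most
`4l²`. The lower bound on `Φ` confines the scaled vector to a box of deterministic radius `l / c`.
-/
lemma abs_dotProduct_le_of_grid (Φ : Matrix m D ℝ) {F c l Y : ℝ} {N : ℕ} (hN : 0 < N)
    (hc : 0 < c) (hl : 1 ≤ l) {S : Finset (D → ℝ)}
    (hS : ∀ v : D → ℝ, (∀ i, |v i| ≤ l / c) → ∃ a ∈ S, ∀ i, |(v - a) i| ≤ l / c / N)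
    (hF : ∀ v, euclNorm (Φ *ᵥ v) ≤ F * euclNorm v) (hF0 : 0 ≤ F)
    (hlow : ∀ e, c * euclNorm e ≤ euclNorm (Φ *ᵥ e)) {y : m → ℝ} (hy : euclNorm y ≤ Y)
    (hY : 1 ≤ Y) (hFN : F * Fintype.card D * (l / c) * Y ≤ N)
    (hgrid : ∀ a ∈ S, (Φ *ᵥ a) ⬝ᵥ y ≤ l ^ 2 + euclNorm (Φ *ᵥ a) ^ 2 / 2) (e : D → ℝ) :
    |(Φ *ᵥ e) ⬝ᵥ y| ≤ 4 * l * euclNorm (Φ *ᵥ e) := by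
  have hN' : (0 : ℝ) < N := by exact_mod_cast hN
  have hl0 : 0 < l := by linarith
  have key : ∀ e : D → ℝ, (Φ *ᵥ e) ⬝ᵥ y ≤ 4 * l * euclNorm (Φ *ᵥ e) := by
    intro e
    rcases (euclNorm_nonneg (Φ *ᵥ e)).eq_or_lt with h0 | h0
    · have h1 := (euclNorm_eq_zero_iff (v := Φ *ᵥ e)).1 h0.symm
      rw [h1, zero_dotProduct, euclNorm_zero, mul_zero]
    set k := l / euclNorm (Φ *ᵥ e) with hk
    have hk0 : 0 < k := by positivity
    have hv1 : euclNorm (Φ *ᵥ (k • e)) = l := by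
      rw [mulVec_smul, euclNorm_smul, abs_of_pos hk0, hk, div_mul_cancel₀ _ h0.ne']
    have hv2 : euclNorm (k • e) ≤ l / c := by
      rw [le_div_iff₀ hc, mul_comm, ← hv1]
      exact hlow _
    obtain ⟨a, haS, ha⟩ := hS (k • e) fun i => (abs_apply_le_euclNorm _ i).trans hv2
    have h1 := euclNorm_le_card_mul ha
    have h2 : euclNorm (Φ *ᵥ (k • e - a)) * Y ≤ 1 := by
      refine (mul_le_mul_of_nonneg_right ((hF _).trans (mul_le_mul_of_nonneg_left h1 hF0))
        (by linarith)).trans ?_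
      rw [← mul_div_assoc, ← mul_div_assoc, div_mul_eq_mul_div, div_le_iff₀ hN', one_mul,
        ← mul_assoc]
      exact hFN
    have h3 : euclNorm (Φ *ᵥ (k • e - a)) ≤ 1 :=
      (le_mul_of_one_le_right (euclNorm_nonneg _) hY).trans h2
    have h4 : euclNorm (Φ *ᵥ a) ≤ 2 * l := by
      have h7 := euclNorm_add_le (Φ *ᵥ (k • e)) (-(Φ *ᵥ (k • e - a)))
      have h8 := euclNorm_smul (-1) (Φ *ᵥ (k • e - a))
      rw [abs_neg, abs_one, one_mul, neg_one_smul] at h8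
      rw [h8, ← mulVec_neg, ← mulVec_add, hv1] at h7
      simp only [neg_sub, add_sub_cancel] at h7
      linarith
    have h5 : (Φ *ᵥ (k • e - a)) ⬝ᵥ y ≤ 1 :=
      (le_abs_self _).trans ((abs_dotProduct_le _ _).trans
        ((mul_le_mul_of_nonneg_left hy (euclNorm_nonneg _)).trans h2))
    have h6 : (Φ *ᵥ (k • e)) ⬝ᵥ y = (Φ *ᵥ a) ⬝ᵥ y + (Φ *ᵥ (k • e - a)) ⬝ᵥ y := by
      rw [← add_dotProduct, ← mulVec_add, add_sub_cancel]
    have h7 := hgrid a haS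
    have h8 : euclNorm (Φ *ᵥ a) ^ 2 ≤ (2 * l) ^ 2 :=
      pow_le_pow_left₀ (euclNorm_nonneg _) h4 2
    have h9 : (Φ *ᵥ (k • e)) ⬝ᵥ y ≤ 4 * l ^ 2 := by
      rw [h6]
      nlinarith
    rw [mulVec_smul, smul_dotProduct, smul_eq_mul, hk, div_mul_eq_mul_div, div_le_iff₀ h0] at h9
    nlinarith
  rw [abs_le]
  refine ⟨?_, key e⟩
  have h1 := key (-e)
  have h8 := euclNorm_smul (-1) (Φ *ᵥ e)
  rw [abs_neg, abs_one, one_mul, neg_one_smul] at h8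
  rw [mulVec_neg, neg_dotProduct, h8] at h1
  linarith

end Grid

/-! ### The small-ball estimate and the self-normalized estimate for a fixed direction -/

section Fixed

variable {ι κ : Type*} [Fintype ι] [DecidableEq ι] [Fintype κ] [DecidableEq κ]
  {A : Matrix ι ι ℝ} {B : Matrix ι κ ℝ} {Kp : Matrix κ ι ℝ} {σw ση m₀ : ℝ}

/-- The data matrix `Φ` of a state-control trajectory. -/
abbrev dataMat (T : ℕ) (z : ℕ → (ι → ℝ) × (κ → ℝ)) : Matrix (Fin T) (Sym2 (ι ⊕ κ)) ℝ :=
  phiMat T (fun t => (z t).1) (fun t => (z t).2)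

/-- The quadratic form `[x; u]ᵀ E [x; u]`. -/
def formAt (E : Matrix (ι ⊕ κ) (ι ⊕ κ) ℝ) (z : (ι → ℝ) × (κ → ℝ)) : ℝ :=
  Sum.elim z.1 z.2 ⬝ᵥ E *ᵥ Sum.elim z.1 z.2

lemma dataMat_mulVec (T : ℕ) (z : ℕ → (ι → ℝ) × (κ → ℝ)) (e : Sym2 (ι ⊕ κ) → ℝ) (t : Fin T) :
    (dataMat T z *ᵥ e) t = formAt (smat e) (z (t + 1)) := phiMat_mulVec _ _ _ _ _

lemma measurable_formAt (E : Matrix (ι ⊕ κ) (ι ⊕ κ) ℝ) : Measurable (formAt E) := by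
  unfold formAt
  simp only [mulVec, dotProduct, Fintype.sum_sum_type, Sum.elim_inl, Sum.elim_inr]
  fun_prop

lemma euclNorm_dataMat_mulVec_sq (T : ℕ) (z : ℕ → (ι → ℝ) × (κ → ℝ)) (e : Sym2 (ι ⊕ κ) → ℝ) :
    euclNorm (dataMat T z *ᵥ e) ^ 2 =
      ∑ k ∈ Finset.range T, formAt (smat e) (z (k + 1)) ^ 2 := by
  rw [euclNorm_sq, ← Fin.sum_univ_eq_sum_range fun k => formAt (smat e) (z (k + 1)) ^ 2]
  exact Finset.sum_congr rfl fun t _ => by rw [dataMat_mulVec]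

lemma euclNorm_dataMat_mulVec_le (T : ℕ) {z : ℕ → (ι → ℝ) × (κ → ℝ)} {b : ℝ}
    (hz : ∀ t < T, euclNorm (Sum.elim (z (t + 1)).1 (z (t + 1)).2) ^ 2 ≤ b)
    (e : Sym2 (ι ⊕ κ) → ℝ) : euclNorm (dataMat T z *ᵥ e) ≤ T * b * euclNorm e := by
  have h := euclNorm_le_card_mul (v := dataMat T z *ᵥ e) (ε := b * euclNorm e) fun t => by
    rw [dataMat_mulVec, formAt, ← svec_vecMulVec_dotProduct]
    exact (abs_smat_dotProduct_le e).trans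
      (mul_le_mul_of_nonneg_right (hz t t.2) (euclNorm_nonneg _))
  rwa [Fintype.card_fin, ← mul_assoc] at h

/-- The linear map that sends the driving noise to its contribution to the next state and
control. -/
def noiseMat (Kp : Matrix κ ι ℝ) (σw ση : ℝ) : Matrix (ι ⊕ κ) (ι ⊕ κ) ℝ :=
  fromBlocks (σw • (1 : Matrix ι ι ℝ)) 0 (σw • Kp) (ση • (1 : Matrix κ κ ℝ))

lemma stepFun_eq (z : (ι → ℝ) × (κ → ℝ)) (g : ι ⊕ κ → ℝ) :
    Sum.elim (stepFun A B Kp σw ση z g).1 (stepFun A B Kp σw ση z g).2 =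
      Sum.elim (A *ᵥ z.1 + B *ᵥ z.2) (Kp *ᵥ (A *ᵥ z.1 + B *ᵥ z.2)) + noiseMat Kp σw ση *ᵥ g := by
  rw [noiseMat, fromBlocks_mulVec]
  ext i
  rcases i with i | i <;>
  simp [stepFun, mulVec_add, mulVec_smul, smul_mulVec, add_assoc]

/-- The inverse of a block triangular matrix. Its size is governed by the smaller noise level `ση`;
the gain enters because the state noise is fed back into the control. -/
lemma specNorm_noiseMat_inv_le (hη : 0 < ση) (hσ : ση ≤ σw) :
    ∃ X : Matrix (ι ⊕ κ) (ι ⊕ κ) ℝ, noiseMat Kp σw ση * X = 1 ∧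
      specNorm X ≤ specNormPlus Kp / ση := by
  have hw : 0 < σw := hη.trans_le hσ
  refine ⟨fromBlocks (σw⁻¹ • (1 : Matrix ι ι ℝ)) 0 (-(ση⁻¹ • Kp)) (ση⁻¹ • (1 : Matrix κ κ ℝ)),
    ?_, ?_⟩
  · rw [noiseMat, fromBlocks_multiply, ← fromBlocks_one]
    congr 1
    · simp [smul_smul, hw.ne']
    · simp
    · simp [smul_smul, hw.ne', hη.ne']
    · simp [smul_smul, hη.ne']
  · have hk := specNorm_nonneg Kp
    refine specNorm_le_of_forall (by unfold specNormPlus; positivity) fun v => ?_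
    set a := v ∘ Sum.inl
    set b := v ∘ Sum.inr
    have hv : v = Sum.elim a b := by ext i; cases i <;> rfl
    refine le_of_sq_le_sq ?_ (mul_nonneg (by unfold specNormPlus; positivity) (euclNorm_nonneg _))
    rw [hv, fromBlocks_mulVec, euclNorm_sumElim_sq, mul_pow, euclNorm_sumElim_sq]
    simp only [Sum.elim_comp_inl, Sum.elim_comp_inr, zero_mulVec, add_zero, smul_mulVec,
      one_mulVec, neg_mulVec]
    have h1 : euclNorm (σw⁻¹ • a) ≤ ση⁻¹ * euclNorm a := by
      rw [euclNorm_smul, abs_of_pos (by positivity)]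
      exact mul_le_mul_of_nonneg_right (inv_anti₀ hη hσ) (euclNorm_nonneg _)
    have h2 : euclNorm (-(ση⁻¹ • (Kp *ᵥ a)) + ση⁻¹ • b) ≤
        ση⁻¹ * (specNorm Kp * euclNorm a + euclNorm b) := by
      refine (euclNorm_add_le _ _).trans ?_
      rw [← neg_smul, euclNorm_smul, euclNorm_smul, abs_neg, abs_of_pos (by positivity), ← mul_add]
      exact mul_le_mul_of_nonneg_left (add_le_add_left (euclNorm_mulVec_le _ _) _) (by positivity)
    have h3 := pow_le_pow_left₀ (euclNorm_nonneg _) h1 2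
    have h4 := pow_le_pow_left₀ (euclNorm_nonneg _) h2 2
    refine (add_le_add h3 h4).trans ?_
    rw [mul_pow, mul_pow, ← mul_add, div_pow, specNormPlus, div_eq_inv_mul, inv_pow, mul_assoc]
    refine mul_le_mul_of_nonneg_left ?_ (by positivity)
    nlinarith [euclNorm_nonneg a, euclNorm_nonneg b, sq_nonneg (euclNorm a - euclNorm b),
      mul_nonneg hk (sq_nonneg (euclNorm a - euclNorm b)), mul_nonneg hk (sq_nonneg (euclNorm a)),
      mul_nonneg hk (sq_nonneg (euclNorm b)), mul_nonneg (mul_nonneg hk hk) (sq_nonneg (euclNorm b))]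

/-- Undoing the conjugation by `noiseMat` shows that the quadratic part in `g` has Frobenius norm at
least `s`. The past enters only the linear and constant parts, to which the small-ball estimate is
insensitive. -/
lemma lintegral_exp_neg_formAt_stepFun_le (hη : 0 < ση) (hσ : ση ≤ σw)
    {E : Matrix (ι ⊕ κ) (ι ⊕ κ) ℝ} (hE : E.IsSymm) {s : ℝ} (hs : 0 < s)
    (hsE : s = ση ^ 2 / specNormPlus Kp ^ 2 * frobNorm E) (z : (ι → ℝ) × (κ → ℝ)) :
    ∫⁻ g, ENNReal.ofReal (Real.exp (-(512 / s ^ 2 * formAt E (stepFun A B Kp σw ση z g) ^ 2)))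
      ∂stdGauss (ι ⊕ κ) ≤ 2⁻¹ := by
  set Γ := noiseMat Kp σw ση with hΓ
  set c := Sum.elim (A *ᵥ z.1 + B *ᵥ z.2) (Kp *ᵥ (A *ᵥ z.1 + B *ᵥ z.2)) with hc
  obtain ⟨X, hX, hXn⟩ := specNorm_noiseMat_inv_le (Kp := Kp) hη hσ
  have hP : 0 < specNormPlus Kp := lt_of_lt_of_le one_pos (one_le_specNormPlus _)
  have hform : ∀ g, formAt E (stepFun A B Kp σw ση z g) =
      g ⬝ᵥ (Γᵀ * E * Γ) *ᵥ g + (2 • (Γᵀ *ᵥ (E *ᵥ c))) ⬝ᵥ g + c ⬝ᵥ E *ᵥ c := by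
    intro g
    rw [formAt, stepFun_eq, ← hc, ← hΓ, dotProduct_conj_mulVec, mulVec_add, add_dotProduct,
      dotProduct_add, dotProduct_add]
    have h1 : c ⬝ᵥ E *ᵥ (Γ *ᵥ g) = (Γᵀ *ᵥ (E *ᵥ c)) ⬝ᵥ g := by
      rw [dotProduct_mulVec c, ← mulVec_transpose, hE.eq, dotProduct_mulVec, ← mulVec_transpose]
    have h2 : (Γ *ᵥ g) ⬝ᵥ E *ᵥ c = (Γᵀ *ᵥ (E *ᵥ c)) ⬝ᵥ g := by
      rw [dotProduct_comm, dotProduct_mulVec, ← mulVec_transpose]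
    rw [h1, h2, two_smul, add_dotProduct]
    ring
  have hM : frobNorm E ≤ (specNormPlus Kp / ση) ^ 2 * frobNorm (Γᵀ * E * Γ) := by
    have h1 : E = Xᵀ * (Γᵀ * E * Γ) * X := by
      have h2 : Xᵀ * Γᵀ = 1 := by rw [← transpose_mul, hX, transpose_one]
      calc E = (Xᵀ * Γᵀ) * E * (Γ * X) := by rw [h2, hX, one_mul, mul_one]
        _ = _ := by simp only [Matrix.mul_assoc]
    calc frobNorm E = frobNorm (Xᵀ * (Γᵀ * E * Γ) * X) := by rw [← h1]
      _ ≤ specNorm X ^ 2 * frobNorm (Γᵀ * E * Γ) := frobNorm_conj_le _ _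
      _ ≤ _ := mul_le_mul_of_nonneg_right (pow_le_pow_left₀ (specNorm_nonneg _) hXn 2)
          (frobNorm_nonneg _)
  have hsM : s ^ 2 ≤ ∑ i, ∑ j, (Γᵀ * E * Γ) i j ^ 2 := by
    rw [← frobNorm_sq]
    refine pow_le_pow_left₀ hs.le ?_ 2
    rw [hsE]
    refine (mul_le_mul_of_nonneg_left hM (by positivity)).trans (le_of_eq ?_)
    field_simp
  have h1 := integral_exp_neg_sq_quadratic_stdGauss_le (isSymm_conj hE Γ)
    (2 • (Γᵀ *ᵥ (E *ᵥ c))) (c ⬝ᵥ E *ᵥ c) hs hsM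
  simp_rw [← hform] at h1
  have hm : Measurable fun g : ι ⊕ κ → ℝ =>
      Real.exp (-(512 / s ^ 2 * formAt E (stepFun A B Kp σw ση z g) ^ 2)) :=
    ((((measurable_formAt E).comp
      (measurable_stepFun.of_uncurry_left (x := z))).pow_const 2).const_mul _).neg.exp
  have hi : Integrable (fun g : ι ⊕ κ → ℝ =>
      Real.exp (-(512 / s ^ 2 * formAt E (stepFun A B Kp σw ση z g) ^ 2))) (stdGauss (ι ⊕ κ)) := by
    refine Integrable.of_bound hm.aestronglyMeasurable 1 (ae_of_all _ fun g => ?_)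
    rw [Real.norm_of_nonneg (Real.exp_pos _).le]
    exact Real.exp_le_one_iff.2 (neg_nonpos.2 (by positivity))
  rw [← ofReal_integral_eq_lintegral_ofReal hi (ae_of_all _ fun _ => (Real.exp_pos _).le)]
  refine (ENNReal.ofReal_le_ofReal h1).trans (le_of_eq ?_)
  rw [one_div, ENNReal.ofReal_inv_of_pos (by norm_num), ENNReal.ofReal_ofNat]

variable {Ω : Type*} [MeasurableSpace Ω] {μ : Measure Ω} [IsProbabilityMeasure μ]
  {z : ℕ → Ω → (ι → ℝ) × (κ → ℝ)} {g : ℕ → Ω → ι ⊕ κ → ℝ}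

namespace IsDriven

/-- The Laplace transform of `‖Φ e‖²` is at most `2^(-T)`. Below the threshold its exponent is at
most `(512/48²) T = (2/9) T`, and `log 2 - 2/9 > 1/4`. -/
lemma measure_euclNorm_dataMat_lt_le (h : IsDriven μ A B Kp σw ση m₀ z g) (hη : 0 < ση)
    (hσ : ση ≤ σw) (T : ℕ) {e : Sym2 (ι ⊕ κ) → ℝ} (he : e ≠ 0) :
    μ {ω | euclNorm (dataMat T (fun t => z t ω) *ᵥ e) <
      √T * (ση ^ 2 / specNormPlus Kp ^ 2) / 48 * euclNorm e} ≤
      ENNReal.ofReal (Real.exp (-(T / 4))) := by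
  have hP : 0 < specNormPlus Kp := lt_of_lt_of_le one_pos (one_le_specNormPlus _)
  have he0 : 0 < euclNorm e :=
    (euclNorm_nonneg e).lt_of_ne fun h => he (euclNorm_eq_zero_iff.1 h.symm)
  set s := ση ^ 2 / specNormPlus Kp ^ 2 * euclNorm e with hs
  have hs0 : 0 < s := by positivity
  set f : (ι → ℝ) × (κ → ℝ) → (ι ⊕ κ → ℝ) → ℝ≥0∞ := fun z g => ENNReal.ofReal (Real.exp
    (-(512 / s ^ 2 * formAt (smat e) (stepFun A B Kp σw ση z g) ^ 2))) with hf
  have hfm : Measurable (Function.uncurry f) :=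
    ((((measurable_formAt (smat e)).comp measurable_stepFun).pow_const
      2).const_mul _).neg.exp.ennreal_ofReal
  have h1 := h.lintegral_prod_le 0 hfm (lintegral_exp_neg_formAt_stepFun_le hη hσ (isSymm_smat e)
    hs0 (by rw [frobNorm_smat])) T
  have h2 : ∀ ω, ∏ k ∈ Finset.range T, f (z (0 + k) ω) (g (0 + k) ω) = ENNReal.ofReal (Real.exp
      (-(512 / s ^ 2 * euclNorm (dataMat T (fun t => z t ω) *ᵥ e) ^ 2))) := by
    intro ω
    rw [euclNorm_dataMat_mulVec_sq, Finset.mul_sum, ← Finset.sum_neg_distrib, Real.exp_sum,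
      ENNReal.ofReal_prod_of_nonneg fun _ _ => (Real.exp_pos _).le]
    refine Finset.prod_congr rfl fun k _ => ?_
    simp only [hf, zero_add, ← h.step]
  simp_rw [h2] at h1
  have h3 : (2⁻¹ : ℝ≥0∞) ^ T ≤ ENNReal.ofReal (Real.exp (-(69 / 100 * T))) := by
    have h4 : (2⁻¹ : ℝ≥0∞) = ENNReal.ofReal (Real.exp (-Real.log 2)) := by
      rw [Real.exp_neg, Real.exp_log (by norm_num), ENNReal.ofReal_inv_of_pos (by norm_num),
        ENNReal.ofReal_ofNat]
    rw [h4, ← ENNReal.ofReal_pow (Real.exp_pos _).le, ← Real.exp_nat_mul]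
    refine ENNReal.ofReal_le_ofReal (Real.exp_le_exp.2 ?_)
    have := Real.log_two_gt_d9
    have hT : (0 : ℝ) ≤ T := Nat.cast_nonneg T
    nlinarith
  have hm : AEMeasurable
      (fun ω => -(512 / s ^ 2 * euclNorm (dataMat T (fun t => z t ω) *ᵥ e) ^ 2)) μ := by
    simp_rw [euclNorm_dataMat_mulVec_sq]
    refine (AEMeasurable.const_mul ?_ _).neg
    exact Finset.aemeasurable_fun_sum _ fun k _ =>
      ((measurable_formAt (smat e)).comp_aemeasurable (h.aemeasurable_state (k + 1))).pow_const 2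
  have h5 := measure_lt_le_of_lintegral_exp_le hm (h1.trans h3) (-(2 / 9 * T))
  refine (measure_mono fun ω hω => ?_).trans (h5.trans
    (ENNReal.ofReal_le_ofReal (Real.exp_le_exp.2 ?_)))
  · simp only [Set.mem_ofPred_eq] at hω ⊢
    have h6 : euclNorm (dataMat T (fun t => z t ω) *ᵥ e) ^ 2 ≤ T * s ^ 2 / 48 ^ 2 := by
      refine (pow_le_pow_left₀ (euclNorm_nonneg _) hω.le 2).trans (le_of_eq ?_)
      rw [hs]
      have := Real.sq_sqrt (Nat.cast_nonneg (α := ℝ) T)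
      rw [mul_pow, div_pow, mul_pow, this]
      ring
    have h7 := mul_le_mul_of_nonneg_left h6 (show 0 ≤ 512 / s ^ 2 by positivity)
    have h8 : 512 / s ^ 2 * (T * s ^ 2 / 48 ^ 2) = 2 / 9 * T := by field_simp; norm_num; ring
    linarith
  · have hT : (0 : ℝ) ≤ T := Nat.cast_nonneg T
    linarith

end IsDriven

/-- Hoeffding's lemma on `[-1, 1]`, where the variance proxy is `1`. -/
lemma lintegral_exp_centred_le {G : Type*} [MeasurableSpace G] {γ : Measure G}
    [IsProbabilityMeasure γ] {Y : G → ℝ} (hY : Measurable Y) (hb : ∀ y, |Y y| ≤ 1) (a : ℝ) :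
    ∫⁻ y, ENNReal.ofReal (Real.exp (a * (Y y - ∫ y', Y y' ∂γ) - a ^ 2 / 2)) ∂γ ≤ 1 := by
  have h := hasSubgaussianMGF_of_mem_Icc (a := -1) (b := 1) hY.aemeasurable
    (ae_of_all γ fun y => abs_le.1 (hb y))
  have h1 := h.mgf_le a
  have h2 := h.integrable_exp_mul a
  have hc : (((‖(1 : ℝ) - -1‖₊ / 2) ^ 2 : NNReal) : ℝ) = 1 := by
    simp only [NNReal.coe_pow, NNReal.coe_div, coe_nnnorm]
    norm_num
  rw [hc, one_mul, mgf] at h1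
  simp_rw [Real.exp_sub]
  rw [← ofReal_integral_eq_lintegral_ofReal (h2.div_const _) (ae_of_all _ fun _ => by positivity),
    integral_div]
  exact ENNReal.ofReal_le_one.2 ((div_le_one (Real.exp_pos _)).2 h1)

/-- The truncated TD noise, centred. -/
def centredNoise (A : Matrix ι ι ℝ) (B : Matrix ι κ ℝ) (σw : ℝ) (P : Matrix ι ι ℝ) (s b : ℝ)
    (z : (ι → ℝ) × (κ → ℝ)) (g : ι ⊕ κ → ℝ) : ℝ :=
  truncNoise A B σw P s b z g - ∫ y, truncNoise A B σw P s b z y ∂stdGauss (ι ⊕ κ)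

lemma measurable_centredNoise (P : Matrix ι ι ℝ) (s b : ℝ) :
    Measurable (Function.uncurry
      (centredNoise A B σw P s b : (ι → ℝ) × (κ → ℝ) → (ι ⊕ κ → ℝ) → ℝ)) := by
  have h := measurable_truncNoise (κ := κ) (A := A) (B := B) (σw := σw) P s b
  refine h.sub ?_
  have h1 : Measurable fun z : (ι → ℝ) × (κ → ℝ) =>
      ∫ y, truncNoise A B σw P s b z y ∂stdGauss (ι ⊕ κ) :=
    (h.stronglyMeasurable.integral_prod_right (ν := stdGauss (ι ⊕ κ))).measurable
  exact h1.comp measurable_fst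

namespace IsDriven

/-- The multiplier `formAt (smat e) z` is determined by the past, and half its square compensates
the exponential. The product over time is an exponential supermartingale of mean at most one, and
Markov's inequality is applied at level `l²`. -/
lemma measure_dotProduct_centredNoise_gt_le (h : IsDriven μ A B Kp σw ση m₀ z g)
    (P : Matrix ι ι ℝ) (s : ℝ) {b : ℝ} (hb : 0 < b) (T : ℕ) (e : Sym2 (ι ⊕ κ) → ℝ) (l : ℝ) :
    μ {ω | l ^ 2 + euclNorm (dataMat T (fun t => z t ω) *ᵥ e) ^ 2 / 2 <
      (dataMat T (fun t => z t ω) *ᵥ e) ⬝ᵥ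
        fun t : Fin T => centredNoise A B σw P s b (z (t + 1) ω) (g (t + 1) ω)} ≤
      ENNReal.ofReal (Real.exp (-l ^ 2)) := by
  set f : (ι → ℝ) × (κ → ℝ) → (ι ⊕ κ → ℝ) → ℝ≥0∞ := fun z g => ENNReal.ofReal (Real.exp
    (formAt (smat e) z * centredNoise A B σw P s b z g - formAt (smat e) z ^ 2 / 2)) with hf
  have hform : Measurable fun p : ((ι → ℝ) × (κ → ℝ)) × (ι ⊕ κ → ℝ) => formAt (smat e) p.1 :=
    (measurable_formAt (smat e)).comp measurable_fst
  have hfm : Measurable (Function.uncurry f) :=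
    ((hform.mul (measurable_centredNoise P s b)).sub
      ((hform.pow_const 2).div_const 2)).exp.ennreal_ofReal
  have h1 := h.lintegral_prod_le 1 hfm (fun z => lintegral_exp_centred_le
    (measurable_truncNoise P s b).of_uncurry_left (fun y => abs_truncNoise_le P s hb z y) _) T
  have hX : ∀ ω, (dataMat T (fun t => z t ω) *ᵥ e) ⬝ᵥ
        (fun t : Fin T => centredNoise A B σw P s b (z (t + 1) ω) (g (t + 1) ω)) -
        euclNorm (dataMat T (fun t => z t ω) *ᵥ e) ^ 2 / 2 = ∑ k ∈ Finset.range T,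
      (formAt (smat e) (z (1 + k) ω) * centredNoise A B σw P s b (z (1 + k) ω) (g (1 + k) ω) -
        formAt (smat e) (z (1 + k) ω) ^ 2 / 2) := by
    intro ω
    rw [Finset.sum_sub_distrib, ← Finset.sum_div, euclNorm_dataMat_mulVec_sq, dotProduct,
      ← Fin.sum_univ_eq_sum_range fun k => formAt (smat e) (z (1 + k) ω) *
        centredNoise A B σw P s b (z (1 + k) ω) (g (1 + k) ω)]
    congr 1
    · refine Finset.sum_congr rfl fun t _ => ?_
      rw [dataMat_mulVec, add_comm 1]
    · congr 1
      exact Finset.sum_congr rfl fun t _ => by rw [add_comm 1]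
  have h2 : ∀ ω, ∏ k ∈ Finset.range T, f (z (1 + k) ω) (g (1 + k) ω) = ENNReal.ofReal (Real.exp
      ((dataMat T (fun t => z t ω) *ᵥ e) ⬝ᵥ
        (fun t : Fin T => centredNoise A B σw P s b (z (t + 1) ω) (g (t + 1) ω)) -
        euclNorm (dataMat T (fun t => z t ω) *ᵥ e) ^ 2 / 2)) := by
    intro ω
    rw [hX, Real.exp_sum, ENNReal.ofReal_prod_of_nonneg fun _ _ => (Real.exp_pos _).le]
  simp_rw [h2, one_pow] at h1
  have hm : AEMeasurable (fun ω => (dataMat T (fun t => z t ω) *ᵥ e) ⬝ᵥ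
        (fun t : Fin T => centredNoise A B σw P s b (z (t + 1) ω) (g (t + 1) ω)) -
        euclNorm (dataMat T (fun t => z t ω) *ᵥ e) ^ 2 / 2) μ := by
    simp_rw [hX]
    refine Finset.aemeasurable_fun_sum _ fun k _ => ?_
    have h3 : AEMeasurable (fun ω => (z (1 + k) ω, g (1 + k) ω)) μ :=
      (h.aemeasurable_state _).prodMk (h.aemeasurable_noise _)
    exact ((hform.mul (measurable_centredNoise P s b)).sub
      ((hform.pow_const 2).div_const 2)).comp_aemeasurable h3
  have h5 := measure_lt_le_of_lintegral_exp_le (c := 0) hm (by simpa using h1) (l ^ 2)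
  rw [zero_sub] at h5
  refine (measure_mono fun ω hω => ?_).trans h5
  simp only [Set.mem_ofPred_eq] at hω ⊢
  linarith

end IsDriven

end Fixed

end

end CoopLQR

namespace CoopLQR

noncomputable section

set_option linter.unusedSectionVars false

open scoped ENNReal

/-! ### High-probability bounds for a driven system -/

section HighProbability

variable {Ω : Type*} [MeasurableSpace Ω] {μ : Measure Ω} [IsProbabilityMeasure μ]

lemma measureReal_le_of_le_ofReal {S : Set Ω} {c : ℝ} (hc : 0 ≤ c) (h : μ S ≤ ENNReal.ofReal c) :
    μ.real S ≤ c := ENNReal.toReal_le_of_le_ofReal hc h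

lemma measureReal_exists_mem_le {α : Type*} (s : Finset α) {p : α → Ω → Prop} {c : ℝ}
    (h : ∀ a ∈ s, μ.real {ω | p a ω} ≤ c) : μ.real {ω | ∃ a ∈ s, p a ω} ≤ s.card * c := by
  have h1 : {ω | ∃ a ∈ s, p a ω} = ⋃ a ∈ s, {ω | p a ω} := by ext; simp
  rw [h1]
  refine (measureReal_biUnion_finset_le s _).trans ?_
  rw [← nsmul_eq_mul]
  exact Finset.sum_le_card_nsmul _ _ _ h

variable {ι κ : Type*} [Fintype ι] [DecidableEq ι] [Fintype κ] [DecidableEq κ]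
  {A : Matrix ι ι ℝ} {B : Matrix ι κ ℝ} {Kp : Matrix κ ι ℝ} {σw ση m₀ : ℝ}
  {z : ℕ → Ω → (ι → ℝ) × (κ → ℝ)} {g : ℕ → Ω → ι ⊕ κ → ℝ}

lemma IsTauRhoStable.euclNorm_transpose_pow_mulVec_le {τ ρ : ℝ} {L : Matrix ι ι ℝ}
    (h : IsTauRhoStable τ ρ L) {j k : ℕ} (hjk : j ≤ k) (v : ι → ℝ) :
    euclNorm (Lᵀ ^ k *ᵥ v) ≤ τ * ρ ^ j * euclNorm v := by
  obtain ⟨h1, h2, h3, h4⟩ := h.transpose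
  refine (euclNorm_mulVec_le _ _).trans (mul_le_mul_of_nonneg_right ((h4 k).trans ?_)
    (euclNorm_nonneg _))
  exact mul_le_mul_of_nonneg_left (pow_le_pow_of_le_one h2.le h3.le hjk) (by linarith)

namespace IsDriven

/-- From time `j - 1` on, the initial moment has been contracted by at least `j` powers of the
closed loop. The crude bound on the states uses `j = 0`; the noise bound uses `j = 2`, which
produces the `τ²ρ⁴` of `sigmaBar`. -/
lemma measureReal_abs_mean_gt_le (h : IsDriven μ A B Kp σw ση m₀ z g) {τ ρ : ℝ}
    (hst : IsTauRhoStable τ ρ (A + B * Kp)) (hm₀ : 0 ≤ m₀) {j t : ℕ} (hjt : j ≤ t + 1) {σ : ℝ}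
    (hσ0 : 0 < σ)
    (hσ : τ ^ 2 * ρ ^ (2 * j) * m₀ +
      specNorm (lyap (A + B * Kp) (σw ^ 2 • 1 + ση ^ 2 • (B * Bᵀ))) ≤ σ ^ 2)
    (v : ι → ℝ) (r : ℝ) :
    μ.real {ω | r * (σ * euclNorm v) < |v ⬝ᵥ meanFun A B (z t ω)|} ≤ 2 * Real.exp (1 - r) := by
  refine measureReal_le_of_le_ofReal (by positivity) ?_
  rcases (euclNorm_nonneg v).eq_or_lt with h0 | h0
  · have h1 := (euclNorm_eq_zero_iff (v := v)).1 h0.symm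
    subst h1
    simp [euclNorm_zero]
  refine h.measure_abs_mean_gt_le hst t v (by positivity) ?_ r
  have h1 := pow_le_pow_left₀ (euclNorm_nonneg _) (hst.euclNorm_transpose_pow_mulVec_le hjt v) 2
  have h2 := mul_le_mul_of_nonneg_left h1 hm₀
  have h3 := mul_le_mul_of_nonneg_right hσ (sq_nonneg (euclNorm v))
  have h4 : (τ * ρ ^ j * euclNorm v) ^ 2 = τ ^ 2 * ρ ^ (2 * j) * euclNorm v ^ 2 := by ring
  rw [h4] at h2
  rw [mul_pow]
  linarith

/-- This bound only determines the mesh of the grids, hence enters logarithmically, so a union over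
all coordinates and times is affordable. -/
lemma measureReal_state_bad_le (h : IsDriven μ A B Kp σw ση m₀ z g) {τ ρ : ℝ}
    (hst : IsTauRhoStable τ ρ (A + B * Kp)) (hm₀ : 0 ≤ m₀) (hη : 0 < ση) (hησ : ση ≤ σw) {σ : ℝ}
    (hσ0 : 0 < σ)
    (hσ : τ ^ 2 * m₀ + specNorm (lyap (A + B * Kp) (σw ^ 2 • 1 + ση ^ 2 • (B * Bᵀ))) ≤ σ ^ 2)
    (T : ℕ) {r : ℝ} (hr : 0 ≤ r) :
    μ.real {ω | ¬ ∀ t < T, euclNorm (Sum.elim (z (t + 1) ω).1 (z (t + 1) ω).2) ^ 2 ≤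
      (specNormPlus Kp * Fintype.card (ι ⊕ κ) * (r * (σ + 2 * σw))) ^ 2} ≤
      (T * Fintype.card ι + T * Fintype.card (ι ⊕ κ)) * (2 * Real.exp (1 - r)) := by
  have h1 := measureReal_exists_mem_le (μ := μ)
    (Finset.range T ×ˢ (Finset.univ : Finset ι))
    (p := fun q ω => r * (σ * euclNorm (Pi.single q.2 1 : ι → ℝ)) <
      |(Pi.single q.2 1 : ι → ℝ) ⬝ᵥ meanFun A B (z q.1 ω)|)
    (fun q _ => h.measureReal_abs_mean_gt_le hst hm₀ (Nat.zero_le _) hσ0 (by simpa using hσ) _ r)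
  have h2 := measureReal_exists_mem_le (μ := μ)
    (Finset.range T ×ˢ (Finset.univ : Finset (ι ⊕ κ))) (p := fun q ω => r < |g q.1 ω q.2|)
    (fun q _ => measureReal_le_of_le_ofReal (by positivity) (h.measure_abs_coord_gt_le q.1 q.2 r))
  simp only [Finset.card_product, Finset.card_range, Finset.card_univ, Nat.cast_mul] at h1 h2
  rw [add_mul]
  refine le_trans ?_ (add_le_add h1 h2)
  refine le_trans (measureReal_mono fun ω hω => ?_) (measureReal_union_le _ _)
  by_contra hc
  simp only [Set.mem_union, Set.mem_ofPred_eq, not_or, not_exists, not_and, not_lt,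
    Finset.mem_product, Finset.mem_range, Finset.mem_univ, and_true, Prod.forall] at hc hω
  obtain ⟨hc1, hc2⟩ := hc
  refine hω fun t ht => ?_
  have hw : 0 < σw := hη.trans_le hησ
  have hsingle : ∀ i : ι, euclNorm (Pi.single i 1 : ι → ℝ) = 1 := fun i => by
    rw [euclNorm_eq_sqrt]; simp [Pi.single_apply]
  have hk := specNorm_nonneg Kp
  have hn0 : (0 : ℝ) ≤ Fintype.card ι := Nat.cast_nonneg _
  have hu0 : (0 : ℝ) ≤ Fintype.card κ := Nat.cast_nonneg _
  rw [h.step t ω]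
  set x := (stepFun A B Kp σw ση (z t ω) (g t ω)).1 with hx
  have hxn : euclNorm x ≤ Fintype.card ι * (r * (σ + σw)) := by
    refine euclNorm_le_card_mul fun i => ?_
    have h3 := hc1 t i ht
    rw [hsingle, mul_one, single_dotProduct, one_mul] at h3
    have h4 := hc2 t (Sum.inl i) ht
    have h5 : x i = meanFun A B (z t ω) i + σw * g t ω (Sum.inl i) := rfl
    rw [h5]
    refine (abs_add_le _ _).trans ?_
    rw [abs_mul, abs_of_pos hw]
    nlinarith
  have hun : euclNorm (stepFun A B Kp σw ση (z t ω) (g t ω)).2 ≤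
      specNorm Kp * euclNorm x + σw * (Fintype.card κ * r) := by
    have h5 : (stepFun A B Kp σw ση (z t ω) (g t ω)).2 = Kp *ᵥ x + ση • (g t ω ∘ Sum.inr) := rfl
    rw [h5]
    refine (euclNorm_add_le _ _).trans (add_le_add (euclNorm_mulVec_le _ _) ?_)
    rw [euclNorm_smul, abs_of_pos hη]
    refine mul_le_mul hησ (euclNorm_le_card_mul fun i => hc2 t _ ht) (euclNorm_nonneg _) hw.le
  rw [euclNorm_sumElim_sq]
  set a := euclNorm x
  set b := euclNorm (stepFun A B Kp σw ση (z t ω) (g t ω)).2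
  have ha : 0 ≤ a := euclNorm_nonneg _
  have hb : 0 ≤ b := euclNorm_nonneg _
  have h6 : a + b ≤ specNormPlus Kp * Fintype.card (ι ⊕ κ) * (r * (σ + 2 * σw)) := by
    rw [Fintype.card_sum, Nat.cast_add, specNormPlus]
    have h7 : specNorm Kp * a ≤ specNorm Kp * (Fintype.card ι * (r * (σ + σw))) :=
      mul_le_mul_of_nonneg_left hxn hk
    have h8 : a + b ≤ (1 + specNorm Kp) * (Fintype.card ι * (r * (σ + σw))) +
        σw * (Fintype.card κ * r) := by linarith
    refine h8.trans ?_
    have e1 : 0 ≤ (1 + specNorm Kp) * Fintype.card ι * r * σw := by positivity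
    have e2 : 0 ≤ (1 + specNorm Kp) * Fintype.card κ * r * σ := by positivity
    have e3 : 0 ≤ (1 + specNorm Kp) * Fintype.card κ * r * σw := by positivity
    have e4 : 0 ≤ specNorm Kp * Fintype.card κ * r * σw := by positivity
    nlinarith
  calc a ^ 2 + b ^ 2 ≤ (a + b) ^ 2 := by nlinarith
    _ ≤ _ := pow_le_pow_left₀ (by positivity) h6 2

/-- While the states are bounded, `Φ` has the deterministic Lipschitz constant `T * bz`, so a
deterministic grid suffices for the random matrix. -/
lemma measureReal_lower_bad_le (h : IsDriven μ A B Kp σw ση m₀ z g) (hη : 0 < ση) (hησ : ση ≤ σw)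
    (T : ℕ) {bz : ℝ} (hbz : 0 ≤ bz) {N : ℕ} (hN : 0 < N)
    (hd : 2 * (Fintype.card (Sym2 (ι ⊕ κ)) : ℝ) ≤ N)
    (hFN : 4 * (T * bz) * Fintype.card (Sym2 (ι ⊕ κ)) ≤
      √T * (ση ^ 2 / specNormPlus Kp ^ 2) / 48 * N) :
    μ.real {ω | (∀ t < T, euclNorm (Sum.elim (z (t + 1) ω).1 (z (t + 1) ω).2) ^ 2 ≤ bz) ∧
      ¬ ∀ e, √T * (ση ^ 2 / specNormPlus Kp ^ 2) / 192 * euclNorm e ≤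
        euclNorm (dataMat T (fun t => z t ω) *ᵥ e)} ≤
      (2 * N + 1) ^ Fintype.card (Sym2 (ι ⊕ κ)) * Real.exp (-(T / 4)) := by
  obtain ⟨S, hSc, hS⟩ := exists_grid (Sym2 (ι ⊕ κ)) one_pos hN
  have h1 := measureReal_exists_mem_le (μ := μ) S
    (p := fun e ω => e ≠ 0 ∧ euclNorm (dataMat T (fun t => z t ω) *ᵥ e) <
      √T * (ση ^ 2 / specNormPlus Kp ^ 2) / 48 * euclNorm e) (c := Real.exp (-(T / 4)))
    (fun e _ => by
      by_cases he : e = 0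
      · simp [he, Real.exp_nonneg]
      · simp only [ne_eq, he, not_false_eq_true, true_and]
        exact measureReal_le_of_le_ofReal (Real.exp_pos _).le
          (h.measure_euclNorm_dataMat_lt_le hη hησ T he))
  refine le_trans (measureReal_mono fun ω hω => ?_) (h1.trans ?_)
  · by_contra hc
    simp only [Set.mem_ofPred_eq, not_exists, not_and, not_lt] at hc hω
    refine hω.2 fun e => ?_
    have h2 := le_euclNorm_mulVec_of_grid (dataMat T fun t => z t ω) hN hS
      (euclNorm_dataMat_mulVec_le T hω.1) (by positivity)
      (c := √T * (ση ^ 2 / specNormPlus Kp ^ 2) / 48) (by positivity) hd hFN hc e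
    refine le_trans (le_of_eq ?_) h2
    ring
  · refine mul_le_mul_of_nonneg_right ?_ (Real.exp_pos _).le
    exact_mod_cast hSc

/-- On the good event no truncation is active and the noise vector is `b (y + M)`, with `y` the
centred truncated noise and `M` its bias. The grid argument gives `4l` for `y`, and `‖M‖ ≤ 1 ≤ l`
adds one more `l`; with `b = 4 s r` and `s = σw σ r p` the product `5 l b` is `20 l r² σw σ p`. -/
lemma measureReal_noise_bad_le (h : IsDriven μ A B Kp σw ση m₀ z g) {τ ρ : ℝ}
    (hst : IsTauRhoStable τ ρ (A + B * Kp)) (hm₀ : 0 ≤ m₀) (hw : 0 < σw) {σ : ℝ} (hwσ : σw ≤ σ)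
    (hσ : τ ^ 2 * ρ ^ 4 * m₀ +
      specNorm (lyap (A + B * Kp) (σw ^ 2 • 1 + ση ^ 2 • (B * Bᵀ))) ≤ σ ^ 2)
    {P : Matrix ι ι ℝ} (hP : P.IsSymm) {p : ℝ} (hp : frobNorm P ≤ p) {T : ℕ} (hT : 0 < T)
    {bz : ℝ} (hbz : 0 ≤ bz) {N : ℕ} (hN : 0 < N) {l r c : ℝ} (hl : 1 ≤ l) (hr : 1 ≤ r)
    (hc : 0 < c) (hFN : T * bz * Fintype.card (Sym2 (ι ⊕ κ)) * (l / c) * (2 * T) ≤ N)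
    (hrT : T * (8 * Real.exp (-r / 2)) ≤ 1) :
    μ.real {ω | ((∀ t < T, euclNorm (Sum.elim (z (t + 1) ω).1 (z (t + 1) ω).2) ^ 2 ≤ bz) ∧
      (∀ e, c * euclNorm e ≤ euclNorm (dataMat T (fun t => z t ω) *ᵥ e))) ∧
      ¬ ∀ e, |(dataMat T (fun t => z t ω) *ᵥ e) ⬝ᵥ fun t : Fin T =>
        tdNoise P σw (A *ᵥ (z (t + 1) ω).1 + B *ᵥ (z (t + 1) ω).2) (z (t + 2) ω).1| ≤
          20 * l * r ^ 2 * (σw * σ) * p * euclNorm (dataMat T (fun t => z t ω) *ᵥ e)} ≤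
      T * (Fintype.card ι + 1) * (2 * Real.exp (1 - r)) +
        (2 * N + 1) ^ Fintype.card (Sym2 (ι ⊕ κ)) * Real.exp (-l ^ 2) := by
  have hσ0 : 0 < σ := hw.trans_le hwσ
  have hTr : (1 : ℝ) ≤ T := by exact_mod_cast hT
  have hp0 : 0 ≤ p := (frobNorm_nonneg P).trans hp
  -- If `p = 0` then `P = 0` and there is no noise; the truncation below needs a positive scale.
  rcases hp0.eq_or_lt with h0 | h0
  · have hPz : P = 0 := by
      have h1 : frobNorm P ^ 2 = 0 := by
        rw [le_antisymm (hp.trans h0.symm.le) (frobNorm_nonneg P)]; norm_num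
      rw [frobNorm_sq_eq_sum_euclNorm, Finset.sum_eq_zero_iff_of_nonneg fun _ _ => sq_nonneg _] at h1
      ext i j
      have h2 := euclNorm_eq_zero_iff.1 (pow_eq_zero_iff (two_ne_zero)|>.1 (h1 i (Finset.mem_univ i)))
      exact congrFun h2 j
    have hz : ∀ m x : ι → ℝ, tdNoise P σw m x = 0 := by
      intro m x
      simp [tdNoise, hPz]
    have h2 : (fun _ : Fin T => (0 : ℝ)) = 0 := rfl
    simp only [hz, ← h0, h2, dotProduct_zero, abs_zero, mul_zero, zero_mul, le_refl, implies_true,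
      not_true_eq_false, and_false, Set.ofPred_false, measureReal_empty]
    positivity
  set s := σw * σ * r * p with hs
  have hs0 : 0 < s := by positivity
  have hPs : σw ^ 2 * frobNorm P ≤ s := by
    have h1 : σw ^ 2 * frobNorm P ≤ σw ^ 2 * p := mul_le_mul_of_nonneg_left hp (sq_nonneg _)
    have h2 : σw ^ 2 * p ≤ σw * σ * p := by
      rw [sq]; exact mul_le_mul_of_nonneg_right (mul_le_mul_of_nonneg_left hwσ hw.le) hp0
    have h3 : σw * σ * p ≤ σw * σ * p * r := le_mul_of_one_le_right (by positivity) hr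
    rw [hs]; linarith
  set b := 4 * s * r with hb
  have hb0 : 0 < b := by positivity
  obtain ⟨S, hSc, hS⟩ := exists_grid (Sym2 (ι ⊕ κ)) (show 0 < l / c by positivity) hN
  -- Tail bounds for the rows of `P`, each relative to its own norm, combine to `‖P m‖ ≤ r σ ‖P‖_F`
  -- without a dimensional factor. The means are taken at times `q.1 + 1`, so `j = 2` is allowed.
  have h1 := measureReal_exists_mem_le (μ := μ) (Finset.range T ×ˢ (Finset.univ : Finset ι))
    (p := fun q ω => r * (σ * euclNorm (P q.2)) < |P q.2 ⬝ᵥ meanFun A B (z (q.1 + 1) ω)|)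
    (fun q _ => h.measureReal_abs_mean_gt_le hst hm₀ (j := 2) (by omega) hσ0 hσ _ r)
  have h2 := measureReal_exists_mem_le (μ := μ) (Finset.range T)
    (p := fun t ω => σw * euclNorm (P *ᵥ meanFun A B (z (t + 1) ω)) ≤ s ∧
      4 * s * r < |noiseFun A B σw P (z (t + 1) ω) (g (t + 1) ω)|)
    (fun t _ => measureReal_le_of_le_ofReal (by positivity)
      (h.measure_noise_gt_le hP hw.le hs0 hPs (t + 1) r))
  have h3 := measureReal_exists_mem_le (μ := μ) S
    (p := fun e ω => l ^ 2 + euclNorm (dataMat T (fun t => z t ω) *ᵥ e) ^ 2 / 2 <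
      (dataMat T (fun t => z t ω) *ᵥ e) ⬝ᵥ
        fun t : Fin T => centredNoise A B σw P s b (z (t + 1) ω) (g (t + 1) ω))
    (fun e _ => measureReal_le_of_le_ofReal (Real.exp_pos _).le
      (h.measure_dotProduct_centredNoise_gt_le P s hb0 T e l))
  simp only [Finset.card_product, Finset.card_range, Finset.card_univ, Nat.cast_mul] at h1 h2
  have h3' := h3.trans (mul_le_mul_of_nonneg_right (show (S.card : ℝ) ≤
    (2 * N + 1) ^ Fintype.card (Sym2 (ι ⊕ κ)) by exact_mod_cast hSc) (Real.exp_pos _).le)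
  have h4 : T * ((Fintype.card ι : ℝ) + 1) * (2 * Real.exp (1 - r)) =
      T * Fintype.card ι * (2 * Real.exp (1 - r)) + T * (2 * Real.exp (1 - r)) := by ring
  rw [h4]
  refine le_trans ?_ (add_le_add (add_le_add h1 h2) h3')
  refine le_trans (measureReal_mono fun ω hω => ?_) ((measureReal_union_le _ _).trans
    (add_le_add_left (measureReal_union_le _ _) _))
  by_contra hcon
  simp only [Set.mem_union, Set.mem_ofPred_eq, not_or, not_exists, not_and, not_lt,
    Finset.mem_product, Finset.mem_range, Finset.mem_univ, and_true, Prod.forall] at hcon hω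
  obtain ⟨⟨hc1, hc2⟩, hc3⟩ := hcon
  obtain ⟨⟨hz, hlow⟩, hbad⟩ := hω
  refine hbad fun e => ?_
  set Φ := dataMat T fun t => z t ω with hΦ
  have hmean : ∀ t < T, σw * euclNorm (P *ᵥ meanFun A B (z (t + 1) ω)) ≤ s := by
    intro t ht
    have h5 : euclNorm (P *ᵥ meanFun A B (z (t + 1) ω)) ≤ r * σ * frobNorm P := by
      refine le_of_sq_le_sq ?_ (by have := frobNorm_nonneg P; positivity)
      rw [euclNorm_sq, mul_pow, frobNorm_sq_eq_sum_euclNorm, Finset.mul_sum]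
      refine Finset.sum_le_sum fun i _ => ?_
      have h6 := hc1 t i ht
      rw [← sq_abs, ← mul_pow]
      refine pow_le_pow_left₀ (abs_nonneg _) (h6.trans (le_of_eq (by ring))) 2
    calc σw * euclNorm (P *ᵥ meanFun A B (z (t + 1) ω)) ≤ σw * (r * σ * p) :=
          mul_le_mul_of_nonneg_left (h5.trans (mul_le_mul_of_nonneg_left hp (by positivity))) hw.le
      _ = s := by rw [hs]; ring
  set y : Fin T → ℝ := fun t => centredNoise A B σw P s b (z (t + 1) ω) (g (t + 1) ω) with hy
  set M : Fin T → ℝ := fun t =>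
    ∫ y, truncNoise A B σw P s b (z (t + 1) ω) y ∂stdGauss (ι ⊕ κ) with hM
  have hζ : (fun t : Fin T =>
      tdNoise P σw (A *ᵥ (z (t + 1) ω).1 + B *ᵥ (z (t + 1) ω).2) (z (t + 2) ω).1) =
      b • (y + M) := by
    ext t
    have h5 : (z (t + 2) ω).1 = meanFun A B (z (t + 1) ω) + σw • (g (t + 1) ω ∘ Sum.inl) := by
      rw [h.step]; rfl
    have h6 : (y + M) t = truncNoise A B σw P s b (z (t + 1) ω) (g (t + 1) ω) := by
      simp [hy, hM, centredNoise]
    rw [Pi.smul_apply, h6, truncNoise, if_pos (hmean t t.2), if_pos (hc2 t t.2 (hmean t t.2)), h5,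
      smul_eq_mul, mul_div_cancel₀ _ hb0.ne']
    rfl
  have hMb : ∀ t, |M t| ≤ 8 * Real.exp (-r / 2) := fun t =>
    abs_integral_truncNoise_le hP hw.le hs0 hr hPs _
  have hMn : euclNorm M ≤ 1 := by
    refine (euclNorm_le_card_mul hMb).trans ?_
    rwa [Fintype.card_fin]
  have hM1 : ∀ t, |M t| ≤ 1 := fun t => (abs_apply_le_euclNorm M t).trans hMn
  have hyn : euclNorm y ≤ 2 * T := by
    have h5 := euclNorm_le_card_mul (v := y) (ε := 2) fun t => by
      have h6 := abs_truncNoise_le (A := A) (B := B) (σw := σw) P s hb0 (z (t + 1) ω) (g (t + 1) ω)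
      have h7 := abs_sub (truncNoise A B σw P s b (z (t + 1) ω) (g (t + 1) ω)) (M t)
      have h8 := hM1 t
      exact h7.trans (by linarith)
    rw [Fintype.card_fin] at h5
    linarith
  have h5 := abs_dotProduct_le_of_grid Φ hN hc hl hS (euclNorm_dataMat_mulVec_le T hz)
    (by positivity) hlow hyn (by linarith) hFN hc3 e
  have h6 : |(Φ *ᵥ e) ⬝ᵥ M| ≤ l * euclNorm (Φ *ᵥ e) := by
    refine (abs_dotProduct_le _ _).trans ?_
    rw [mul_comm]
    exact mul_le_mul_of_nonneg_right (hMn.trans hl) (euclNorm_nonneg _)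
  rw [hζ, dotProduct_smul, dotProduct_add, smul_eq_mul, abs_mul, abs_of_pos hb0]
  calc b * |(Φ *ᵥ e) ⬝ᵥ y + (Φ *ᵥ e) ⬝ᵥ M| ≤
        b * (4 * l * euclNorm (Φ *ᵥ e) + l * euclNorm (Φ *ᵥ e)) :=
        mul_le_mul_of_nonneg_left ((abs_add_le _ _).trans (add_le_add h5 h6)) hb0.le
    _ = _ := by rw [hb, hs]; ring

/-- The LSTDQ estimate of a driven system, with explicit parameters. -/
lemma measureReal_lstdq_bad_le (h : IsDriven μ A B Kp σw ση m₀ z g) {K : Matrix κ ι ℝ} {τ ρ : ℝ}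
    (hK : IsTauRhoStable τ ρ (A + B * K))
    (hst : IsTauRhoStable τ ρ (A + B * Kp)) (hm₀ : 0 ≤ m₀) (hη : 0 < ση) (hησ : ση ≤ σw)
    {σ σ' : ℝ} (hwσ : σw ≤ σ)
    (hσ : τ ^ 2 * ρ ^ 4 * m₀ +
      specNorm (lyap (A + B * Kp) (σw ^ 2 • 1 + ση ^ 2 • (B * Bᵀ))) ≤ σ ^ 2) (hσ'0 : 0 < σ')
    (hσ' : τ ^ 2 * m₀ + specNorm (lyap (A + B * Kp) (σw ^ 2 • 1 + ση ^ 2 • (B * Bᵀ))) ≤ σ' ^ 2)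
    {T : ℕ} (hT : 0 < T) {N : ℕ} {l r c bz : ℝ} (hl : 1 ≤ l) (hr : 1 ≤ r)
    (hbz : bz = (specNormPlus Kp * Fintype.card (ι ⊕ κ) * (r * (σ' + 2 * σw))) ^ 2)
    (hc : c = √T * (ση ^ 2 / specNormPlus Kp ^ 2) / 192) (hN0 : 0 < N)
    (hd : 2 * (Fintype.card (Sym2 (ι ⊕ κ)) : ℝ) ≤ N)
    (hFN : T * bz * Fintype.card (Sym2 (ι ⊕ κ)) * (l / c) * (2 * T) ≤ N)
    (hrT : T * (8 * Real.exp (-r / 2)) ≤ 1)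
    (hcond : 2 * (20 * l * r ^ 2 * (σw * σ) * Fintype.card ι * specNormPlus K ^ 2 *
      invBound A B K τ ρ) ≤ c)
    {Q : Matrix (ι ⊕ κ) (ι ⊕ κ) ℝ} (hQ : Q.IsSymm) {cost : Ω → ℕ → ℝ}
    (hcost : ∀ ω, (fun t : Fin T => cost ω (t + 1)) = dataMat T (fun t => z t ω) *ᵥ
      (svec Q - svec ((closedLoop A B K)ᵀ * Q * closedLoop A B K))) :
    μ.real {ω | ¬ (IsUnit (lstdqMat T K σw (fun t => (z t ω).1) (fun t => (z t ω).2)).det ∧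
      euclNorm (lstdq T K σw (fun t => (z t ω).1) (fun t => (z t ω).2) (cost ω) - svec Q) ≤
        2 * invBound A B K τ ρ / c *
          (20 * l * r ^ 2 * (σw * σ) * (specNormPlus K ^ 2 * frobNorm Q)))} ≤
      (T * Fintype.card ι + T * Fintype.card (ι ⊕ κ)) * (2 * Real.exp (1 - r)) +
      (2 * N + 1) ^ Fintype.card (Sym2 (ι ⊕ κ)) * Real.exp (-(T / 4)) +
      ((Fintype.card ι : ℝ) ^ 2 + 1) * (T * (Fintype.card ι + 1) * (2 * Real.exp (1 - r)) +
        (2 * N + 1) ^ Fintype.card (Sym2 (ι ⊕ κ)) * Real.exp (-l ^ 2)) := by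
  have hw : 0 < σw := hη.trans_le hησ
  have hP : 0 < specNormPlus Kp := lt_of_lt_of_le one_pos (one_le_specNormPlus _)
  have hTr : (1 : ℝ) ≤ T := by exact_mod_cast hT
  have hc0 : 0 < c := by
    rw [hc]
    have : 0 < √(T : ℝ) := Real.sqrt_pos.2 (by linarith)
    positivity
  have hbz0 : 0 ≤ bz := by rw [hbz]; positivity
  have h1 := h.measureReal_state_bad_le hst hm₀ hη hησ hσ'0 hσ' T (r := r) (by linarith)
  rw [← hbz] at h1
  have h2 := h.measureReal_lower_bad_le hη hησ T hbz0 hN0 hd (by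
    have h3 : √T * (ση ^ 2 / specNormPlus Kp ^ 2) / 48 = 4 * c := by rw [hc]; ring
    rw [h3]
    have h4 : T * bz * Fintype.card (Sym2 (ι ⊕ κ)) * 1 * 1 ≤ c * N := by
      have h5 := mul_le_mul_of_nonneg_left hFN hc0.le
      refine le_trans ?_ h5
      have h6 : c * (T * bz * Fintype.card (Sym2 (ι ⊕ κ)) * (l / c) * (2 * T)) =
          T * bz * Fintype.card (Sym2 (ι ⊕ κ)) * l * (2 * T) := by field_simp
      rw [h6]
      gcongr
      linarith
    linarith)
  rw [← hc] at h2
  -- The basis matrices cover the data-dependent matrices. The fixed matrix `policyForm K Q` gets an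
  -- event of its own in `h4`, which keeps the factor `card ι` out of the error bound.
  have h3 := measureReal_exists_mem_le (μ := μ) (Finset.univ : Finset (ι × ι)) fun q _ =>
    h.measureReal_noise_bad_le hst hm₀ hw hwσ hσ (isSymm_symSingle q.1 q.2)
      (frobNorm_symSingle_le q.1 q.2) hT hbz0 hN0 hl hr hc0 hFN hrT
  have h4 := h.measureReal_noise_bad_le hst hm₀ hw hwσ hσ (isSymm_policyForm (K := K) hQ)
      (frobNorm_policyForm_le K Q) hT hbz0 hN0 hl hr hc0 hFN hrT
  rw [Finset.card_univ, Fintype.card_prod, Nat.cast_mul, ← sq] at h3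
  rw [add_mul _ (1 : ℝ), one_mul]
  refine le_trans ?_ (add_le_add (add_le_add h1 h2) (add_le_add h3 h4))
  refine le_trans (measureReal_mono fun ω hω => ?_) ((measureReal_union_le _ _).trans
    (add_le_add (measureReal_union_le _ _) (measureReal_union_le _ _)))
  by_contra hcon
  simp only [Set.mem_union, Set.mem_ofPred_eq, not_or] at hcon hω
  obtain ⟨⟨hc1, hc2⟩, hc3, hc4⟩ := hcon
  have hz := not_not.1 hc1
  have hlow := not_not.1 fun hh => hc2 ⟨hz, hh⟩
  have hq := not_not.1 fun hh => hc4 ⟨⟨hz, hlow⟩, hh⟩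
  have hij : ∀ q : ι × ι, _ := fun q =>
    not_not.1 fun hh => hc3 ⟨q, Finset.mem_univ _, ⟨hz, hlow⟩, hh⟩
  have h5 := lstdq_error_le T (σw := σw) (x := fun t => (z t ω).1) (u := fun t => (z t ω).2) hK hc0
    hlow (β := 20 * l * r ^ 2 * (σw * σ)) (fun i j e => by
      have := hij (i, j) e
      rwa [mul_one] at this) hcond
  refine hω ⟨h5.1, ?_⟩
  have h6 : smat (svec Q) = Q := smat_svec hQ
  refine h5.2 (svec Q) (cost ω) _ (by
    have := frobNorm_nonneg Q
    have hσ0 : 0 < σ := hw.trans_le hwσ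
    positivity) ?_ ?_
  · rw [h6]; exact hq
  · rw [h6]; exact hcost ω

end IsDriven

end HighProbability

end

end CoopLQR

namespace CoopLQR

noncomputable section

set_option linter.unusedSectionVars false

open scoped ENNReal

/-! ### Gaussian laws -/

section Laws

variable {Ω : Type*} [MeasurableSpace Ω] {μ : Measure Ω} [IsProbabilityMeasure μ]
  {m n : Type*} [Fintype m] [Fintype n]

lemma hasLaw_stdGauss_of_multivariateGaussian [DecidableEq n] {X : Ω → n → ℝ} {σ : ℝ} (hσ : 0 < σ)
    (h : HasLaw (fun ω => WithLp.toLp 2 (X ω)) (multivariateGaussian 0 (σ ^ 2 • 1)) μ) :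
    HasLaw (fun ω => σ⁻¹ • X ω) (stdGauss n) μ := by
  have h1 : multivariateGaussian 0 (σ ^ 2 • (1 : Matrix n n ℝ)) =
      (stdGaussian (EuclideanSpace ℝ n)).map (σ • ·) := by
    apply Measure.ext_of_charFun
    ext t
    rw [charFun_multivariateGaussian (Matrix.PosSemidef.one.smul (sq_nonneg σ)), charFun_map_smul,
      charFun_stdGaussian]
    congr 1
    have h2 : t.ofLp ⬝ᵥ t.ofLp = ‖t‖ ^ 2 := by
      rw [EuclideanSpace.norm_sq_eq, dotProduct]
      exact Finset.sum_congr rfl fun i _ => by rw [Real.norm_eq_abs, sq_abs, sq]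
    rw [smul_mulVec, one_mulVec, dotProduct_smul, h2, norm_smul, Real.norm_eq_abs, abs_of_pos hσ]
    simp
    ring
  have hm : AEMeasurable X μ := by
    have := (WithLp.measurable_ofLp 2 (n → ℝ)).comp_aemeasurable h.aemeasurable
    exact this
  refine ⟨hm.fun_const_smul _, ?_⟩
  have h3 : (fun ω => σ⁻¹ • X ω) = (fun y : EuclideanSpace ℝ n => σ⁻¹ • WithLp.ofLp y) ∘
      fun ω => WithLp.toLp 2 (X ω) := rfl
  have hm1 : Measurable fun y : EuclideanSpace ℝ n => σ⁻¹ • WithLp.ofLp y :=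
    (WithLp.measurable_ofLp 2 (n → ℝ)).const_smul σ⁻¹
  have hm2 : Measurable fun y : EuclideanSpace ℝ n => σ • y := measurable_const_smul σ
  rw [h3, ← AEMeasurable.map_map_of_aemeasurable hm1.aemeasurable h.aemeasurable, h.map_eq, h1,
    Measure.map_map hm1 hm2, ← map_pi_eq_stdGaussian,
    Measure.map_map (hm1.comp hm2) (WithLp.measurable_toLp 2 (n → ℝ))]
  have h4 : ((fun y : EuclideanSpace ℝ n => σ⁻¹ • WithLp.ofLp y) ∘ fun y => σ • y) ∘ WithLp.toLp 2 =
      id := by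
    ext y i
    simp [hσ.ne']
  rw [h4, Measure.map_id]
  rfl

lemma hasLaw_stdGauss_comp {X : Ω → n → ℝ} (h : HasLaw X (stdGauss n) μ) {f : m → n}
    (hf : Function.Injective f) : HasLaw (fun ω => X ω ∘ f) (stdGauss m) μ := by
  have h1 : iIndepFun (fun i (y : n → ℝ) => y i) (stdGauss n) := by
    rw [iIndepFun_iff_map_fun_eq_pi_map fun i => (measurable_pi_apply i).aemeasurable]
    have h2 : ∀ i, (stdGauss n).map (fun y : n → ℝ => y i) = gaussianReal 0 1 := fun i =>
      (measurePreserving_eval (fun _ : n => gaussianReal 0 1) i).map_eq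
    simp_rw [h2]
    exact Measure.map_id
  have h2 := h1.precomp hf
  rw [iIndepFun_iff_map_fun_eq_pi_map fun i => (measurable_pi_apply _).aemeasurable] at h2
  have h3 : ∀ i, (stdGauss n).map (fun y : n → ℝ => y (f i)) = gaussianReal 0 1 := fun i =>
    (measurePreserving_eval (fun _ : n => gaussianReal 0 1) (f i)).map_eq
  simp_rw [h3] at h2
  have h4 : MeasurePreserving (fun (y : n → ℝ) => y ∘ f) (stdGauss n) (stdGauss m) :=
    ⟨measurable_pi_lambda _ fun i => measurable_pi_apply _, h2⟩
  exact h4.fun_comp_hasLaw h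

lemma hasLaw_stdGauss_sumElim {X : Ω → m → ℝ} {Y : Ω → n → ℝ} (hX : HasLaw X (stdGauss m) μ)
    (hY : HasLaw Y (stdGauss n) μ) (hXY : IndepFun X Y μ) :
    HasLaw (fun ω => Sum.elim (X ω) (Y ω)) (stdGauss (m ⊕ n)) μ := by
  have h1 := measurePreserving_sumPiEquivProdPi_symm (fun _ : m ⊕ n => gaussianReal 0 1)
  have h2 : HasLaw (fun ω => (X ω, Y ω)) ((stdGauss m).prod (stdGauss n)) μ :=
    ⟨hX.aemeasurable.prodMk hY.aemeasurable, by
      rw [hXY.map_prod_eq_prod_map_map hX.aemeasurable hY.aemeasurable, hX.map_eq, hY.map_eq]⟩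
  have h3 := h1.fun_comp_hasLaw h2
  have h4 : (fun ω => Sum.elim (X ω) (Y ω)) =
      fun ω => (MeasurableEquiv.sumPiEquivProdPi fun _ : m ⊕ n => ℝ).symm (X ω, Y ω) := by
    ext ω i
    cases i <;> rfl
  rw [h4]
  exact h3

lemma lintegral_exp_dotProduct_of_hasLaw {X : Ω → n → ℝ} (h : HasLaw X (stdGauss n) μ)
    (b : n → ℝ) : ∫⁻ ω, ENNReal.ofReal (Real.exp (b ⬝ᵥ X ω)) ∂μ =
      ENNReal.ofReal (Real.exp (euclNorm b ^ 2 / 2)) := by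
  rw [← lintegral_exp_dotProduct_stdGauss b, ← h.map_eq, lintegral_map'
    (Measurable.aemeasurable (by simp only [dotProduct]; fun_prop)) h.aemeasurable]

/-- A linear functional of a Gaussian vector is a real Gaussian variable, even for singular `S`; the
value is its moment generating function at `1`. -/
lemma lintegral_exp_dotProduct_of_multivariateGaussian [DecidableEq n] {X : Ω → n → ℝ}
    {x₀ : n → ℝ} {S : Matrix n n ℝ} (hS : S.PosSemidef)
    (h : HasLaw (fun ω => WithLp.toLp 2 (X ω)) (multivariateGaussian (WithLp.toLp 2 x₀) S) μ)
    (a : n → ℝ) :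
    ∫⁻ ω, ENNReal.ofReal (Real.exp (a ⬝ᵥ X ω)) ∂μ =
      ENNReal.ofReal (Real.exp (a ⬝ᵥ x₀ + a ⬝ᵥ S *ᵥ a / 2)) := by
  set γ := multivariateGaussian (WithLp.toLp 2 x₀) S with hγ
  set L : StrongDual ℝ (EuclideanSpace ℝ n) := innerSL ℝ (WithLp.toLp 2 a) with hL
  have hLv : ∀ y : n → ℝ, L (WithLp.toLp 2 y) = a ⬝ᵥ y := by
    intro y
    simp [hL, PiLp.inner_apply, dotProduct, mul_comm]
  have hmean : ∫ y, L y ∂γ = a ⬝ᵥ x₀ := by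
    rw [L.integral_comp_id_comm IsGaussian.integrable_id, hγ, integral_id_multivariateGaussian, hLv]
  have hvar : Var[L; γ] = a ⬝ᵥ S *ᵥ a := by
    have h1 := covarianceBilin_self (μ := γ) IsGaussian.memLp_two_id (WithLp.toLp 2 a)
    rw [hγ, covarianceBilin_multivariateGaussian hS] at h1
    exact h1.symm
  have h1 : γ.map L = gaussianReal (a ⬝ᵥ x₀) (a ⬝ᵥ S *ᵥ a).toNNReal := by
    rw [IsGaussian.map_eq_gaussianReal, hmean, hvar]
  have hnn : 0 ≤ a ⬝ᵥ S *ᵥ a := by simpa using hS.dotProduct_mulVec_nonneg a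
  calc ∫⁻ ω, ENNReal.ofReal (Real.exp (a ⬝ᵥ X ω)) ∂μ =
        ∫⁻ ω, ENNReal.ofReal (Real.exp (L (WithLp.toLp 2 (X ω)))) ∂μ := by simp_rw [hLv]
    _ = ∫⁻ y, ENNReal.ofReal (Real.exp (L y)) ∂γ := by
        rw [← h.map_eq, lintegral_map' (by fun_prop) h.aemeasurable]
    _ = ∫⁻ r, ENNReal.ofReal (Real.exp r) ∂γ.map L := by
        rw [lintegral_map (by fun_prop) (by fun_prop)]
    _ = _ := by
        have h2 := congrFun (mgf_id_gaussianReal (μ := a ⬝ᵥ x₀) (v := (a ⬝ᵥ S *ᵥ a).toNNReal)) 1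
        have h3 := integrable_exp_mul_gaussianReal (μ := a ⬝ᵥ x₀) (v := (a ⬝ᵥ S *ᵥ a).toNNReal) 1
        simp only [mgf, id, one_mul, mul_one, one_pow, Real.coe_toNNReal _ hnn] at h2 h3
        rw [h1, ← ofReal_integral_eq_lintegral_ofReal h3
          (ae_of_all _ fun _ => (Real.exp_pos _).le), h2]

/-- If `Y` is independent of `Z` and `X` is independent of the pair, then the pair `(X, Y)` is
independent of `Z`. -/
lemma indepFun_prodMk_of_prodMk {α β γ : Type*} [MeasurableSpace α] [MeasurableSpace β]
    [MeasurableSpace γ] {X : Ω → α} {Y : Ω → β} {Z : Ω → γ} (hX : AEMeasurable X μ)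
    (hY : AEMeasurable Y μ) (hZ : AEMeasurable Z μ) (h : IndepFun X (fun ω => (Y ω, Z ω)) μ)
    (hYZ : IndepFun Y Z μ) : IndepFun (fun ω => (X ω, Y ω)) Z μ := by
  have hXY : IndepFun X Y μ := h.comp measurable_id measurable_fst
  have _ := Measure.isProbabilityMeasure_map hX (μ := μ)
  have _ := Measure.isProbabilityMeasure_map hY (μ := μ)
  have _ := Measure.isProbabilityMeasure_map hZ (μ := μ)
  rw [indepFun_iff_map_prod_eq_prod_map_map (hX.prodMk hY) hZ,
    hXY.map_prod_eq_prod_map_map hX hY]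
  have h1 := h.map_prod_eq_prod_map_map hX (hY.prodMk hZ)
  rw [hYZ.map_prod_eq_prod_map_map hY hZ, ← Measure.prodAssoc_prod] at h1
  have h2 := congrArg (Measure.map MeasurableEquiv.prodAssoc.symm) h1
  rw [MeasurableEquiv.map_symm_map,
    AEMeasurable.map_map_of_aemeasurable (MeasurableEquiv.measurable _).aemeasurable
      (hX.prodMk (hY.prodMk hZ))] at h2
  exact h2

end Laws

/-! ### The data of a sub-system -/

namespace System

variable {N nx nu : ℕ} (M : System N nx nu)

variable {Ω : Type*} [MeasurableSpace Ω] {μ : Measure Ω} [IsProbabilityMeasure μ]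
  {Kplay : Matrix (Fin N × Fin nu) (Fin N × Fin nx) ℝ} {σw ση : ℝ}
  {x₀ : Fin N × Fin nx → ℝ} {Sigma₀ : Matrix (Fin N × Fin nx) (Fin N × Fin nx) ℝ}
  {x w : ℕ → Ω → Fin N × Fin nx → ℝ} {u η : ℕ → Ω → Fin N × Fin nu → ℝ}

lemma measurable_subVec {n : ℕ} (s : Finset (Fin N)) :
    Measurable (subVec s : (Fin N × Fin n → ℝ) → Idx s n → ℝ) :=
  measurable_pi_lambda _ fun _ => measurable_pi_apply _

lemma subVec_eq_mulVec {n : ℕ} (s : Finset (Fin N)) (v : Fin N × Fin n → ℝ) :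
    subVec s v = (1 : Matrix (Fin N × Fin n) (Fin N × Fin n) ℝ).submatrix
      (fun p : Idx s n => (p.1.1, p.2)) id *ᵥ v := by
  ext p
  simp [subVec, mulVec, dotProduct, Matrix.one_apply]

lemma subMat_eq_mul {n : ℕ} (s : Finset (Fin N)) (X : Matrix (Fin N × Fin n) (Fin N × Fin n) ℝ) :
    subMat s X = (1 : Matrix (Fin N × Fin n) (Fin N × Fin n) ℝ).submatrix
      (fun p : Idx s n => (p.1.1, p.2)) id * X * ((1 : Matrix (Fin N × Fin n) (Fin N × Fin n)
        ℝ).submatrix (fun p : Idx s n => (p.1.1, p.2)) id)ᵀ := by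
  ext p q
  simp [subMat, Matrix.mul_apply, Matrix.one_apply]

lemma specNorm_subMat_le {n : ℕ} (s : Finset (Fin N))
    (X : Matrix (Fin N × Fin n) (Fin N × Fin n) ℝ) : specNorm (subMat s X) ≤ specNorm X := by
  set E := (1 : Matrix (Fin N × Fin n) (Fin N × Fin n) ℝ).submatrix
      (fun p : Idx s n => (p.1.1, p.2)) id with hE
  have h1 : specNorm E ≤ 1 := specNorm_le_of_forall zero_le_one fun v => by
    rw [hE, ← subVec_eq_mulVec, one_mul]
    refine euclNorm_comp_le ?_ v
    rintro ⟨⟨a, ha⟩, b⟩ ⟨⟨c, hc⟩, d⟩ h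
    simp only [Prod.mk.injEq] at h
    obtain ⟨rfl, rfl⟩ := h
    rfl
  have h0 := specNorm_nonneg E
  have hX := specNorm_nonneg X
  rw [subMat_eq_mul, ← hE]
  refine (specNorm_mul_le _ _).trans ?_
  rw [specNorm_transpose]
  have h2 := specNorm_mul_le E X
  calc specNorm (E * X) * specNorm E ≤ specNorm E * specNorm X * specNorm E :=
        mul_le_mul_of_nonneg_right h2 h0
    _ ≤ 1 * specNorm X * 1 := by gcongr
    _ = specNorm X := by ring

namespace IsRollout

variable {M}

lemma aemeasurable_w (h : M.IsRollout μ Kplay σw ση x₀ Sigma₀ x w u η) (t : ℕ) :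
    AEMeasurable (w t) μ :=
  (WithLp.measurable_ofLp 2 (Fin N × Fin nx → ℝ)).comp_aemeasurable (h.law_w t).aemeasurable

lemma aemeasurable_η (h : M.IsRollout μ Kplay σw ση x₀ Sigma₀ x w u η) (t : ℕ) :
    AEMeasurable (η t) μ :=
  (WithLp.measurable_ofLp 2 (Fin N × Fin nu → ℝ)).comp_aemeasurable (h.law_η t).aemeasurable

lemma aemeasurable_init (h : M.IsRollout μ Kplay σw ση x₀ Sigma₀ x w u η) :
    AEMeasurable (x 0) μ :=
  (WithLp.measurable_ofLp 2 (Fin N × Fin nx → ℝ)).comp_aemeasurable h.law_init.aemeasurable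

/-- The state at time `0`, the state noise before time `t` and the control noise up to time `t` are
independent of the noise `(w(t), η(t+1))`. -/
lemma indepFun_history (h : M.IsRollout μ Kplay σw ση x₀ Sigma₀ x w u η) (t : ℕ) :
    IndepFun (fun ω => (x 0 ω, ((fun s : Finset.range t => (w s ω, η s ω)), η t ω)))
      (fun ω => (w t ω, η (t + 1) ω)) μ := by
  have hm : ∀ t, AEMeasurable (fun ω => (w t ω, η t ω)) μ := fun t =>
    (h.aemeasurable_w t).prodMk (h.aemeasurable_η t)
  -- Step `t` is driven by `(w(t), η(t+1))`, while `η(t)` already belongs to the control at time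
  -- `t`. Independence across times therefore has to be recombined with the independence of `w(t)`
  -- and `η(t)`.
  set X₁ : Ω → (Finset.range t → (Fin N × Fin nx → ℝ) × (Fin N × Fin nu → ℝ)) :=
    fun ω s => (w s ω, η s ω) with hX₁
  have hX₁m : AEMeasurable X₁ μ := aemeasurable_pi_lambda _ fun s => hm s
  have h1 : IndepFun X₁ (fun ω => (η t ω, w t ω)) μ := by
    have h2 := h.indep_time.indepFun_finset₀ (Finset.range t) {t} (by simp) hm
    have hφ : Measurable fun y : ({t} : Finset ℕ) → (Fin N × Fin nx → ℝ) × (Fin N × Fin nu → ℝ) =>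
        ((y ⟨t, Finset.mem_singleton_self t⟩).2, (y ⟨t, Finset.mem_singleton_self t⟩).1) := by
      fun_prop
    exact h2.comp measurable_id hφ
  have h2 : IndepFun (fun ω => (X₁ ω, η t ω)) (w t) μ :=
    indepFun_prodMk_of_prodMk hX₁m (h.aemeasurable_η t) (h.aemeasurable_w t) h1
      (h.indep_w_η t).symm
  have h3 : IndepFun (η (t + 1)) (fun ω => (w t ω, (X₁ ω, η t ω))) μ := by
    have h4 := h.indep_time.indepFun_finset₀ {t + 1} (Finset.range (t + 1)) (by simp) hm
    have hφ : Measurable fun y : ({t + 1} : Finset ℕ) →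
        (Fin N × Fin nx → ℝ) × (Fin N × Fin nu → ℝ) =>
        (y ⟨t + 1, Finset.mem_singleton_self (t + 1)⟩).2 := by fun_prop
    have hψ : Measurable fun y : Finset.range (t + 1) →
        (Fin N × Fin nx → ℝ) × (Fin N × Fin nu → ℝ) =>
        ((y ⟨t, Finset.self_mem_range_succ t⟩).1,
          ((fun s : Finset.range t => y ⟨s, Finset.mem_range.2
            ((Finset.mem_range.1 s.2).trans t.lt_succ_self)⟩),
            (y ⟨t, Finset.self_mem_range_succ t⟩).2)) := by fun_prop
    exact h4.comp hφ hψ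
  have h5 : IndepFun (fun ω => (η (t + 1) ω, w t ω)) (fun ω => (X₁ ω, η t ω)) μ :=
    indepFun_prodMk_of_prodMk (h.aemeasurable_η _) (h.aemeasurable_w t)
      (hX₁m.prodMk (h.aemeasurable_η t)) h3 h2.symm
  have h6 : IndepFun (fun ω => (X₁ ω, η t ω)) (fun ω => (w t ω, η (t + 1) ω)) μ :=
    (h5.comp (φ := Prod.swap) (ψ := id) measurable_swap measurable_id).symm
  refine indepFun_prodMk_of_prodMk h.aemeasurable_init (hX₁m.prodMk (h.aemeasurable_η t))
    ((h.aemeasurable_w t).prodMk (h.aemeasurable_η _)) ?_ h6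
  have hφ : Measurable fun y : ℕ → (Fin N × Fin nx → ℝ) × (Fin N × Fin nu → ℝ) =>
      (((fun s : Finset.range t => y s), (y t).2), ((y t).1, (y (t + 1)).2)) := by fun_prop
  exact h.indep_init.comp measurable_id hφ

/-- The mean is absorbed through `b·x₀ ≤ 1/2 + (b·x₀)²/2`. This is why the second moment replaces
the covariance and why `1/2` appears in `init_mgf`. -/
lemma lintegral_exp_init_le (h : M.IsRollout μ Kplay σw ση x₀ Sigma₀ x w u η)
    (hS0 : Sigma₀.PosSemidef) (s : Finset (Fin N)) (a : Idx s nx → ℝ) :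
    ∫⁻ ω, ENNReal.ofReal (Real.exp (a ⬝ᵥ subVec s (x 0 ω))) ∂μ ≤ ENNReal.ofReal (Real.exp
      (1 / 2 + specNorm (subMat s (initMoment x₀ Sigma₀)) * euclNorm a ^ 2 / 2)) := by
  set E := (1 : Matrix (Fin N × Fin nx) (Fin N × Fin nx) ℝ).submatrix
      (fun p : Idx s nx => (p.1.1, p.2)) id with hE
  have h1 : ∀ v, a ⬝ᵥ subVec s v = (Eᵀ *ᵥ a) ⬝ᵥ v := fun v => by
    rw [subVec_eq_mulVec, dotProduct_mulVec, ← mulVec_transpose]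
  simp_rw [h1]
  rw [lintegral_exp_dotProduct_of_multivariateGaussian hS0 h.law_init]
  refine ENNReal.ofReal_le_ofReal (Real.exp_le_exp.2 ?_)
  set b := Eᵀ *ᵥ a with hb
  have h2 : a ⬝ᵥ subMat s (initMoment x₀ Sigma₀) *ᵥ a = b ⬝ᵥ Sigma₀ *ᵥ b + (b ⬝ᵥ x₀) ^ 2 := by
    rw [subMat_eq_mul, ← hE, ← mulVec_mulVec, ← mulVec_mulVec, dotProduct_mulVec, ← mulVec_transpose,
      ← hb, initMoment, add_mulVec, dotProduct_add, vecMulVec_mulVec, dotProduct_smul]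
    simp [sq, dotProduct_comm]
  have h3 := dotProduct_mulVec_le (subMat s (initMoment x₀ Sigma₀)) a
  nlinarith [sq_nonneg (b ⬝ᵥ x₀ - 1)]

/-- The data of the agents in `I_Q^j` form a system driven by standard Gaussian noise. -/
lemma isDriven (h : M.IsRollout μ Kplay σw ση x₀ Sigma₀ x w u η) (hK : M.IsStructuredGain Kplay)
    (hS0 : Sigma₀.PosSemidef) (hη : 0 < ση) (hw : 0 < σw) (j : Fin N) :
    IsDriven μ (subMat (M.IQ j) M.A) (subMat (M.IQ j) M.B) (subMat (M.IQ j) Kplay) σw ση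
      (specNorm (subMat (M.IQ j) (initMoment x₀ Sigma₀)))
      (fun t ω => (subVec (M.IQ j) (x t ω), subVec (M.IQ j) (u t ω)))
      (fun t ω => Sum.elim (σw⁻¹ • subVec (M.IQ j) (w t ω))
        (ση⁻¹ • subVec (M.IQ j) (η (t + 1) ω))) := by
  have hinj : ∀ n : ℕ, Function.Injective
      fun p : Idx (M.IQ j) n => ((p.1.1, p.2) : Fin N × Fin n) := by
    rintro n ⟨⟨a, ha⟩, b⟩ ⟨⟨c, hc⟩, d⟩ h
    simp only [Prod.mk.injEq] at h
    obtain ⟨rfl, rfl⟩ := h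
    rfl
  have hu : ∀ t ω, subVec (M.IQ j) (u t ω) =
      subMat (M.IQ j) Kplay *ᵥ subVec (M.IQ j) (x t ω) + subVec (M.IQ j) (η t ω) := by
    intro t ω
    rw [h.control, ← subVec_mulVec (M.closedOn_gain hK j)]
    rfl
  have hx : ∀ t ω, subVec (M.IQ j) (x (t + 1) ω) =
      subMat (M.IQ j) M.A *ᵥ subVec (M.IQ j) (x t ω) +
        subMat (M.IQ j) M.B *ᵥ subVec (M.IQ j) (u t ω) + subVec (M.IQ j) (w t ω) := by
    intro t ω
    rw [h.dynamics, ← subVec_mulVec (M.closedOn_A j), ← subVec_mulVec (M.closedOn_B j)]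
    rfl
  have hsx := measurable_subVec (n := nx) (M.IQ j)
  have hsu := measurable_subVec (n := nu) (M.IQ j)
  have hlη : ∀ t, HasLaw (fun ω => ση⁻¹ • subVec (M.IQ j) (η t ω)) (stdGauss (Idx (M.IQ j) nu)) μ :=
    fun t => hasLaw_stdGauss_comp (hasLaw_stdGauss_of_multivariateGaussian hη (h.law_η t)) (hinj nu)
  have hlw : ∀ t, HasLaw (fun ω => σw⁻¹ • subVec (M.IQ j) (w t ω)) (stdGauss (Idx (M.IQ j) nx)) μ :=
    fun t => hasLaw_stdGauss_comp (hasLaw_stdGauss_of_multivariateGaussian hw (h.law_w t)) (hinj nx)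
  have hz0 : ∀ ω, (subVec (M.IQ j) (x 0 ω), subVec (M.IQ j) (u 0 ω)) =
      (subVec (M.IQ j) (x 0 ω), subMat (M.IQ j) Kplay *ᵥ subVec (M.IQ j) (x 0 ω) +
        subVec (M.IQ j) (η 0 ω)) := fun ω => by rw [hu]
  have hKm : Measurable fun v : Idx (M.IQ j) nx → ℝ => subMat (M.IQ j) Kplay *ᵥ v := by
    refine measurable_pi_lambda _ fun i => ?_
    simp only [mulVec, dotProduct]
    fun_prop
  refine ⟨?_, ?_, ?_, ?_, ?_⟩
  · simp only [hz0]
    exact (hsx.comp_aemeasurable h.aemeasurable_init).prodMk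
      ((hKm.comp_aemeasurable (hsx.comp_aemeasurable h.aemeasurable_init)).add
        (hsu.comp_aemeasurable (h.aemeasurable_η 0)))
  · intro t
    refine hasLaw_stdGauss_sumElim (hlw t) (hlη (t + 1)) ?_
    have h1 : IndepFun (fun ω => (w t ω, η t ω)) (fun ω => (w (t + 1) ω, η (t + 1) ω)) μ :=
      h.indep_time.indepFun (by omega)
    exact h1.comp (φ := fun p => σw⁻¹ • subVec (M.IQ j) p.1)
      (ψ := fun p => ση⁻¹ • subVec (M.IQ j) p.2) ((hsx.comp measurable_fst).fun_const_smul _)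
      ((hsu.comp measurable_snd).fun_const_smul _)
  · intro t
    have h1 := h.indepFun_history t
    set H := (Fin N × Fin nx → ℝ) × ((Finset.range t → (Fin N × Fin nx → ℝ) × (Fin N × Fin nu → ℝ)) ×
      (Fin N × Fin nu → ℝ)) with hH
    -- The default value matters at `s = t`, where it has to be `η t`. Larger indices are never
    -- read, because `truncSeq t` uses `η (s + 1)` only for `s < t`.
    set ηAt : ℕ → H → Fin N × Fin nu → ℝ := fun s y =>
      if hs : s < t then (y.2.1 ⟨s, Finset.mem_range.2 hs⟩).2 else y.2.2 with hηAt
    set wAt : ℕ → H → Fin N × Fin nx → ℝ := fun s y =>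
      if hs : s < t then (y.2.1 ⟨s, Finset.mem_range.2 hs⟩).1 else 0 with hwAt
    have hηm : ∀ s, Measurable (ηAt s) := by
      intro s
      by_cases hs : s < t
      · simp only [hηAt, hs, dif_pos]; fun_prop
      · simp only [hηAt, hs, dif_neg, not_false_eq_true]; fun_prop
    have hwm : ∀ s, Measurable (wAt s) := by
      intro s
      by_cases hs : s < t
      · simp only [hwAt, hs, dif_pos]; fun_prop
      · simp only [hwAt, hs, dif_neg, not_false_eq_true]; fun_prop
    set φ : H → ((Idx (M.IQ j) nx → ℝ) × (Idx (M.IQ j) nu → ℝ)) ×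
        (ℕ → Idx (M.IQ j) nx ⊕ Idx (M.IQ j) nu → ℝ) := fun y =>
      ((subVec (M.IQ j) y.1, subMat (M.IQ j) Kplay *ᵥ subVec (M.IQ j) y.1 +
        subVec (M.IQ j) (ηAt 0 y)),
      truncSeq t fun s => Sum.elim (σw⁻¹ • subVec (M.IQ j) (wAt s y))
        (ση⁻¹ • subVec (M.IQ j) (ηAt (s + 1) y))) with hφ
    have hφm : Measurable φ := by
      refine Measurable.prodMk ((hsx.comp measurable_fst).prodMk
        ((hKm.comp (hsx.comp measurable_fst)).add (hsu.comp (hηm 0)))) ?_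
      refine measurable_pi_lambda _ fun s => ?_
      by_cases hs : s < t
      · simp only [truncSeq, hs, if_true]
        refine measurable_pi_lambda _ fun i => ?_
        rcases i with i | i
        · exact (measurable_pi_apply i).comp ((hsx.comp (hwm s)).fun_const_smul _)
        · exact (measurable_pi_apply i).comp ((hsu.comp (hηm (s + 1))).fun_const_smul _)
      · simp only [truncSeq, hs, if_false]
        exact measurable_const
    have hψ : Measurable fun p : (Fin N × Fin nx → ℝ) × (Fin N × Fin nu → ℝ) =>
        (Sum.elim (σw⁻¹ • subVec (M.IQ j) p.1) (ση⁻¹ • subVec (M.IQ j) p.2) :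
          Idx (M.IQ j) nx ⊕ Idx (M.IQ j) nu → ℝ) := by
      refine measurable_pi_lambda _ fun i => ?_
      rcases i with i | i
      · exact (measurable_pi_apply i).comp ((hsx.comp measurable_fst).fun_const_smul _)
      · exact (measurable_pi_apply i).comp ((hsu.comp measurable_snd).fun_const_smul _)
    have h2 := h1.comp hφm hψ
    have h3 : (fun ω => ((subVec (M.IQ j) (x 0 ω), subVec (M.IQ j) (u 0 ω)),
        truncSeq t fun s => (Sum.elim (σw⁻¹ • subVec (M.IQ j) (w s ω))
          (ση⁻¹ • subVec (M.IQ j) (η (s + 1) ω)) : Idx (M.IQ j) nx ⊕ Idx (M.IQ j) nu → ℝ))) =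
        φ ∘ fun ω => (x 0 ω, ((fun s : Finset.range t => (w s ω, η s ω)), η t ω)) := by
      have hηv : ∀ s ω, s ≤ t →
          ηAt s (x 0 ω, ((fun s : Finset.range t => (w s ω, η s ω)), η t ω)) = η s ω := by
        intro s ω hs
        by_cases hs' : s < t
        · simp [hηAt, hs']
        · have : s = t := by omega
          subst this
          simp [hηAt]
      have hwv : ∀ s ω, s < t →
          wAt s (x 0 ω, ((fun s : Finset.range t => (w s ω, η s ω)), η t ω)) = w s ω := by
        intro s ω hs
        simp [hwAt, hs]
      ext1 ω
      simp only [Function.comp, hφ, hz0, hηv 0 ω (Nat.zero_le t)]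
      congr 1
      ext1 s
      by_cases hs : s < t
      · simp only [truncSeq, hs, if_true, hηv (s + 1) ω hs, hwv s ω hs]
      · simp only [truncSeq, hs, if_false]
    rw [h3]
    exact h2
  · intro t ω
    have h1 : ∀ {k : Type} (c : ℝ) (v : k → ℝ), c ≠ 0 → c • (c⁻¹ • v) = v := fun c v hc => by
      rw [smul_smul, mul_inv_cancel₀ hc, one_smul]
    simp only [stepFun, Sum.elim_comp_inl, Sum.elim_comp_inr, h1 _ _ hw.ne', h1 _ _ hη.ne']
    rw [← hx, ← hu]
  -- The mean of the first step is a function of `x(0)` plus a function of `η(0)`; their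
  -- independence factorizes the moment.
  · intro v
    set L := subMat (M.IQ j) M.A + subMat (M.IQ j) M.B * subMat (M.IQ j) Kplay with hL
    set B' := subMat (M.IQ j) M.B with hB'
    have h1 : ∀ ω, v ⬝ᵥ (subMat (M.IQ j) M.A *ᵥ subVec (M.IQ j) (x 0 ω) +
        B' *ᵥ subVec (M.IQ j) (u 0 ω)) =
        (Lᵀ *ᵥ v) ⬝ᵥ subVec (M.IQ j) (x 0 ω) +
          (ση • (B'ᵀ *ᵥ v)) ⬝ᵥ (ση⁻¹ • subVec (M.IQ j) (η 0 ω)) := by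
      intro ω
      rw [hu, mulVec_add, mulVec_mulVec, ← add_assoc, ← add_mulVec, ← hL, dotProduct_add,
        smul_dotProduct, dotProduct_smul, smul_smul, mul_inv_cancel₀ hη.ne', one_smul,
        mulVec_transpose, mulVec_transpose, ← dotProduct_mulVec, ← dotProduct_mulVec]
    simp only [h1]
    rw [Real.exp_add, ENNReal.ofReal_mul (Real.exp_pos _).le]
    have h2 : ∀ a b : ℝ, ENNReal.ofReal (Real.exp (a + b)) =
        ENNReal.ofReal (Real.exp a) * ENNReal.ofReal (Real.exp b) := fun a b => by
      rw [Real.exp_add, ENNReal.ofReal_mul (Real.exp_pos _).le]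
    simp_rw [h2]
    have hf1 : Measurable fun y : Fin N × Fin nx → ℝ =>
        ENNReal.ofReal (Real.exp ((Lᵀ *ᵥ v) ⬝ᵥ subVec (M.IQ j) y)) := by
      simp only [dotProduct, subVec]; fun_prop
    have hf2 : Measurable fun y : Fin N × Fin nu → ℝ => ENNReal.ofReal
        (Real.exp ((ση • (B'ᵀ *ᵥ v)) ⬝ᵥ (ση⁻¹ • subVec (M.IQ j) y))) := by
      simp only [dotProduct, subVec, Pi.smul_apply]; fun_prop
    have hind : IndepFun (fun ω => ENNReal.ofReal (Real.exp ((Lᵀ *ᵥ v) ⬝ᵥ subVec (M.IQ j) (x 0 ω))))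
        (fun ω => ENNReal.ofReal
        (Real.exp ((ση • (B'ᵀ *ᵥ v)) ⬝ᵥ (ση⁻¹ • subVec (M.IQ j) (η 0 ω))))) μ := by
      have h2 : IndepFun (x 0) (η 0) μ :=
        h.indep_init.comp measurable_id (measurable_snd.comp (measurable_pi_apply 0))
      exact h2.comp hf1 hf2
    have hg1 : AEMeasurable (fun ω => ENNReal.ofReal
        (Real.exp ((Lᵀ *ᵥ v) ⬝ᵥ subVec (M.IQ j) (x 0 ω)))) μ :=
      hf1.comp_aemeasurable h.aemeasurable_init
    have hg2 : AEMeasurable (fun ω => ENNReal.ofReal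
        (Real.exp ((ση • (B'ᵀ *ᵥ v)) ⬝ᵥ (ση⁻¹ • subVec (M.IQ j) (η 0 ω))))) μ :=
      hf2.comp_aemeasurable (h.aemeasurable_η 0)
    rw [lintegral_mul_eq_lintegral_mul_lintegral_of_indepFun'' hg1 hg2 hind]
    rw [← h2, lintegral_exp_dotProduct_of_hasLaw (hlη 0), euclNorm_smul, mul_pow, sq_abs]
    exact mul_le_mul_left (h.lintegral_exp_init_le hS0 (M.IQ j) (Lᵀ *ᵥ v)) _

end IsRollout

end System

end

end CoopLQR

namespace CoopLQR

noncomputable section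

set_option linter.unusedSectionVars false

/-! ### Choice of the parameters -/

section Parameters

/-- `E` stands for `exp(1 - r)` and `F` for the cardinality of the grid times `exp(-l²)`. All other
parameters are at most `X`, so the powers `10` and `29` leave enough room for a total of `1 / X`. -/
lemma failure_le {X T nx n E F : ℝ} (hX : Real.exp 1 ≤ X) (hT0 : 0 ≤ T)
    (hT : T ≤ X) (hnx0 : 0 ≤ nx) (hnx : nx ≤ X) (hn0 : 0 ≤ n) (hn : n ≤ X) (hE0 : 0 ≤ E)
    (hE : E * X ^ 10 ≤ 3) (hF0 : 0 ≤ F) (hF : F * X ^ 29 ≤ 1) :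
    (T * nx + T * n) * (2 * E) + F + (nx ^ 2 + 1) * (T * (nx + 1) * (2 * E) + F) ≤ 1 / X := by
  have hX2 : 2.7 ≤ X := by linarith [Real.exp_one_gt_d9]
  have hX0 : 0 < X := by linarith
  have h1 : T * nx + T * n ≤ X ^ 2 * 2 := by nlinarith
  have h2 : nx ^ 2 + 1 ≤ 2 * X ^ 2 := by nlinarith
  have h3 : T * (nx + 1) ≤ 2 * X ^ 2 := by nlinarith
  have hX5 : (100 : ℝ) ≤ X ^ 5 := le_trans (by norm_num) (pow_le_pow_left₀ (by norm_num) hX2 5)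
  have hX9 : (1000 : ℝ) ≤ X ^ 9 := le_trans (by norm_num) (pow_le_pow_left₀ (by norm_num) hX2 9)
  have hE5 : E * X ^ 5 ≤ 3 / X ^ 5 := by
    rw [le_div_iff₀ (by positivity)]
    calc E * X ^ 5 * X ^ 5 = E * X ^ 10 := by ring
      _ ≤ 3 := hE
  have hE5' : E * X ^ 5 ≤ 3 / 100 :=
    hE5.trans (div_le_div_of_nonneg_left (by norm_num) (by norm_num) hX5)
  have hF3 : F * X ^ 3 ≤ 1 / 1000 := by
    have h4 : F * X ^ 3 * X ^ 9 ≤ 1 := by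
      calc F * X ^ 3 * X ^ 9 = F * X ^ 12 := by ring
        _ ≤ F * X ^ 29 := by
          refine mul_le_mul_of_nonneg_left (pow_le_pow_right₀ (by linarith) (by norm_num)) hF0
        _ ≤ 1 := hF
    have h5 : 0 ≤ F * X ^ 3 := by positivity
    nlinarith
  have hX1 : 1 ≤ X := by linarith
  have h6 : (T * nx + T * n) * (2 * E) ≤ X ^ 2 * 2 * (2 * E) :=
    mul_le_mul_of_nonneg_right h1 (by positivity)
  have h7 : (nx ^ 2 + 1) * (T * (nx + 1) * (2 * E) + F) ≤
      2 * X ^ 2 * (2 * X ^ 2 * (2 * E) + F) := by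
    refine mul_le_mul h2 (add_le_add_left (mul_le_mul_of_nonneg_right h3 (by positivity)) _)
      (by positivity) (by positivity)
  rw [le_div_iff₀ hX0]
  have h8 : E * X ^ 3 ≤ E * X ^ 5 :=
    mul_le_mul_of_nonneg_left (pow_le_pow_right₀ hX1 (by norm_num)) hE0
  have h9 : F * X ≤ F * X ^ 3 :=
    mul_le_mul_of_nonneg_left (le_self_pow₀ hX1 (by norm_num)) hF0
  calc ((T * nx + T * n) * (2 * E) + F + (nx ^ 2 + 1) * (T * (nx + 1) * (2 * E) + F)) * X ≤
      (X ^ 2 * 2 * (2 * E) + F + 2 * X ^ 2 * (2 * X ^ 2 * (2 * E) + F)) * X := by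
        refine mul_le_mul_of_nonneg_right ?_ hX0.le
        linarith
    _ = 4 * (E * X ^ 3) + F * X + 8 * (E * X ^ 5) + 2 * (F * X ^ 3) := by ring
    _ ≤ 1 := by linarith

/-- Counting powers gives a numerical constant times `X^18`, and `X^15 ≥ 2.7^15` absorbs the
constant. -/
lemma grid_size_le {X T kp n r σ' σw d l c : ℝ} (hX : Real.exp 1 ≤ X) (hT0 : 0 ≤ T) (hT : T ≤ X)
    (hkp0 : 0 ≤ kp) (hkp : kp ≤ X) (hn0 : 0 ≤ n) (hn : n ≤ X) (hr0 : 0 ≤ r) (hr : r ≤ 10 * X)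
    (hσ'0 : 0 ≤ σ') (hσ' : σ' ≤ X ^ 2) (hσw0 : 0 ≤ σw) (hσw : σw ≤ X) (hd0 : 0 ≤ d) (hd : d ≤ X)
    (hl0 : 0 ≤ l) (hl : l ≤ 8 * X ^ 2) (hc0 : 0 < c) (hc : 1 / c ≤ 192 * X ^ 3) :
    T * (kp * n * (r * (σ' + 2 * σw))) ^ 2 * d * (l / c) * (2 * T) ≤ X ^ 33 := by
  have hX2 : 2.7 ≤ X := by linarith [Real.exp_one_gt_d9]
  have hX0 : 0 < X := by linarith
  have h1 : σ' + 2 * σw ≤ 2 * X ^ 2 := by nlinarith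
  have h2 : l / c ≤ 8 * X ^ 2 * (192 * X ^ 3) := by
    rw [div_eq_mul_one_div]
    exact mul_le_mul hl hc (by positivity) (by positivity)
  have hX15 : (8 * 192 * 800 : ℝ) ≤ X ^ 15 :=
    le_trans (by norm_num) (pow_le_pow_left₀ (by norm_num) hX2 15)
  calc T * (kp * n * (r * (σ' + 2 * σw))) ^ 2 * d * (l / c) * (2 * T) ≤
      X * (X * X * (10 * X * (2 * X ^ 2))) ^ 2 * X * (8 * X ^ 2 * (192 * X ^ 3)) * (2 * X) := by
        gcongr
    _ = 8 * 192 * 800 * X ^ 18 := by ring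
    _ ≤ X ^ 15 * X ^ 18 := mul_le_mul_of_nonneg_right hX15 (by positivity)
    _ = X ^ 33 := by ring

/-- The grid has at most `X^(35 n²)` points, as `2N + 1 ≤ X^35` and `d ≤ n²`; the exponent `64 n²
log X` pays for this entropy and for the spare factor `X^29`. -/
lemma grid_card_mul_exp_le {X n l : ℝ} {N d : ℕ} (hX : Real.exp 1 ≤ X) (hn : 1 ≤ n)
    (hd : (d : ℝ) ≤ n ^ 2) (hN : (N : ℝ) ≤ X ^ 33 + 1) (hl : 64 * n ^ 2 * Real.log X ≤ l) :
    (2 * N + 1 : ℝ) ^ d * Real.exp (-l) * X ^ 29 ≤ 1 := by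
  have hX2 : 2.7 ≤ X := by linarith [Real.exp_one_gt_d9]
  have hX0 : 0 < X := by linarith
  have hlog : 1 ≤ Real.log X := (Real.le_log_iff_exp_le hX0).2 hX
  have hX1 : 1 ≤ X := by linarith
  have h1 : (2 * N + 1 : ℝ) ≤ X ^ 35 := by
    have h2 : 1 ≤ X ^ 33 := one_le_pow₀ hX1
    have h3 : X ^ 35 = X ^ 33 * X ^ 2 := by ring
    have h4 : (5 : ℝ) ≤ X ^ 2 := by nlinarith
    rw [h3]
    nlinarith
  have h2 : (2 * N + 1 : ℝ) ^ d ≤ Real.exp (35 * n ^ 2 * Real.log X) := by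
    refine (pow_le_pow_left₀ (by positivity) h1 d).trans ?_
    rw [← pow_mul]
    nth_rw 1 [← Real.exp_log hX0]
    rw [← Real.exp_nat_mul, Real.exp_le_exp]
    refine mul_le_mul_of_nonneg_right ?_ (by linarith)
    push_cast
    linarith
  have h3 : X ^ 29 = Real.exp (29 * Real.log X) := by
    nth_rw 1 [← Real.exp_log hX0]
    rw [← Real.exp_nat_mul]
    norm_num
  calc (2 * N + 1 : ℝ) ^ d * Real.exp (-l) * X ^ 29 ≤
      Real.exp (35 * n ^ 2 * Real.log X) * Real.exp (-l) * Real.exp (29 * Real.log X) := by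
        rw [h3]; gcongr
    _ = Real.exp (35 * n ^ 2 * Real.log X + -l + 29 * Real.log X) := by
        rw [← Real.exp_add, ← Real.exp_add]
    _ ≤ 1 := by
        refine Real.exp_le_one_iff.2 ?_
        have : 29 * Real.log X ≤ 29 * n ^ 2 * Real.log X := by
          refine mul_le_mul_of_nonneg_right ?_ (by linarith)
          nlinarith
        linarith

end Parameters

/-! ### The bound for one driven system with tuned parameters. -/

section Tuned

variable {Ω : Type*} [MeasurableSpace Ω] {μ : Measure Ω} [IsProbabilityMeasure μ]
  {ι κ : Type*} [Fintype ι] [DecidableEq ι] [Fintype κ] [DecidableEq κ]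
  {A : Matrix ι ι ℝ} {B : Matrix ι κ ℝ} {Kp : Matrix κ ι ℝ} {σw ση m₀ : ℝ}
  {z : ℕ → Ω → (ι → ℝ) × (κ → ℝ)} {g : ℕ → Ω → ι ⊕ κ → ℝ}

/-- The product of the system constants in the error bound. -/
def errorFactor (A : Matrix ι ι ℝ) (B : Matrix ι κ ℝ) (K Kp : Matrix κ ι ℝ) (σw ση σ τ ρ : ℝ) : ℝ :=
  specNormPlus Kp ^ 2 / ση ^ 2 * (σw * σ) *
    (τ ^ 2 * specNormPlus K ^ 4 * (1 + specNorm A ^ 2 + specNorm B ^ 2) / (ρ ^ 2 * (1 - ρ ^ 2)))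

/-- Both sides agree except for the factor `1 / ρ² ≥ 1` on the right, which is slack. -/
lemma invBound_mul_le_errorFactor {K : Matrix κ ι ℝ} {σ τ ρ : ℝ} (hρ0 : 0 < ρ) (hρ1 : ρ < 1)
    (hσ : 0 ≤ σ) (hw : 0 ≤ σw) :
    specNormPlus Kp ^ 2 / ση ^ 2 * (σw * σ) * (specNormPlus K ^ 2 * invBound A B K τ ρ) ≤
      errorFactor A B K Kp σw ση σ τ ρ := by
  have hρ : 0 < 1 - ρ ^ 2 := by nlinarith
  unfold errorFactor invBound
  refine mul_le_mul_of_nonneg_left ?_ (by positivity)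
  have h1 : specNormPlus K ^ 2 * (specNormPlus K ^ 2 * τ ^ 2 *
      (1 + specNorm A ^ 2 + specNorm B ^ 2) / (1 - ρ ^ 2)) =
      τ ^ 2 * specNormPlus K ^ 4 * (1 + specNorm A ^ 2 + specNorm B ^ 2) / (1 - ρ ^ 2) := by ring
  rw [h1]
  refine div_le_div_of_nonneg_left (by positivity) (by positivity) ?_
  exact mul_le_of_le_one_left hρ.le (by nlinarith)

lemma card_sym2_le {α : Type*} [Fintype α] [DecidableEq α] :
    Fintype.card (Sym2 α) ≤ Fintype.card α ^ 2 := by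
  have h := Fintype.card_le_of_surjective (fun p : α × α => s(p.1, p.2)) fun q => by
    induction q using Sym2.ind with
    | _ a b => exact ⟨(a, b), rfl⟩
  rwa [Fintype.card_prod, ← sq] at h

/-- With `Λ = log X` the choices are `l = 8 n Λ`, `r = 10 Λ` and grid parameter `⌈X^33⌉`. Then `20 l
r² = 16000 n Λ³`, and together with the `192` in `c` and the `2` of `lstdq_error_le` this gives `2 ·
192 · 16000 = 6144000`. -/
lemma IsDriven.measureReal_lstdq_bad_le_inv (h : IsDriven μ A B Kp σw ση m₀ z g)
    {K : Matrix κ ι ℝ} {τ ρ : ℝ} (hK : IsTauRhoStable τ ρ (A + B * K))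
    (hst : IsTauRhoStable τ ρ (A + B * Kp)) (hm₀ : 0 ≤ m₀) (hη : 0 < ση) (hησ : ση ≤ σw)
    {σ : ℝ} (hwσ : σw ≤ σ)
    (hσ : τ ^ 2 * ρ ^ 4 * m₀ +
      specNorm (lyap (A + B * Kp) (σw ^ 2 • 1 + ση ^ 2 • (B * Bᵀ))) ≤ σ ^ 2)
    (hn : 0 < Fintype.card (ι ⊕ κ)) {T : ℕ} {X : ℝ} (hX : Real.exp 1 ≤ X) (hTX : T ≤ X)
    (hKpX : specNormPlus Kp ≤ X) (hηX : 1 / ση ^ 2 ≤ X) (hm₀X : m₀ ≤ X) (hτX : τ ≤ X) (hσwX : σw ≤ X)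
    (hPX : specNorm (lyap (A + B * Kp) (σw ^ 2 • 1 + ση ^ 2 • (B * Bᵀ))) ≤ X)
    (hT : 6144000 ^ 2 * Real.log X ^ 6 * max ((Fintype.card (ι ⊕ κ) : ℝ) ^ 2)
      ((Fintype.card ι : ℝ) ^ 2 * (Fintype.card (ι ⊕ κ) : ℝ) ^ 2 *
        errorFactor A B K Kp σw ση σ τ ρ ^ 2) ≤ T)
    {Q : Matrix (ι ⊕ κ) (ι ⊕ κ) ℝ} (hQ : Q.IsSymm) {cost : Ω → ℕ → ℝ}
    (hcost : ∀ ω, (fun t : Fin T => cost ω (t + 1)) = dataMat T (fun t => z t ω) *ᵥ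
      (svec Q - svec ((closedLoop A B K)ᵀ * Q * closedLoop A B K))) :
    μ.real {ω | ¬ (IsUnit (lstdqMat T K σw (fun t => (z t ω).1) (fun t => (z t ω).2)).det ∧
      euclNorm (lstdq T K σw (fun t => (z t ω).1) (fun t => (z t ω).2) (cost ω) - svec Q) ≤
        6144000 * Real.log X ^ 3 * Fintype.card (ι ⊕ κ) / √T *
          errorFactor A B K Kp σw ση σ τ ρ * frobNorm Q)} ≤ 1 / X := by
  set n : ℝ := (Fintype.card (ι ⊕ κ) : ℝ) with hndef
  set nx : ℝ := (Fintype.card ι : ℝ) with hnxdef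
  set G := errorFactor A B K Kp σw ση σ τ ρ with hG
  set Λ := Real.log X with hΛ
  have hw : 0 < σw := hη.trans_le hησ
  have hσ0 : 0 < σ := hw.trans_le hwσ
  have ⟨hτ1, hρ0, hρ1, _⟩ := hst
  have hX2 : 2.7 ≤ X := by linarith [Real.exp_one_gt_d9]
  have hX0 : 0 < X := by linarith
  have hΛ1 : 1 ≤ Λ := (Real.le_log_iff_exp_le hX0).2 hX
  have hΛX : Λ ≤ X := (Real.log_le_sub_one_of_pos hX0).trans (by linarith)
  have hn1 : 1 ≤ n := by rw [hndef]; exact_mod_cast hn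
  have hnx0 : 0 ≤ nx := Nat.cast_nonneg _
  have hnxn : nx ≤ n := by
    rw [hndef, hnxdef, Fintype.card_sum, Nat.cast_add]
    linarith [Nat.cast_nonneg (α := ℝ) (Fintype.card κ)]
  have hΛ6 : 1 ≤ Λ ^ 6 := one_le_pow₀ hΛ1
  have hT1 : 6144000 ^ 2 * Λ ^ 6 * n ^ 2 ≤ T :=
    (mul_le_mul_of_nonneg_left (le_max_left _ _) (by positivity)).trans hT
  have hT2 : (6144000 * Λ ^ 3 * (nx * n * G)) ^ 2 ≤ T := by
    refine le_trans (le_of_eq ?_)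
      ((mul_le_mul_of_nonneg_left (le_max_right _ _) (by positivity)).trans hT)
    ring
  have hΛ2 : Λ ^ 2 ≤ Λ ^ 6 := pow_le_pow_right₀ hΛ1 (by norm_num)
  have hn2 : 1 ≤ n ^ 2 := one_le_pow₀ hn1
  have hT3 : 256 * (Λ ^ 2 * n ^ 2) ≤ T := by
    refine le_trans ?_ hT1
    have h1 : Λ ^ 2 * n ^ 2 ≤ Λ ^ 6 * n ^ 2 := mul_le_mul_of_nonneg_right hΛ2 (by positivity)
    have h2 : 0 ≤ Λ ^ 6 * n ^ 2 := by positivity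
    rw [mul_assoc]
    linarith
  have hΛn : 1 ≤ Λ ^ 2 * n ^ 2 := one_le_mul_of_one_le_of_one_le (one_le_pow₀ hΛ1) hn2
  have hnT : n ^ 2 ≤ T := by
    have h1 : n ^ 2 ≤ Λ ^ 2 * n ^ 2 := le_mul_of_one_le_left (by positivity) (one_le_pow₀ hΛ1)
    linarith
  have hT1' : (1 : ℝ) ≤ T := by linarith
  have hT0 : 0 < T := by
    have : (0 : ℝ) < T := by linarith
    exact_mod_cast this
  have hnX : n ≤ X := (le_self_pow₀ hn1 two_ne_zero).trans (hnT.trans hTX)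
  have hsT : 1 ≤ √(T : ℝ) := Real.one_le_sqrt.2 hT1'
  have hP : 1 ≤ specNormPlus Kp := one_le_specNormPlus _
  have hd : (Fintype.card (Sym2 (ι ⊕ κ)) : ℝ) ≤ n ^ 2 := by
    rw [hndef]; exact_mod_cast card_sym2_le
  have hdX : (Fintype.card (Sym2 (ι ⊕ κ)) : ℝ) ≤ X := hd.trans (hnT.trans hTX)
  set c := √T * (ση ^ 2 / specNormPlus Kp ^ 2) / 192 with hc
  have hc0 : 0 < c := by positivity
  have hcinv : 1 / c = 192 / √T * (specNormPlus Kp ^ 2 / ση ^ 2) := by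
    rw [hc]; field_simp
  have hcX : 1 / c ≤ 192 * X ^ 3 := by
    rw [hcinv]
    have h1 : specNormPlus Kp ^ 2 / ση ^ 2 ≤ X ^ 2 * X := by
      rw [div_eq_mul_one_div]
      exact mul_le_mul (pow_le_pow_left₀ (by linarith) hKpX 2) hηX (by positivity) (by positivity)
    have h2 : 192 / √(T : ℝ) ≤ 192 := div_le_self (by norm_num) hsT
    calc 192 / √(T : ℝ) * (specNormPlus Kp ^ 2 / ση ^ 2) ≤ 192 * (X ^ 2 * X) :=
          mul_le_mul h2 h1 (by positivity) (by norm_num)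
      _ = 192 * X ^ 3 := by ring
  set l := 8 * n * Λ with hl
  set r := 10 * Λ with hr
  have hl2 : l ^ 2 = 64 * (Λ ^ 2 * n ^ 2) := by rw [hl]; ring
  have hlr : 20 * l * r ^ 2 = 16000 * n * Λ ^ 3 := by rw [hl, hr]; ring
  obtain ⟨N, hN1, hN2⟩ : ∃ N : ℕ, X ^ 33 ≤ N ∧ (N : ℝ) ≤ X ^ 33 + 1 :=
    ⟨⌈X ^ 33⌉₊, Nat.le_ceil _, (Nat.ceil_lt_add_one (by positivity)).le⟩
  have hFG := invBound_mul_le_errorFactor (A := A) (B := B) (Kp := Kp) (K := K) (σw := σw)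
    (ση := ση) (τ := τ) hρ0 hρ1 hσ0.le hw.le
  rw [← hG] at hFG
  have hH0 : 0 ≤ invBound A B K τ ρ := by
    unfold invBound
    have hρ : 0 < 1 - ρ ^ 2 := sub_pos.2 (pow_lt_one₀ hρ0.le hρ1 two_ne_zero)
    positivity
  have hG0 : 0 ≤ G := le_trans (by positivity) hFG
  -- The crude scale of the states is taken to be `X²`; a power of `X` is enough, since it affects
  -- only the grid.
  have hσ' : τ ^ 2 * m₀ + specNorm (lyap (A + B * Kp) (σw ^ 2 • 1 + ση ^ 2 • (B * Bᵀ))) ≤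
      (X ^ 2) ^ 2 := by
    have h2 : τ ^ 2 * m₀ ≤ X ^ 2 * X :=
      mul_le_mul (pow_le_pow_left₀ (by linarith) hτX 2) hm₀X hm₀ (by positivity)
    have h3 : X ^ 2 * X + X ≤ (X ^ 2) ^ 2 := by
      have h4 : X ≤ X ^ 3 := le_self_pow₀ (by linarith) (by norm_num)
      have h5 : X ^ 3 * 2 ≤ X ^ 3 * X := mul_le_mul_of_nonneg_left (by linarith) (by positivity)
      calc X ^ 2 * X + X = X ^ 3 + X := by ring
        _ ≤ X ^ 3 * X := by linarith
        _ = (X ^ 2) ^ 2 := by ring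
    linarith
  have hl1 : 1 ≤ l := by
    have := one_le_mul_of_one_le_of_one_le hn1 hΛ1
    rw [hl, mul_assoc]
    linarith
  have hr1 : 1 ≤ r := by rw [hr]; linarith
  have hN0 : 0 < N := by
    have : (0 : ℝ) < N := lt_of_lt_of_le (by positivity) hN1
    exact_mod_cast this
  have hdN : 2 * (Fintype.card (Sym2 (ι ⊕ κ)) : ℝ) ≤ N := by
    have h3 : X ^ 2 ≤ X ^ 33 := pow_le_pow_right₀ (by linarith) (by norm_num)
    have h4 := mul_le_mul (show (2 : ℝ) ≤ X by linarith) hdX (by positivity) hX0.le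
    rw [← sq] at h4
    exact h4.trans (h3.trans hN1)
  have hlX : l ≤ 8 * X ^ 2 := by
    have := mul_le_mul hnX hΛX (by linarith) hX0.le
    rw [hl, mul_assoc, sq]
    linarith
  have hFN := (grid_size_le (r := r) hX (by positivity) hTX (by positivity) hKpX (by positivity) hnX
      (by positivity) (by rw [hr]; linarith) (by positivity) le_rfl hw.le hσwX (by positivity) hdX
      (by positivity) hlX hc0 hcX).trans hN1
  have hrT : T * (8 * Real.exp (-r / 2)) ≤ 1 := by
    have h2 : Real.exp (-r / 2) = (X ^ 5)⁻¹ := by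
      have h3 : -r / 2 = -((5 : ℕ) * Λ) := by rw [hr]; push_cast; ring
      rw [h3, Real.exp_neg, Real.exp_nat_mul, hΛ, Real.exp_log hX0]
    rw [h2, ← mul_assoc, ← div_eq_mul_inv, div_le_one (by positivity)]
    have h3 : (8 : ℝ) ≤ X ^ 4 := le_trans (by norm_num) (pow_le_pow_left₀ (by norm_num) hX2 4)
    calc (T : ℝ) * 8 ≤ X * X ^ 4 := mul_le_mul hTX h3 (by norm_num) hX0.le
      _ = X ^ 5 := by ring
  -- The absorption condition is the second entry of the maximum in `hT`, after taking square roots.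
  have hcond : 2 * (20 * l * r ^ 2 * (σw * σ) * Fintype.card ι * specNormPlus K ^ 2 *
      invBound A B K τ ρ) ≤ c := by
    rw [hlr, ← hnxdef]
    have h2 : 6144000 * Λ ^ 3 * (nx * n * G) ≤ √T := Real.le_sqrt_of_sq_le hT2
    have h3 : 6144000 * Λ ^ 3 * nx * n * (specNormPlus Kp ^ 2 / ση ^ 2 * (σw * σ) *
        (specNormPlus K ^ 2 * invBound A B K τ ρ)) ≤ √T := by
      refine le_trans (mul_le_mul_of_nonneg_left hFG (by positivity)) (le_trans (le_of_eq ?_) h2)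
      ring
    have h4 := mul_le_mul_of_nonneg_right h3
      (show 0 ≤ ση ^ 2 / specNormPlus Kp ^ 2 / 192 by positivity)
    refine le_trans (le_of_eq ?_) (h4.trans (le_of_eq ?_))
    · field_simp
      ring
    · rw [hc]; ring
  have h1 := h.measureReal_lstdq_bad_le hK hst hm₀ hη hησ hwσ hσ (by positivity) hσ' hT0 hl1 hr1 rfl
    hc hN0 hdN hFN hrT hcond hQ hcost
  refine le_trans (measureReal_mono fun ω hω => ?_) (h1.trans ?_)
  · simp only [Set.mem_ofPred_eq] at hω ⊢
    refine fun hgood => hω ⟨hgood.1, hgood.2.trans ?_⟩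
    rw [hlr]
    have h2 : 2 * invBound A B K τ ρ / c *
        (16000 * n * Λ ^ 3 * (σw * σ) * (specNormPlus K ^ 2 * frobNorm Q)) =
        6144000 * Λ ^ 3 * n / √T * (specNormPlus Kp ^ 2 / ση ^ 2 * (σw * σ) *
          (specNormPlus K ^ 2 * invBound A B K τ ρ)) * frobNorm Q := by
      rw [div_eq_mul_one_div _ c, hcinv]
      ring
    rw [h2]
    exact mul_le_mul_of_nonneg_right (mul_le_mul_of_nonneg_left hFG (by positivity))
      (frobNorm_nonneg _)
  · have hE : Real.exp (1 - r) * X ^ 10 ≤ 3 := by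
      have h3 : (1 : ℝ) - r = 1 - (10 : ℕ) * Λ := by rw [hr]; norm_num
      rw [h3, Real.exp_sub, Real.exp_nat_mul, hΛ, Real.exp_log hX0, div_mul_cancel₀ _ (by positivity)]
      linarith [Real.exp_one_lt_d9]
    set F := (2 * N + 1 : ℝ) ^ Fintype.card (Sym2 (ι ⊕ κ)) * Real.exp (-l ^ 2) with hF
    have hF1 : F * X ^ 29 ≤ 1 := grid_card_mul_exp_le hX hn1 hd hN2 (by
      rw [hl2]
      have := mul_le_mul_of_nonneg_left (le_self_pow₀ hΛ1 two_ne_zero) (sq_nonneg n)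
      linarith)
    -- Since `T / 4 ≥ 64 n² Λ² = l²` by `hT3`, the failure term of the lower bound is dominated by
    -- that of the noise grid.
    have hF2 : (2 * N + 1 : ℝ) ^ Fintype.card (Sym2 (ι ⊕ κ)) * Real.exp (-(T / 4)) ≤ F := by
      refine mul_le_mul_of_nonneg_left (Real.exp_le_exp.2 ?_) (by positivity)
      rw [hl2]
      linarith
    have h3 := failure_le hX (by linarith : (0 : ℝ) ≤ T) hTX hnx0 (hnxn.trans hnX) (by linarith) hnX
      (Real.exp_pos (1 - r)).le hE (by positivity) hF1
    linarith

end Tuned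

end

end CoopLQR

namespace CoopLQR

noncomputable section

/-! ### The estimates of the agents -/

/-- From `log y = 6 log (y^(1/6)) ≤ 6 (y^(1/6) - 1)`: the sixth power of a logarithm grows at most
linearly. This carries the sample size condition from `Tmin j` to a larger `T`. -/
lemma add_log_pow_six_le {y a : ℝ} (hy : 1 ≤ y) (ha : 1 ≤ a) :
    (a + Real.log y) ^ 6 ≤ 6 ^ 6 * y * a ^ 6 := by
  set q := y ^ (1 / 6 : ℝ) with hq
  have hy0 : 0 < y := by linarith
  have hq0 : 0 < q := Real.rpow_pos_of_pos hy0 _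
  have hq1 : 1 ≤ q := Real.one_le_rpow hy (by norm_num)
  have hq6 : q ^ 6 = y := by
    rw [hq, ← Real.rpow_natCast, ← Real.rpow_mul hy0.le]
    norm_num
  have h1 : Real.log y ≤ 6 * (q - 1) := by
    rw [← hq6, Real.log_pow]
    have := Real.log_le_sub_one_of_pos hq0
    push_cast
    linarith
  have h2 : a + Real.log y ≤ 6 * q * a := by nlinarith
  have h3 : 0 ≤ a + Real.log y := add_nonneg (by linarith) (Real.log_nonneg hy)
  calc (a + Real.log y) ^ 6 ≤ (6 * q * a) ^ 6 := pow_le_pow_left₀ h3 h2 6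
    _ = 6 ^ 6 * q ^ 6 * a ^ 6 := by ring
    _ = 6 ^ 6 * y * a ^ 6 := by rw [hq6]

namespace System

variable {N nx nu : ℕ} (M : System N nx nu)
  {Kplay : Matrix (Fin N × Fin nu) (Fin N × Fin nx) ℝ} {σw ση : ℝ}
  {x₀ : Fin N × Fin nx → ℝ} {Sigma₀ : Matrix (Fin N × Fin nx) (Fin N × Fin nx) ℝ} {τ δ : ℝ}

lemma card_idx (s : Finset (Fin N)) (n : ℕ) : Fintype.card (Idx s n) = n * s.card := by
  rw [Fintype.card_prod, Fintype.card_coe, Fintype.card_fin, mul_comm]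

lemma one_le_logTerm (hτ : 0 ≤ τ) (hδ : 0 < δ) (m T : ℕ) (j : Fin N) :
    1 ≤ M.logTerm Kplay σw ση x₀ Sigma₀ τ δ m T j := by
  have h1 := specNorm_nonneg (initMoment x₀ Sigma₀)
  have h2 := specNorm_nonneg (subMat (M.IQ j) Kplay)
  have h3 := specNorm_nonneg (M.statCov Kplay σw ση j)
  have h4 : 0 ≤ m * T / δ + 1 / ση ^ 4 + τ + M.dimX j := by positivity
  have h5 := Real.exp_pos 1
  rw [logTerm, Real.le_log_iff_exp_le (by linarith)]
  linarith

/-- The logarithmic factor grows at most linearly in the number of samples. -/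
lemma logTerm_pow_mul_le (hτ : 0 ≤ τ) (hδ : 0 < δ) (m : ℕ) {S T : ℕ} (hS : 0 < S) (hST : S ≤ T)
    (j : Fin N) :
    M.logTerm Kplay σw ση x₀ Sigma₀ τ δ m T j ^ 6 * S ≤
      6 ^ 6 * T * M.logTerm Kplay σw ση x₀ Sigma₀ τ δ m S j ^ 6 := by
  have hS' : (0 : ℝ) < S := by exact_mod_cast hS
  have hST' : (S : ℝ) ≤ T := by exact_mod_cast hST
  have hT0 : (0 : ℝ) < T := by linarith
  have hy : 1 ≤ (T : ℝ) / S := (one_le_div hS').2 hST'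
  have h0 := M.one_le_logTerm (Kplay := Kplay) (σw := σw) (ση := ση) (x₀ := x₀) (Sigma₀ := Sigma₀)
    hτ hδ m T j
  have h1 := M.one_le_logTerm (Kplay := Kplay) (σw := σw) (ση := ση) (x₀ := x₀) (Sigma₀ := Sigma₀)
    hτ hδ m S j
  have h2 : M.logTerm Kplay σw ση x₀ Sigma₀ τ δ m T j ≤
      M.logTerm Kplay σw ση x₀ Sigma₀ τ δ m S j + Real.log (T / S) := by
    have e1 := specNorm_nonneg (initMoment x₀ Sigma₀)
    have e2 := specNorm_nonneg (subMat (M.IQ j) Kplay)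
    have e3 := specNorm_nonneg (M.statCov Kplay σw ση j)
    have e4 : 0 ≤ (m : ℝ) * S / δ := by positivity
    have e5 : 0 ≤ 1 / ση ^ 4 := by positivity
    have e6 : (0 : ℝ) ≤ M.dimX j := Nat.cast_nonneg _
    have e7 := Real.exp_pos 1
    have e8 : (m : ℝ) * T / δ = T / S * (m * S / δ) := by field_simp
    have e9 : 0 ≤ (m : ℝ) * T / δ := by positivity
    unfold logTerm
    rw [← Real.log_mul (by positivity) (by positivity)]
    refine Real.log_le_log (by positivity) ?_
    rw [e8]
    generalize hR : 1 / ση ^ 4 = a at *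
    nlinarith [mul_nonneg (sub_nonneg.2 hy) e7.le, mul_nonneg (sub_nonneg.2 hy) e5,
      mul_nonneg (sub_nonneg.2 hy) hτ, mul_nonneg (sub_nonneg.2 hy) e6,
      mul_nonneg (sub_nonneg.2 hy) e1, mul_nonneg (sub_nonneg.2 hy) e2,
      mul_nonneg (sub_nonneg.2 hy) e3]
  have h3 := (pow_le_pow_left₀ (by linarith) h2 6).trans (add_log_pow_six_le hy h1)
  calc _ ≤ 6 ^ 6 * ((T : ℝ) / S) * M.logTerm Kplay σw ση x₀ Sigma₀ τ δ m S j ^ 6 * S :=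
        mul_le_mul_of_nonneg_right h3 hS'.le
    _ = _ := by field_simp

variable {Ω : Type*} [MeasurableSpace Ω] {μ : Measure Ω} [IsProbabilityMeasure μ]
  {x w : ℕ → Ω → Fin N × Fin nx → ℝ} {u η : ℕ → Ω → Fin N × Fin nu → ℝ}
  {K : Matrix (Fin N × Fin nu) (Fin N × Fin nx) ℝ} {ρ : ℝ}

/-- The first term of the Lyapunov series already dominates `σw² I`. It lets `logTerm` control `σw`,
which does not occur in it explicitly. -/
lemma sq_le_specNorm_statCov {j : Fin N} (hx : 0 < M.dimX j)
    (hst : IsTauRhoStable τ ρ (subMat (M.IQ j) M.A + subMat (M.IQ j) M.B * subMat (M.IQ j) Kplay)) :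
    σw ^ 2 ≤ specNorm (M.statCov Kplay σw ση j) := by
  have h1 : 0 < Fintype.card (Idx (M.IQ j) nx) := by rw [card_idx]; exact hx
  obtain ⟨k⟩ := Fintype.card_pos_iff.1 h1
  have h2 := IsDriven.sum_noise_le_lyap hst (subMat (M.IQ j) M.B) σw ση (Pi.single k 1) 1
  have h3 : euclNorm (Pi.single k 1 : Idx (M.IQ j) nx → ℝ) = 1 := by
    rw [euclNorm_eq_sqrt]; simp [Pi.single_apply]
  simp only [Finset.range_one, Finset.sum_singleton, pow_zero, one_mulVec, h3, one_pow, mul_one]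
    at h2
  have h4 : 0 ≤ ση ^ 2 * euclNorm ((subMat (M.IQ j) M.B)ᵀ *ᵥ Pi.single k 1) ^ 2 := by positivity
  exact le_trans (by linarith) h2

/-- The Bellman equation for the costs of agent `j`. -/
lemma cost_eq_dataMat_mulVec {j : Fin N}
    (hK : IsTauRhoStable τ ρ (subMat (M.IQ j) M.A + subMat (M.IQ j) M.B * subMat (M.IQ j) K))
    (T : ℕ) (y : ℕ → Fin N × Fin nx → ℝ) (v : ℕ → Fin N × Fin nu → ℝ) :
    (fun t : Fin T => M.cost j (y (t + 1)) (v (t + 1))) =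
      dataMat T (fun t => (subVec (M.IQ j) (y t), subVec (M.IQ j) (v t))) *ᵥ
      (svec (M.qTrue K j) - svec ((closedLoop (subMat (M.IQ j) M.A) (subMat (M.IQ j) M.B)
        (subMat (M.IQ j) K))ᵀ * M.qTrue K j *
        closedLoop (subMat (M.IQ j) M.A) (subMat (M.IQ j) M.B) (subMat (M.IQ j) K))) := by
  have h1 := phiMat_mulVec_qMat T hK (M.isSymm_costS j (M.IQ j)) (M.isSymm_costR j (M.IQ j))
    (fun t => subVec (M.IQ j) (y t)) (fun t => subVec (M.IQ j) (v t))
  change phiMat T _ _ *ᵥ (svec (M.qTrue K j) - svec (_ * smat (svec (M.qTrue K j)) * _)) = _ at h1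
  rw [smat_svec (M.isSymm_qTrue K j)] at h1
  rw [h1]
  ext t
  rw [M.cost_eq]

/-- The estimate of one agent. -/
lemma IsRollout.measureReal_agentLstdq_bad_le
    (h : M.IsRollout μ Kplay σw ση x₀ Sigma₀ x w u η) (hKp : M.IsStructuredGain Kplay)
    (hS0 : Sigma₀.PosSemidef) (hη : 0 < ση) (hησ : ση ≤ σw) (hδ : 0 < δ) (hδ1 : δ < 1)
    {m : ℕ} (hm : 0 < m) {j : Fin N} (hx : 0 < M.dimX j)
    (hK : IsTauRhoStable τ ρ (subMat (M.IQ j) M.A + subMat (M.IQ j) M.B * subMat (M.IQ j) K))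
    (hst : IsTauRhoStable τ ρ (subMat (M.IQ j) M.A + subMat (M.IQ j) M.B * subMat (M.IQ j) Kplay))
    {T : ℕ} (hT : 6144000 ^ 2 * M.logTerm Kplay σw ση x₀ Sigma₀ τ δ m T j ^ 6 *
      max (((M.dimX j + M.dimU j : ℕ) : ℝ) ^ 2)
        ((M.dimX j : ℝ) ^ 2 * ((M.dimX j + M.dimU j : ℕ) : ℝ) ^ 2 *
          M.sysFactor K Kplay σw ση x₀ Sigma₀ τ ρ j ^ 2) ≤ (T : ℝ)) :
    μ.real {ω | ¬ (IsUnit (M.agentLstdqMat K σw T (fun t => x t ω) (fun t => u t ω) j).det ∧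
      euclNorm (M.agentLstdq K σw T (fun t => x t ω) (fun t => u t ω) j - svec (M.qTrue K j)) ≤
        6144000 * M.logTerm Kplay σw ση x₀ Sigma₀ τ δ m T j ^ 3 *
          ((M.dimX j + M.dimU j : ℕ) : ℝ) / √T *
          M.sysFactor K Kplay σw ση x₀ Sigma₀ τ ρ j * frobNorm (M.qTrue K j))} ≤ δ / m := by
  have hw : 0 < σw := hη.trans_le hησ
  have hτ1 : 1 ≤ τ := hst.1
  have hcx : Fintype.card (Idx (M.IQ j) nx) = M.dimX j := card_idx _ _
  have hcn : Fintype.card (Idx (M.IQ j) nx ⊕ Idx (M.IQ j) nu) = M.dimX j + M.dimU j := by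
    rw [Fintype.card_sum, card_idx, card_idx]; rfl
  have hT1 : (1 : ℝ) ≤ T := by
    refine le_trans ?_ hT
    have h1 := M.one_le_logTerm (Kplay := Kplay) (σw := σw) (ση := ση) (x₀ := x₀)
      (Sigma₀ := Sigma₀) (by linarith : 0 ≤ τ) hδ m T j
    have h2 : (1 : ℝ) ≤ ((M.dimX j + M.dimU j : ℕ) : ℝ) := by
      have : 1 ≤ M.dimX j + M.dimU j := by omega
      exact_mod_cast this
    exact one_le_mul_of_one_le_of_one_le
      (one_le_mul_of_one_le_of_one_le (by norm_num) (one_le_pow₀ h1))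
      (le_max_of_le_left (one_le_pow₀ h2))
  have hm1 : (1 : ℝ) ≤ m := by exact_mod_cast hm
  have e1 := specNorm_nonneg (initMoment x₀ Sigma₀)
  have e2 := specNorm_nonneg (subMat (M.IQ j) Kplay)
  have e3 := specNorm_nonneg (M.statCov Kplay σw ση j)
  have e4 : 0 ≤ (m : ℝ) * T / δ := by positivity
  have e5 : 0 ≤ 1 / ση ^ 4 := by positivity
  have e6 : (0 : ℝ) ≤ M.dimX j := Nat.cast_nonneg _
  have e7 := Real.exp_one_gt_d9
  -- `logTerm` is the logarithm of this `X`; each of its summands is there to dominate one of the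
  -- parameters, or to make the failure probability small.
  obtain ⟨X, hX⟩ : ∃ X : ℝ, X = Real.exp 1 + m * T / δ + 1 / ση ^ 4 + τ + M.dimX j +
    specNorm (initMoment x₀ Sigma₀) + specNorm (subMat (M.IQ j) Kplay) +
    specNorm (M.statCov Kplay σw ση j) := ⟨_, rfl⟩
  have hlog : M.logTerm Kplay σw ση x₀ Sigma₀ τ δ m T j = Real.log X := by rw [hX]; rfl
  have hXδ : m * T / δ ≤ X := by linarith
  have hTX : (T : ℝ) ≤ X := by
    refine le_trans ?_ hXδ
    rw [le_div_iff₀ hδ, mul_comm (m : ℝ)]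
    exact mul_le_mul_of_nonneg_left (hδ1.le.trans hm1) (by linarith)
  -- `2a ≤ a² + 1` with `a = 1/ση²`, where `1/ση⁴` and `exp 1` are summands of `X`.
  have hηX : 1 / ση ^ 2 ≤ X := by
    have h1 : 1 / ση ^ 4 = (1 / ση ^ 2) ^ 2 := by field_simp
    have h2 := two_mul_le_add_sq (1 / ση ^ 2) 1
    linarith
  have hPw := M.sq_le_specNorm_statCov (σw := σw) (ση := ση) hx hst
  have hσwX : σw ≤ X := by
    have h2 := two_mul_le_add_sq σw 1
    linarith
  have hσ2 : M.sigmaBar Kplay σw ση x₀ Sigma₀ τ ρ j ^ 2 =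
      τ ^ 2 * ρ ^ 4 * specNorm (subMat (M.IQ j) (initMoment x₀ Sigma₀)) +
      specNorm (M.statCov Kplay σw ση j) + σw ^ 2 +
      ση ^ 2 * specNorm (subMat (M.IQ j) M.B) ^ 2 := by
    have := specNorm_nonneg (subMat (M.IQ j) (initMoment x₀ Sigma₀))
    exact Real.sq_sqrt (by positivity)
  have e8 : 0 ≤ τ ^ 2 * ρ ^ 4 * specNorm (subMat (M.IQ j) (initMoment x₀ Sigma₀)) :=
    mul_nonneg (by positivity) (specNorm_nonneg _)
  have e9 : 0 ≤ ση ^ 2 * specNorm (subMat (M.IQ j) M.B) ^ 2 := by positivity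
  have e10 := sq_nonneg σw
  have hwσ : σw ≤ M.sigmaBar Kplay σw ση x₀ Sigma₀ τ ρ j := by
    refine Real.le_sqrt_of_sq_le ?_
    linarith
  have hQ := M.isSymm_qTrue K j
  have hcost := fun ω => M.cost_eq_dataMat_mulVec hK T (fun t => x t ω) (fun t => u t ω)
  have hmain := (h.isDriven hKp hS0 hη hw j).measureReal_lstdq_bad_le_inv (X := X) hK hst
    (specNorm_nonneg _) hη hησ hwσ (by
      change _ + specNorm (M.statCov Kplay σw ση j) ≤ _
      rw [hσ2]; linarith) (by rw [hcn]; omega)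
    (by linarith) hTX (by unfold specNormPlus; linarith) hηX
    ((specNorm_subMat_le _ _).trans (by linarith)) (by linarith) hσwX
    (by change specNorm (M.statCov Kplay σw ση j) ≤ _; linarith)
    (by rw [hcn, hcx, ← hlog]; exact hT) hQ
    (cost := fun ω t => M.cost j (x t ω) (u t ω)) hcost
  rw [hcn, ← hlog] at hmain
  refine hmain.trans ?_
  have hX0 : 0 < X := by linarith
  -- The summand `m T / δ` of `X` gives `1 / X ≤ δ / (m T) ≤ δ / m`.
  rw [div_le_div_iff₀ hX0 (by linarith), one_mul]
  rw [div_le_iff₀ hδ] at hXδ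
  linarith [le_mul_of_one_le_right (show (0 : ℝ) ≤ m by linarith) hT1]

end System

end

end CoopLQR

/-! ### The union bound over the agents. -/

open CoopLQR in
theorem mainTheorem5 :
    ∃ (C : ℝ) (p : ℕ), 0 < C ∧
      ∀ (N nx nu : ℕ) (_ : 0 < nx) (_ : 0 < nu) (M : CoopLQR.System N nx nu)
        (K Kplay : Matrix (Fin N × Fin nu) (Fin N × Fin nx) ℝ)
        (_ : M.IsStructuredGain K) (_ : M.IsStructuredGain Kplay)
        (σw ση : ℝ) (_ : 0 < ση) (_ : ση ≤ σw)
        (x₀ : Fin N × Fin nx → ℝ) (Sigma₀ : Matrix (Fin N × Fin nx) (Fin N × Fin nx) ℝ)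
        (_ : Sigma₀.PosSemidef)
        (Ω : Type*) (_ : MeasurableSpace Ω) (μ : MeasureTheory.Measure Ω)
        (_ : MeasureTheory.IsProbabilityMeasure μ)
        (x w : ℕ → Ω → Fin N × Fin nx → ℝ) (u η : ℕ → Ω → Fin N × Fin nu → ℝ)
        (_ : M.IsRollout μ Kplay σw ση x₀ Sigma₀ x w u η)
        (δ : ℝ) (_ : 0 < δ) (_ : δ < 1) (i : Fin N) (τ ρ : Fin N → ℝ)
        (_ : ∀ j ∈ M.IGD i,
          CoopLQR.IsTauRhoStable (τ j) (ρ j)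
            (CoopLQR.subMat (M.IQ j) M.A +
              CoopLQR.subMat (M.IQ j) M.B * CoopLQR.subMat (M.IQ j) K) ∧
          CoopLQR.IsTauRhoStable (τ j) (ρ j)
            (CoopLQR.subMat (M.IQ j) M.A +
              CoopLQR.subMat (M.IQ j) M.B * CoopLQR.subMat (M.IQ j) Kplay))
        (Tmin : Fin N → ℕ)
        (_ : ∀ j ∈ M.IGD i,
          C * M.logTerm Kplay σw ση x₀ Sigma₀ (τ j) δ (M.IGD i).card (Tmin j) j ^ p *
              max (((M.dimX j + M.dimU j : ℕ) : ℝ) ^ 2)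
                ((M.dimX j : ℝ) ^ 2 * ((M.dimX j + M.dimU j : ℕ) : ℝ) ^ 2 *
                  M.sysFactor K Kplay σw ση x₀ Sigma₀ (τ j) (ρ j) j ^ 2)
            ≤ (Tmin j : ℝ))
        (T : ℕ) (_ : ∀ j ∈ M.IGD i, Tmin j ≤ T),
        1 - δ ≤ μ.real {ω |
          (∀ j ∈ M.IGD i,
            IsUnit (M.agentLstdqMat K σw T (fun t => x t ω) (fun t => u t ω) j).det) ∧
          CoopLQR.euclNorm (CoopLQR.svec (M.qHatTrue K i) -
              M.qIndirect K σw T (fun t => x t ω) (fun t => u t ω) i) ≤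
            ∑ j ∈ M.IGD i,
              C * M.logTerm Kplay σw ση x₀ Sigma₀ (τ j) δ (M.IGD i).card T j ^ p *
                ((M.dimX j + M.dimU j : ℕ) : ℝ) / Real.sqrt T *
                M.sysFactor K Kplay σw ση x₀ Sigma₀ (τ j) (ρ j) j *
                CoopLQR.frobNorm (M.qTrue K j)} := by
  -- The factor `6^6` pays for comparing the logarithms at `Tmin j` and `T`, and `6144000²` is the
  -- requirement for one agent. The exponent `6` is twice that of the `log³` in the error, because
  -- the condition on `T` is its square.
  refine ⟨6 ^ 6 * 6144000 ^ 2, 6, by norm_num, ?_⟩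
  intro N nx nu hnx hnu M K Kplay hK hKp σw ση hη hησ x₀ Sigma₀ hS0 Ω _ μ _ x w u η h δ hδ hδ1 i τ ρ
    hst Tmin hTmin T hT
  set m := (M.IGD i).card with hm
  have hdim : ∀ j ∈ M.IGD i, 0 < M.dimX j := by
    intro j hj
    have h1 : i ∈ M.IQ j := (Finset.mem_filter.1 hj).2
    exact Nat.mul_pos hnx (Finset.card_pos.2 ⟨i, h1⟩)
  have hτ0 : ∀ j ∈ M.IGD i, 0 ≤ τ j := fun j hj => zero_le_one.trans (hst j hj).1.1
  have hbad : ∀ j ∈ M.IGD i, _ := fun j hj =>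
    h.measureReal_agentLstdq_bad_le (T := T) (m := m) M hKp hS0 hη hησ hδ hδ1
      (Finset.card_pos.2 ⟨j, hj⟩) (hdim j hj) (hst j hj).1 (hst j hj).2 (by
        have h1 := hTmin j hj
        set D := max (((M.dimX j + M.dimU j : ℕ) : ℝ) ^ 2)
          ((M.dimX j : ℝ) ^ 2 * ((M.dimX j + M.dimU j : ℕ) : ℝ) ^ 2 *
            M.sysFactor K Kplay σw ση x₀ Sigma₀ (τ j) (ρ j) j ^ 2)
        have hD : 1 ≤ D := by
          refine le_max_of_le_left (one_le_pow₀ ?_)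
          have := hdim j hj
          have h2 : 1 ≤ M.dimX j + M.dimU j := by omega
          exact_mod_cast h2
        have hL := M.one_le_logTerm (Kplay := Kplay) (σw := σw) (ση := ση) (x₀ := x₀)
          (Sigma₀ := Sigma₀) (hτ0 j hj) hδ m (Tmin j) j
        have hpos : (0 : ℝ) < Tmin j := lt_of_lt_of_le (by positivity) h1
        have h2 := M.logTerm_pow_mul_le (Kplay := Kplay) (σw := σw) (ση := ση) (x₀ := x₀)
          (Sigma₀ := Sigma₀) (hτ0 j hj) hδ m (by exact_mod_cast hpos) (hT j hj) j
        -- The condition is given at `Tmin j` but needed at `T`. Multiplying by `Tmin j` makes the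
        -- almost linear growth of the sixth power of the logarithm applicable.
        refine le_of_mul_le_mul_right ?_ hpos
        set LT := M.logTerm Kplay σw ση x₀ Sigma₀ (τ j) δ m T j
        set LS := M.logTerm Kplay σw ση x₀ Sigma₀ (τ j) δ m (Tmin j) j
        calc 6144000 ^ 2 * LT ^ 6 * D * Tmin j = 6144000 ^ 2 * D * (LT ^ 6 * Tmin j) := by ring
          _ ≤ 6144000 ^ 2 * D * (6 ^ 6 * T * LS ^ 6) :=
              mul_le_mul_of_nonneg_left h2 (by positivity)
          _ = T * (6 ^ 6 * 6144000 ^ 2 * LS ^ 6 * D) := by ring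
          _ ≤ T * Tmin j := mul_le_mul_of_nonneg_left h1 (by positivity))
  have hunion := measureReal_exists_mem_le (μ := μ) (M.IGD i) hbad
  have hcard : ((M.IGD i).card : ℝ) * (δ / m) ≤ δ := by
    rw [← hm]
    -- `IGD i` may be empty, since an agent need not enter any cost; then `δ / m` is `0` by
    -- convention.
    rcases Nat.eq_zero_or_pos m with h0 | h0
    · rw [h0]; simpa using hδ.le
    · have : (0 : ℝ) < m := by exact_mod_cast h0
      rw [mul_div_cancel₀ _ this.ne']
  have htot := hunion.trans hcard
  have huniv : (1 : ℝ) = μ.real Set.univ := by simp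
  rw [sub_le_iff_le_add, huniv]
  refine le_trans ?_ ((MeasureTheory.measureReal_union_le _ _).trans (add_le_add_right htot _))
  refine MeasureTheory.measureReal_mono fun ω _ => ?_
  by_cases hω : ∃ j ∈ M.IGD i, ¬ (IsUnit
      (M.agentLstdqMat K σw T (fun t => x t ω) (fun t => u t ω) j).det ∧
      euclNorm (M.agentLstdq K σw T (fun t => x t ω) (fun t => u t ω) j - svec (M.qTrue K j)) ≤
        6144000 * M.logTerm Kplay σw ση x₀ Sigma₀ (τ j) δ m T j ^ 3 *
          ((M.dimX j + M.dimU j : ℕ) : ℝ) / √T *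
          M.sysFactor K Kplay σw ση x₀ Sigma₀ (τ j) (ρ j) j * frobNorm (M.qTrue K j))
  · exact Or.inr hω
  · refine Or.inl ?_
    push Not at hω
    refine ⟨fun j hj => (hω j hj).1, ?_⟩
    refine (M.euclNorm_qHatTrue_sub_qIndirect_le hK (fun j hj => (hst j hj).1) σw T _ _).trans
      (Finset.sum_le_sum fun j hj => (hω j hj).2.trans ?_)
    have hL := M.one_le_logTerm (Kplay := Kplay) (σw := σw) (ση := ση) (x₀ := x₀)
      (Sigma₀ := Sigma₀) (hτ0 j hj) hδ m T j
    obtain ⟨-, hρ0, hρ1, -⟩ := (hst j hj).1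
    have hF := frobNorm_nonneg (M.qTrue K j)
    have hG : 0 ≤ M.sysFactor K Kplay σw ση x₀ Sigma₀ (τ j) (ρ j) j := by
      unfold System.sysFactor
      have h1 : 0 ≤ M.sigmaBar Kplay σw ση x₀ Sigma₀ (τ j) (ρ j) j := Real.sqrt_nonneg _
      have h2 : 0 < 1 - ρ j ^ 2 := sub_pos.2 (pow_lt_one₀ hρ0.le hρ1 two_ne_zero)
      have hw : 0 < σw := hη.trans_le hησ
      have := one_le_specNormPlus (subMat (M.IQ j) K)
      positivity
    -- The error bound of one agent has only the third power of the logarithm; as `logTerm` is at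
    -- least `1`, the common exponent `6` is weaker.
    have hL36 := pow_le_pow_right₀ hL (show 3 ≤ 6 by norm_num)
    gcongr
    norm_num
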